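/- **Grid.** For $k\in\mathbb N$ let $G_k=\{\frac{j}{2^k}-\frac12+2^{-k-1} : j\in\{0,\dots,2^k-1\}\}\subset(-\frac12,\frac12)$ and let $G_k^n$ be its $n$-fold Cartesian product; an element of $G_k^n$ is encoded by $n\times k$ bits (the binary digits of the $n$ indices $j$). **Unitary $\delta$-approximator.** Let $X$ be a finite set encoded by bit strings, $f:X\to\mathbb R$, and let $Y$ be the $b$-bit fixed-point numbers $a_0+a\sum_{j<b}y_j2^j$ ($y_j\in\{0,1\}$, with fixed $a_0,a\in\mathbb R$). A $b$-bit unitary $\delta$-approximator of $f$ is a unitary $U$ on a query register, a $b$-qubit answer register and a workspace register of qubits such that for all $x\in X$ $$U|x,0,0\rangle=\sum_{y\in Y}\alpha_{x,y}|x,y,\psi_{x,y}\rangle ,\qquad \sum_{y:\,|f(x)-y|\le\delta}|\alpha_{x,y}|^2\ge\tfrac23 ,$$ where the $|\psi_{x,y}\rangle$ are normalized states. **Algorithms.** A quantum query algorithm is a circuit of gates acting on at most two qubits (arbitrary unitaries) and of queries to $U$ and $U^\dagger$, started in the all-zero state and followed by a measurement of all qubits; its output $\tilde g\in\mathbb R^n$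 is read off as fixed-point numbers from $n$ disjoint blocks of qubits. Its gate complexity is the total number of gates, a query being counted as one gate. **Theorem (gradient computation using a unitary $\delta$-approximator).** Let $n\ge1$, $\delta,B,r>0$, $\rho\in(0,1/3]$, and assume that $m:=\left\lceil\log_2\left(\frac{B}{28\pi\delta}\right)\right\rceil\ge0$. Let $b=O(\log(B/\delta))$, and fix a $b$-bit fixed-point format and a number of workspace qubits. There is a quantum query algorithm, depending only on these data, which uses $O\big(\log\frac n\rho\big)$ queries to $U$ and $U^\dagger$, has gate complexity $$O\Big(n\log\big(\tfrac n\rho\big)\log\big(\tfrac B\delta\big)\log\log\big(\tfrac n\rho\big)\log\log\big(\tfrac B\delta\big)\Big),$$ and has the following property. Let $x_0,g\in\mathbb R^n$ with $\|g\|_\infty\le\frac Br$, let $c\in\mathbb R$, and let $f:(x_0+rG_m^n)\to\mathbb R$ satisfy $$\left|f(x_0+rx)-\langle g,rx\rangle-c\right|\le\delta$$ for at least $99.9\%$ of the points $x\in G_m^n$. If $U$ is a $b$-bit unitary $\delta$-approximator of $f$ over the domain $x_0+rG_m^n$ (with points $x_0+rx$ encoded by the encoding of $x$), then the output $\tilde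 g$ of the algorithm run with $U$ satisfies $$\Pr\left[\,\|\tilde g-g\|_\infty>\frac{8\cdot42\pi\delta}{r}\right]\le\rho .$$ The constant in the query bound is absolute; the constant in the gate bound depends only on the constant in $b=O(\log(B/\delta))$. -/

import Mathlib

noncomputable section

/-- The natural number with binary digits `z`, least significant bit first. -/
def bitsToNat {k : ℕ} (z : Fin k → Bool) : ℕ :=
  ∑ j : Fin k, if z j then 2 ^ (j : ℕ) else 0

/-- The value of a `b`-bit fixed-point number `z` with offset `a₀` and resolution `a`. -/
def fixedPoint (a₀ a : ℝ) {b : ℕ} (z : Fin b → Bool) : ℝ :=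
  a₀ + a * (bitsToNat z : ℝ)

/-- The point `j / 2^k - 1/2 + 2^(-k-1)` of the one-dimensional grid. -/
def gridCoord (k j : ℕ) : ℝ :=
  (j : ℝ) / 2 ^ k - 1 / 2 + 1 / 2 ^ (k + 1)

/-- The grid `G_k`, a discretization of the interval `(-1/2, 1/2)`. -/
def grid (k : ℕ) : Finset ℝ :=
  (Finset.range (2 ^ k)).image (gridCoord k)

/-- The hyper-grid `G_k^n`. -/
def hyperGrid (n k : ℕ) : Finset (Fin n → ℝ) :=
  Fintype.piFinset fun _ => grid k

/-- The point of `G_k^n` represented by `n × k` bits. -/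
def gridPoint {n k : ℕ} (x : Fin n × Fin k → Bool) : Fin n → ℝ :=
  fun i => gridCoord k (bitsToNat fun j => x (i, j))

/-- `U` is a relational quantum oracle for the valid-answer sets `F x` with error probability at
most `ε`: it is a unitary on three registers of qubits (query `ι`, answer `κ`, workspace `ω`) with
`U |x, 0, 0⟩ = ∑ y, α y |x, y, ψ y⟩`, each `ψ y` normalized, and `∑_{y ∈ F x} |α y|² ≥ 1 - ε`. -/
def IsRelationalOracle {ι κ ω : Type} [Fintype ι] [DecidableEq ι] [Fintype κ] [DecidableEq κ]
    [Fintype ω] [DecidableEq ω] (F : (ι → Bool) → Set (κ → Bool)) (ε : ℝ)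
    (U : Matrix (ι ⊕ κ ⊕ ω → Bool) (ι ⊕ κ ⊕ ω → Bool) ℂ) : Prop :=
  U ∈ Matrix.unitaryGroup (ι ⊕ κ ⊕ ω → Bool) ℂ ∧
  ∀ x : ι → Bool, ∃ (α : (κ → Bool) → ℂ) (ψ : (κ → Bool) → (ω → Bool) → ℂ),
    (∀ y, ∑ v, ‖ψ y v‖ ^ 2 = 1) ∧
    (∀ x' y v, U (Sum.elim x' (Sum.elim y v))
        (Sum.elim x (Sum.elim (fun _ => false) fun _ => false)) =
      if x' = x then α y * ψ y v else 0) ∧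
    1 - ε ≤ ∑ y, (F x).indicator (fun y => ‖α y‖ ^ 2) y

/-- A `b`-bit unitary `δ`-approximator of a function `f` of a bit string: a relational oracle whose
valid answers are the fixed-point numbers that differ from `f x` by at most `δ`, with success
probability at least `2/3`. -/
def IsUnitaryApproximator {ι ω : Type} [Fintype ι] [DecidableEq ι] [Fintype ω] [DecidableEq ω]
    {b : ℕ} (a₀ a δ : ℝ) (f : (ι → Bool) → ℝ)
    (U : Matrix (ι ⊕ Fin b ⊕ ω → Bool) (ι ⊕ Fin b ⊕ ω → Bool) ℂ) : Prop :=
  IsRelationalOracle (fun x => {y | |f x - fixedPoint a₀ a y| ≤ δ}) (1 / 3) U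

/-- The matrix `V`, acting on qubits labelled by `ι`, applied to the qubits `e i` of a register
with qubits `κ`, and the identity on all the others. -/
def applyOn {ι κ : Type} [Fintype ι] [DecidableEq ι] (e : ι ↪ κ)
    (V : Matrix (ι → Bool) (ι → Bool) ℂ) (φ : (κ → Bool) → ℂ) : (κ → Bool) → ℂ :=
  fun s => ∑ t : ι → Bool, V (s ∘ e) t * φ (Function.extend e t s)

/-- One instruction of a circuit on `N` qubits with oracle access to an unknown unitary on qubits
labelled by `Q`: an arbitrary gate on at most two qubits, a query to the unknown unitary, or a query
to its adjoint. -/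
inductive CircuitOp (Q : Type) (N : ℕ) : Type
  | gate (k : ℕ) (hk : k ≤ 2) (e : Fin k ↪ Fin N) (V : Matrix.unitaryGroup (Fin k → Bool) ℂ)
  | query (e : Q ↪ Fin N)
  | queryAdjoint (e : Q ↪ Fin N)

namespace CircuitOp

/-- Whether an instruction is a query to the oracle or to its adjoint. -/
def isQuery {Q : Type} {N : ℕ} : CircuitOp Q N → Bool
  | gate _ _ _ _ => false
  | query _ => true
  | queryAdjoint _ => true

/-- The effect of an instruction on a state vector, when the oracle is `U`. -/
def apply {Q : Type} [Fintype Q] [DecidableEq Q] {N : ℕ}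
    (U : Matrix (Q → Bool) (Q → Bool) ℂ) : CircuitOp Q N →
      ((Fin N → Bool) → ℂ) → ((Fin N → Bool) → ℂ)
  | gate _ _ e V, φ => applyOn e V.1 φ
  | query e, φ => applyOn e U φ
  | queryAdjoint e, φ => applyOn e U.conjTranspose φ

end CircuitOp

/-- A quantum query algorithm that outputs a vector with `n` real coordinates: a circuit on
`qubits` qubits, started in the all-zero state, after which all qubits are measured; the `i`-th
coordinate of the output is the `prec`-bit fixed-point number found in the qubits `out (i, ·)`. -/
structure QueryAlgorithm (Q : Type) (n : ℕ) where
  qubits : ℕ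
  ops : List (CircuitOp Q qubits)
  prec : ℕ
  out : Fin n × Fin prec ↪ Fin qubits
  offset : ℝ
  scale : ℝ

namespace QueryAlgorithm

/-- The number of queries to the oracle and to its adjoint. -/
def queryCount {Q : Type} {n : ℕ} (A : QueryAlgorithm Q n) : ℕ :=
  A.ops.countP CircuitOp.isQuery

/-- The gate complexity: the number of all instructions, a query being counted as one gate. -/
def gateCount {Q : Type} {n : ℕ} (A : QueryAlgorithm Q n) : ℕ :=
  A.ops.length

/-- The state just before the measurement, when the oracle is `U`. -/
def finalState {Q : Type} [Fintype Q] [DecidableEq Q] {n : ℕ} (A : QueryAlgorithm Q n)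
    (U : Matrix (Q → Bool) (Q → Bool) ℂ) : (Fin A.qubits → Bool) → ℂ :=
  A.ops.foldl (fun φ op => op.apply U φ) (Pi.single (fun _ => false) 1)

/-- The output vector that is read off from the measurement outcome `z`. -/
def output {Q : Type} {n : ℕ} (A : QueryAlgorithm Q n) (z : Fin A.qubits → Bool) : Fin n → ℝ :=
  fun i => fixedPoint A.offset A.scale fun j => z (A.out (i, j))

/-- The probability that the output lies in `S`, when the oracle is `U`. -/
def outputProb {Q : Type} [Fintype Q] [DecidableEq Q] {n : ℕ} (A : QueryAlgorithm Q n)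
    (U : Matrix (Q → Bool) (Q → Bool) ℂ) (S : Set (Fin n → ℝ)) : ℝ :=
  ∑ z, (A.output ⁻¹' S).indicator (fun z => ‖A.finalState U z‖ ^ 2) z

end QueryAlgorithm

end

/-!
The algorithm is Jordan's gradient algorithm, made robust against an oracle that leaves garbage in the
workspace and sometimes gives wrong answers and against a function that is far from linear at a few
points, and then amplified by medians.

*One run.* Hadamard gates prepare the uniform superposition of all grid points. The oracle is called
`127` times with the same query register and separate answer and workspace registers. A reversible
circuit computes the median of the answers, single-qubit gates on its bits apply the phase
`2π σ` times the median, with `σ = 1 / (112 π δ)`, and the median and the answers are uncomputed, the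
latter by `127` adjoint calls. At every grid point, the median is within `δ` of `f` except with
probability `1/1000`, by a Chernoff bound (`sum_prod_majority_bad_le`). As `f` is nearly linear at
almost all grid points, the state is close in norm to the one obtained from the exact phase of the
linear function (`sum_normSq_phase_sub_le`), and unitarity carries this estimate to the end of the
run. The ideal
state is a product over the coordinates, and a Fourier transform of each coordinate register reads
`σ r gᵢ` up to `3` with good probability. Rotations of the Fourier transform by very small angles are
omitted, which reduces its size from quadratic to `O(m log m)`; since each bit of the outcome has an
explicit conditional probability given the bits read before, the loss is bounded by a telescoping
argument on these conditional probabilities (`IsBitChain.sum_abs_sub_le`, `sum_truncated_far_le`). All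
together, each coordinate is right with probability at least `2/3` (`exists_run`).

*Amplification.* `T = O(log (n / ρ))` independent runs are followed by the median of the readings of
each coordinate, which fails with probability at most `((4/3) / √2) ^ T ≤ ρ / n`
(`exists_medianAlgorithm`, `exists_repetitions`).

*Gate count.* The median of `T` numbers of `b` bits is computed with `O(T b log T)` gates, without
sorting. Its bits are found from the leading one on, as
majorities: a number that differs from the median in some bit keeps voting with that bit
(`Derives.exists_median`). Majorities are computed by counting in binary, and any Boolean circuit runs
reversibly with one ancilla for each gate (`Derives.exists_flips`).

Circuits are built on arbitrary finite types of wires and translated to numbered qubits at the end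
(`exists_queryAlgorithm`). If `m ≤ 3`, the tolerance exceeds `B / r` and the output `0` is correct.
-/

noncomputable section

/-! ### Applying a matrix to a subset of the wires -/

section ApplyOn

variable {ι κ κ' : Type}

theorem extend_comp_embedding (e : ι ↪ κ) (t : ι → Bool) (s : κ → Bool) :
    Function.extend e t s ∘ e = t :=
  Function.extend_comp e.injective t s

theorem extend_restrict (e : ι ↪ κ) (s : κ → Bool) : Function.extend e (s ∘ e) s = s := by
  funext w
  by_cases h : ∃ i, e i = w
  · obtain ⟨i, rfl⟩ := h
    simp [e.injective.extend_apply]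
  · exact Function.extend_apply' _ _ _ h

theorem extend_extend (e : ι ↪ κ) (t t' : ι → Bool) (s : κ → Bool) :
    Function.extend e t (Function.extend e t' s) = Function.extend e t s := by
  funext w
  by_cases h : ∃ i, e i = w
  · obtain ⟨i, rfl⟩ := h
    simp [e.injective.extend_apply]
  · simp [Function.extend_apply' _ _ _ h]

theorem extend_trans_comp (e : ι ↪ κ) (j : κ ↪ κ') (t : ι → Bool) (s : κ' → Bool) :
    Function.extend (e.trans j) t s ∘ j = Function.extend e t (s ∘ j) := by
  funext w
  by_cases h : ∃ i, e i = w
  · obtain ⟨i, rfl⟩ := h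
    have := (e.trans j).injective.extend_apply t s i
    simpa [e.injective.extend_apply] using this
  · have h' : ¬ ∃ i, (e.trans j) i = j w := by
      rintro ⟨i, hi⟩
      exact h ⟨i, j.injective hi⟩
    simp [Function.extend_apply' _ _ _ h, Function.extend_apply' _ _ _ h']

/-- Exchanging the contents of the wires in the range of `e` with those of a separate register is
an involution. -/
theorem involutive_exchange (e : ι ↪ κ) : Function.Involutive
    (fun p : (κ → Bool) × (ι → Bool) => (Function.extend e p.2 p.1, p.1 ∘ e)) := by
  rintro ⟨s, t⟩
  simp [extend_extend, extend_restrict, extend_comp_embedding]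

/-- A function of the state does not depend on the wires in the range of `j`. -/
def IndepOf (j : κ ↪ κ') (ψ : (κ' → Bool) → ℂ) : Prop :=
  ∀ s s' : κ' → Bool, (∀ w, w ∉ Set.range j → s w = s' w) → ψ s = ψ s'

variable [Fintype ι] [DecidableEq ι]

theorem applyOn_trans (e : ι ↪ κ) (j : κ ↪ κ') (V : Matrix (ι → Bool) (ι → Bool) ℂ)
    (φ : (κ → Bool) → ℂ) (ψ : (κ' → Bool) → ℂ) (hψ : IndepOf j ψ) :
    applyOn (e.trans j) V (fun s => φ (s ∘ j) * ψ s) =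
      fun s => applyOn e V φ (s ∘ j) * ψ s := by
  funext s
  simp only [applyOn, Finset.sum_mul]
  refine Finset.sum_congr rfl fun t _ => ?_
  rw [extend_trans_comp]
  have : ψ (Function.extend (e.trans j) t s) = ψ s := by
    apply hψ
    intro w hw
    apply Function.extend_apply'
    rintro ⟨i, rfl⟩
    exact hw ⟨e i, rfl⟩
  rw [this, ← mul_assoc]
  rfl

theorem applyOn_applyOn (e : ι ↪ κ) (V W : Matrix (ι → Bool) (ι → Bool) ℂ)
    (φ : (κ → Bool) → ℂ) : applyOn e V (applyOn e W φ) = applyOn e (V * W) φ := by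
  funext s
  simp only [applyOn, extend_comp_embedding, extend_extend, Matrix.mul_apply, Finset.sum_mul,
    Finset.mul_sum]
  rw [Finset.sum_comm]
  simp only [mul_assoc]

theorem applyOn_diagonal (e : ι ↪ κ) (d : (ι → Bool) → ℂ) (φ : (κ → Bool) → ℂ) :
    applyOn e (Matrix.diagonal d) φ = fun s => d (s ∘ e) * φ s := by
  funext s
  simp only [applyOn, Matrix.diagonal_apply]
  rw [Finset.sum_eq_single (s ∘ e)]
  · simp [extend_restrict]
  · intro t _ ht
    simp [ht.symm]
  · simp

theorem applyOn_one (e : ι ↪ κ) (φ : (κ → Bool) → ℂ) : applyOn e 1 φ = φ := by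
  rw [← Matrix.diagonal_one, applyOn_diagonal]
  simp

theorem applyOn_sub (e : ι ↪ κ) (V : Matrix (ι → Bool) (ι → Bool) ℂ) (φ ψ : (κ → Bool) → ℂ) :
    applyOn e V (φ - ψ) = applyOn e V φ - applyOn e V ψ := by
  funext s
  simp [applyOn, mul_sub, Finset.sum_sub_distrib]

variable [Fintype κ] [DecidableEq κ]

/-- The adjoint of `applyOn e V` is `applyOn e V.conjTranspose`. -/
theorem sum_star_mul_applyOn (e : ι ↪ κ) (V : Matrix (ι → Bool) (ι → Bool) ℂ)
    (φ ψ : (κ → Bool) → ℂ) :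
    ∑ s, star (ψ s) * applyOn e V φ s = ∑ s, star (applyOn e V.conjTranspose ψ s) * φ s := by
  simp only [applyOn, Finset.mul_sum, star_sum, Finset.sum_mul]
  rw [← Fintype.sum_prod_type', ← Fintype.sum_prod_type',
    ← Equiv.sum_comp (involutive_exchange e).toPerm]
  refine Finset.sum_congr rfl fun p _ => ?_
  simp only [Function.Involutive.coe_toPerm, extend_comp_embedding, extend_extend, extend_restrict,
    star_mul', Matrix.conjTranspose_apply, star_star]
  ring

theorem sum_normSq_applyOn (e : ι ↪ κ) {V : Matrix (ι → Bool) (ι → Bool) ℂ}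
    (hV : V ∈ Matrix.unitaryGroup (ι → Bool) ℂ) (φ : (κ → Bool) → ℂ) :
    ∑ s, ‖applyOn e V φ s‖ ^ 2 = ∑ s, ‖φ s‖ ^ 2 := by
  have key : ∀ χ : (κ → Bool) → ℂ, ((∑ s, ‖χ s‖ ^ 2 : ℝ) : ℂ) = ∑ s, star (χ s) * χ s := by
    intro χ
    push_cast
    refine Finset.sum_congr rfl fun s _ => ?_
    rw [← Complex.conj_mul']
    rfl
  have h : ((∑ s, ‖applyOn e V φ s‖ ^ 2 : ℝ) : ℂ) = ((∑ s, ‖φ s‖ ^ 2 : ℝ) : ℂ) := by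
    rw [key, key, sum_star_mul_applyOn, applyOn_applyOn]
    have : V.conjTranspose * V = 1 := Matrix.mem_unitaryGroup_iff'.1 hV
    rw [this, applyOn_one]
  exact_mod_cast h

end ApplyOn

/-! ### Circuits on an arbitrary set of wires -/

/-- An instruction of a circuit whose wires are labelled by an arbitrary type `κ`. -/
inductive WireOp (Q κ : Type) : Type
  | gate (k : ℕ) (hk : k ≤ 2) (e : Fin k ↪ κ) (V : Matrix.unitaryGroup (Fin k → Bool) ℂ)
  | query (e : Q ↪ κ)
  | queryAdjoint (e : Q ↪ κ)

namespace WireOp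

variable {Q κ κ' : Type}

/-- Relabelling of the wires. -/
def map (j : κ ↪ κ') : WireOp Q κ → WireOp Q κ'
  | gate k hk e V => gate k hk (e.trans j) V
  | query e => query (e.trans j)
  | queryAdjoint e => queryAdjoint (e.trans j)

/-- The instruction as one of a circuit on `N` numbered qubits. -/
def toCircuitOp {N : ℕ} : WireOp Q (Fin N) → CircuitOp Q N
  | gate k hk e V => .gate k hk e V
  | query e => .query e
  | queryAdjoint e => .queryAdjoint e

/-- Whether the instruction is a query to the oracle or to its adjoint. -/
def isQuery : WireOp Q κ → Bool
  | gate _ _ _ _ => false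
  | query _ => true
  | queryAdjoint _ => true

@[simp] theorem isQuery_map (j : κ ↪ κ') (op : WireOp Q κ) : (op.map j).isQuery = op.isQuery := by
  cases op <;> rfl

@[simp] theorem isQuery_toCircuitOp {N : ℕ} (op : WireOp Q (Fin N)) :
    op.toCircuitOp.isQuery = op.isQuery := by
  cases op <;> rfl

variable [Fintype Q] [DecidableEq Q]

/-- The effect of an instruction on a state vector, when the oracle is `U`. -/
def apply (U : Matrix (Q → Bool) (Q → Bool) ℂ) : WireOp Q κ →
      ((κ → Bool) → ℂ) → ((κ → Bool) → ℂ)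
  | gate _ _ e V, φ => applyOn e V.1 φ
  | query e, φ => applyOn e U φ
  | queryAdjoint e, φ => applyOn e U.conjTranspose φ

/-- The effect of a list of instructions, executed from left to right. -/
def run (U : Matrix (Q → Bool) (Q → Bool) ℂ) (L : List (WireOp Q κ)) (φ : (κ → Bool) → ℂ) :
    (κ → Bool) → ℂ :=
  L.foldl (fun φ op => op.apply U φ) φ

variable (U : Matrix (Q → Bool) (Q → Bool) ℂ)

@[simp] theorem run_nil (φ : (κ → Bool) → ℂ) : run U [] φ = φ := rfl

@[simp] theorem run_cons (op : WireOp Q κ) (L : List (WireOp Q κ)) (φ : (κ → Bool) → ℂ) :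
    run U (op :: L) φ = run U L (op.apply U φ) := rfl

@[simp] theorem run_append (L L' : List (WireOp Q κ)) (φ : (κ → Bool) → ℂ) :
    run U (L ++ L') φ = run U L' (run U L φ) := by
  simp [run]

theorem apply_toCircuitOp {N : ℕ} (op : WireOp Q (Fin N)) (φ : (Fin N → Bool) → ℂ) :
    op.toCircuitOp.apply U φ = op.apply U φ := by
  cases op <;> rfl

theorem foldl_toCircuitOp {N : ℕ} (L : List (WireOp Q (Fin N))) (φ : (Fin N → Bool) → ℂ) :
    (L.map toCircuitOp).foldl (fun φ op => op.apply U φ) φ = run U L φ := by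
  induction L generalizing φ with
  | nil => rfl
  | cons op L ih => simp [ih, apply_toCircuitOp]

/-- A circuit on some of the wires acts on the corresponding tensor factor of a product state. -/
theorem run_map (j : κ ↪ κ') (L : List (WireOp Q κ)) (φ : (κ → Bool) → ℂ) (ψ : (κ' → Bool) → ℂ)
    (hψ : IndepOf j ψ) :
    run U (L.map (map j)) (fun s => φ (s ∘ j) * ψ s) = fun s => run U L φ (s ∘ j) * ψ s := by
  induction L generalizing φ with
  | nil => rfl
  | cons op L ih =>
    rw [List.map_cons, run_cons, run_cons, ← ih]
    congr 1
    cases op <;> exact applyOn_trans _ _ _ _ _ hψ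

theorem run_sub (L : List (WireOp Q κ)) (φ ψ : (κ → Bool) → ℂ) :
    run U L (φ - ψ) = run U L φ - run U L ψ := by
  induction L generalizing φ ψ with
  | nil => rfl
  | cons op L ih =>
    rw [run_cons, run_cons, run_cons, ← ih]
    congr 1
    cases op <;> exact applyOn_sub _ _ _ _

variable {U} in
theorem sum_normSq_run [Fintype κ] [DecidableEq κ] (hU : U ∈ Matrix.unitaryGroup (Q → Bool) ℂ)
    (L : List (WireOp Q κ)) (φ : (κ → Bool) → ℂ) :
    ∑ s, ‖run U L φ s‖ ^ 2 = ∑ s, ‖φ s‖ ^ 2 := by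
  induction L generalizing φ with
  | nil => rfl
  | cons op L ih =>
    rw [run_cons, ih]
    cases op with
    | gate k hk e V => exact sum_normSq_applyOn e V.2 φ
    | query e => exact sum_normSq_applyOn e hU φ
    | queryAdjoint e => exact sum_normSq_applyOn e (Unitary.star_mem hU) φ

/-- The same circuit executed on each of several disjoint sets of wires acts on each factor of a
product state. -/
theorem run_flatMap_map {T : Type} [Fintype T] [DecidableEq T] (j : T → κ ↪ κ')
    (hj : ∀ t t' w w', j t w = j t' w' → t = t') (C : List (WireOp Q κ)) (l : List T)
    (hl : l.Nodup) (χ : T → (κ → Bool) → ℂ) (ψ : (κ' → Bool) → ℂ) (hψ : ∀ t, IndepOf (j t) ψ) :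
    run U (l.flatMap fun t => C.map (map (j t))) (fun s => (∏ t, χ t (s ∘ j t)) * ψ s) =
      fun s => (∏ t, (if t ∈ l then run U C (χ t) else χ t) (s ∘ j t)) * ψ s := by
  induction l generalizing χ with
  | nil => simp
  | cons t₀ l ih =>
    rw [List.flatMap_cons, run_append]
    have h1 : (fun s : κ' → Bool => (∏ t, χ t (s ∘ j t)) * ψ s) =
        fun s => χ t₀ (s ∘ j t₀) * ((∏ t ∈ Finset.univ.erase t₀, χ t (s ∘ j t)) * ψ s) := by
      funext s
      rw [← mul_assoc, Finset.mul_prod_erase Finset.univ (fun t => χ t (s ∘ j t))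
        (Finset.mem_univ t₀)]
    have h2 : IndepOf (j t₀)
        (fun s => (∏ t ∈ Finset.univ.erase t₀, χ t (s ∘ j t)) * ψ s) := by
      intro s s' h
      have h3 : ψ s = ψ s' := hψ t₀ s s' h
      simp only [h3]
      congr 1
      refine Finset.prod_congr rfl fun t ht => ?_
      congr 1
      funext w
      apply h
      rintro ⟨w', hw'⟩
      exact (Finset.ne_of_mem_erase ht) (hj _ _ _ _ hw').symm
    rw [h1, run_map U (j t₀) C _ _ h2]
    have h4 : (fun s : κ' → Bool => run U C (χ t₀) (s ∘ j t₀) *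
          ((∏ t ∈ Finset.univ.erase t₀, χ t (s ∘ j t)) * ψ s)) =
        fun s => (∏ t, (Function.update χ t₀ (run U C (χ t₀))) t (s ∘ j t)) * ψ s := by
      funext s
      rw [← Finset.mul_prod_erase Finset.univ _ (Finset.mem_univ t₀), ← mul_assoc]
      congr 1
      rw [Function.update_self]
      congr 1
      refine Finset.prod_congr rfl fun t ht => ?_
      rw [Function.update_of_ne (Finset.ne_of_mem_erase ht)]
    rw [h4, ih (List.nodup_cons.1 hl).2]
    funext s
    congr 1
    refine Finset.prod_congr rfl fun t _ => ?_
    by_cases h : t = t₀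
    · subst h
      simp [(List.nodup_cons.1 hl).1]
    · simp [h]

end WireOp

/-! ### Hadamard and phase gates -/

namespace WireOp

variable {Q κ : Type}

/-- The Hadamard matrix. -/
def hadamardMatrix : Matrix (Fin 1 → Bool) (Fin 1 → Bool) ℂ :=
  Matrix.of fun s t => (if s 0 && t 0 then -1 else 1) / (Real.sqrt 2 : ℂ)

theorem sqrt_two_mul_sqrt_two : (Real.sqrt 2 : ℂ) * (Real.sqrt 2 : ℂ) = 2 := by
  rw [← Complex.ofReal_mul, Real.mul_self_sqrt (by norm_num)]
  norm_num

theorem sqrt_two_ne_zero : (Real.sqrt 2 : ℂ) ≠ 0 := by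
  intro h
  have := sqrt_two_mul_sqrt_two
  simp [h] at this

theorem sum_fin_one_bool {M : Type} [AddCommMonoid M] (f : (Fin 1 → Bool) → M) :
    ∑ t, f t = f (fun _ => false) + f (fun _ => true) := by
  rw [← Equiv.sum_comp (Equiv.funUnique (Fin 1) Bool).symm, Fintype.sum_bool, add_comm]
  rfl

theorem hadamardMatrix_mem : hadamardMatrix ∈ Matrix.unitaryGroup (Fin 1 → Bool) ℂ := by
  rw [Matrix.mem_unitaryGroup_iff]
  have h2 := sqrt_two_mul_sqrt_two
  have h0 := sqrt_two_ne_zero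
  ext s t
  rw [Matrix.mul_apply, sum_fin_one_bool]
  have hs : s = (fun _ => s 0) := by funext i; fin_cases i; rfl
  have ht : t = (fun _ => t 0) := by funext i; fin_cases i; rfl
  have hst : (s = t) ↔ (s 0 = t 0) := by
    constructor
    · rintro rfl; rfl
    · intro h; rw [hs, ht, h]
  simp only [Matrix.star_apply, hadamardMatrix, Matrix.of_apply, Matrix.one_apply, hst]
  cases s 0 <;> cases t 0 <;> simp <;> field_simp <;> simp [sq, h2] <;> norm_num

/-- A wire as a register of length one. -/
def wire1 (a : κ) : Fin 1 ↪ κ := ⟨fun _ => a, fun i j _ => Subsingleton.elim i j⟩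

/-- Two wires as a register of length two. -/
def wire2 (a b : κ) (h : a ≠ b) : Fin 2 ↪ κ :=
  ⟨![a, b], by
    intro i j hij
    fin_cases i <;> fin_cases j <;> simp_all⟩

/-- The diagonal gate with phases `d`. -/
def diagonalGate {ι : Type} [Fintype ι] [DecidableEq ι] (d : (ι → Bool) → ℝ) :
    Matrix.unitaryGroup (ι → Bool) ℂ :=
  ⟨Matrix.diagonal fun s => Complex.exp (d s * Complex.I), by
    rw [Matrix.mem_unitaryGroup_iff, Matrix.star_eq_conjTranspose, Matrix.diagonal_conjTranspose,
      Matrix.diagonal_mul_diagonal, ← Matrix.diagonal_one]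
    congr 1
    funext s
    simp only [Pi.star_apply, RCLike.star_def]
    rw [← Complex.exp_conj, ← Complex.exp_add]
    simp⟩

/-- The Hadamard gate on wire `a`. -/
def had (a : κ) : WireOp Q κ := gate 1 (by norm_num) (wire1 a) ⟨hadamardMatrix, hadamardMatrix_mem⟩

/-- The phase `θ` on the states whose wire `a` is set. -/
def phase (θ : ℝ) (a : κ) : WireOp Q κ :=
  gate 1 (by norm_num) (wire1 a) (diagonalGate fun s => if s 0 then θ else 0)

@[simp] theorem isQuery_had (a : κ) : (had a : WireOp Q κ).isQuery = false := rfl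

@[simp] theorem isQuery_phase (θ : ℝ) (a : κ) : (phase θ a : WireOp Q κ).isQuery = false := rfl

theorem apply_phase [Fintype Q] [DecidableEq Q] (U : Matrix (Q → Bool) (Q → Bool) ℂ)
    (θ : ℝ) (a : κ) (φ : (κ → Bool) → ℂ) :
    (phase θ a : WireOp Q κ).apply U φ = fun s =>
      Complex.exp ((if s a then θ else 0 : ℝ) * Complex.I) * φ s := by
  simp only [phase, apply, diagonalGate, applyOn_diagonal]
  rfl

variable [DecidableEq κ]

/-- The phase `θ` on the states whose wires `a` and `b` are both set. -/
def cphase (θ : ℝ) (a b : κ) : WireOp Q κ :=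
  if h : a = b then phase θ a
  else gate 2 le_rfl (wire2 a b h) (diagonalGate fun s => if s 0 && s 1 then θ else 0)

@[simp] theorem isQuery_cphase (θ : ℝ) (a b : κ) :
    (cphase θ a b : WireOp Q κ).isQuery = false := by
  unfold cphase
  split <;> rfl

variable [Fintype Q] [DecidableEq Q] (U : Matrix (Q → Bool) (Q → Bool) ℂ)

theorem extend_wire1 (a : κ) (v : Bool) (s : κ → Bool) :
    Function.extend (wire1 a) (fun _ => v) s = Function.update s a v := by
  funext w
  by_cases h : w = a
  · subst h
    rw [Function.update_self]
    exact (wire1 w).injective.extend_apply (fun _ => v) s 0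
  · rw [Function.update_of_ne h]
    apply Function.extend_apply'
    rintro ⟨i, hi⟩
    exact h hi.symm

theorem apply_had (a : κ) (φ : (κ → Bool) → ℂ) :
    (had a : WireOp Q κ).apply U φ = fun s =>
      (φ (Function.update s a false) +
        (if s a then -1 else 1) * φ (Function.update s a true)) / (Real.sqrt 2 : ℂ) := by
  funext s
  simp only [had, apply, applyOn, sum_fin_one_bool, extend_wire1, hadamardMatrix, Matrix.of_apply]
  have : (s ∘ wire1 a) 0 = s a := rfl
  rw [this]
  cases s a <;> simp <;> ring

theorem apply_cphase (θ : ℝ) (a b : κ) (φ : (κ → Bool) → ℂ) :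
    (cphase θ a b : WireOp Q κ).apply U φ = fun s =>
      Complex.exp ((if s a && s b then θ else 0 : ℝ) * Complex.I) * φ s := by
  unfold cphase
  split
  · next h =>
    subst h
    simp [apply_phase]
  · simp only [apply, diagonalGate, applyOn_diagonal]
    rfl

/-- A Hadamard gate on wire `t`, the sign `(-1)^(t ∧ h)` and another Hadamard gate on `t` together
replace `t` by `t ⊕ h`. -/
theorem apply_had_sign_had (t : κ) (h : (κ → Bool) → Bool)
    (hh : ∀ s v, h (Function.update s t v) = h s) (φ : (κ → Bool) → ℂ) :
    (had t : WireOp Q κ).apply U (fun s =>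
      Complex.exp ((if s t && h s then Real.pi else 0 : ℝ) * Complex.I) *
        (had t : WireOp Q κ).apply U φ s) = fun s => φ (Function.update s t (s t ^^ h s)) := by
  have h2 := sqrt_two_mul_sqrt_two
  have h0 := sqrt_two_ne_zero
  rw [apply_had, apply_had]
  funext s
  simp only [Function.update_self, Function.update_idem, hh]
  cases s t <;> cases h s <;> simp <;> field_simp <;> simp [sq, h2] <;> ring

end WireOp

/-! ### Classical reversible circuits -/

/-- A classical reversible instruction: negate the target `t`, unconditionally or under one or two
controls. -/
inductive Flip (κ : Type) : Type
  | not (t : κ)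
  | cnot (a t : κ) (h : a ≠ t)
  | toffoli (a b t : κ) (hab : a ≠ b) (ha : a ≠ t) (hb : b ≠ t)

namespace Flip

variable {Q κ : Type} [DecidableEq κ]

/-- The action of a classical instruction on the contents of the wires. -/
def act : Flip κ → (κ → Bool) → (κ → Bool)
  | not t, s => Function.update s t (s t ^^ true)
  | cnot a t _, s => Function.update s t (s t ^^ s a)
  | toffoli a b t _ _ _, s => Function.update s t (s t ^^ (s a && s b))

theorem act_act (f : Flip κ) (s : κ → Bool) : f.act (f.act s) = s := by
  cases f with
  | not t => simp [act]
  | cnot a t h => simp [act, h]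
  | toffoli a b t hab ha hb => simp [act, ha, hb]

/-- Implementation by Hadamard gates and phases. For the Toffoli gate, the sign `(-1)^(a ∧ b ∧ t)`
is a product of phases `± π / 2` controlled by `t` and one of `a`, `b`, `a ⊕ b`. -/
def ops : Flip κ → List (WireOp Q κ)
  | not t => [.had t, .phase Real.pi t, .had t]
  | cnot a t _ => [.had t, .cphase Real.pi t a, .had t]
  | toffoli a b t _ _ _ =>
    [.had t, .cphase (Real.pi / 2) b t,
      .had b, .cphase Real.pi b a, .had b,
      .cphase (-(Real.pi / 2)) b t,
      .had b, .cphase Real.pi b a, .had b,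
      .cphase (Real.pi / 2) a t, .had t]

theorem length_ops_le (f : Flip κ) : (f.ops : List (WireOp Q κ)).length ≤ 11 := by
  cases f <;> simp [ops]

theorem isQuery_ops (f : Flip κ) : ∀ op ∈ (f.ops : List (WireOp Q κ)), op.isQuery = false := by
  cases f <;> simp [ops]

/-- The action of a list of classical instructions, executed from left to right. -/
def fwd (L : List (Flip κ)) (s : κ → Bool) : κ → Bool := L.foldl (fun s f => f.act s) s

/-- The inverse of `fwd`. -/
def bwd (L : List (Flip κ)) (s : κ → Bool) : κ → Bool := L.foldr act s

theorem bwd_fwd (L : List (Flip κ)) (s : κ → Bool) : bwd L (fwd L s) = s := by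
  induction L generalizing s with
  | nil => rfl
  | cons f L ih =>
    have h := ih (f.act s)
    simp only [fwd, bwd, List.foldl_cons, List.foldr_cons] at h ⊢
    rw [h, act_act]

theorem fwd_bwd (L : List (Flip κ)) (s : κ → Bool) : fwd L (bwd L s) = s := by
  induction L generalizing s with
  | nil => rfl
  | cons f L ih =>
    have h := ih s
    simp only [fwd, bwd, List.foldl_cons, List.foldr_cons] at h ⊢
    rw [act_act, h]

theorem bwd_reverse (L : List (Flip κ)) : bwd L.reverse = fwd L := by
  funext s
  simp [bwd, fwd]

@[simp] theorem fwd_append (L L' : List (Flip κ)) (s : κ → Bool) :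
    fwd (L ++ L') s = fwd L' (fwd L s) := by
  simp [fwd]

/-- A classical circuit as a bijection. -/
def fwdEquiv (L : List (Flip κ)) : (κ → Bool) ≃ (κ → Bool) :=
  ⟨fwd L, bwd L, bwd_fwd L, fwd_bwd L⟩

/-- The implementation of a list of classical instructions. -/
def circuit (L : List (Flip κ)) : List (WireOp Q κ) := L.flatMap ops

theorem length_circuit_le (L : List (Flip κ)) :
    (circuit L : List (WireOp Q κ)).length ≤ 11 * L.length := by
  induction L with
  | nil => simp [circuit]
  | cons f L ih =>
    have := length_ops_le (Q := Q) f
    simp only [circuit, List.flatMap_cons, List.length_append, List.length_cons] at ih ⊢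
    omega

theorem isQuery_circuit (L : List (Flip κ)) :
    ∀ op ∈ (circuit L : List (WireOp Q κ)), op.isQuery = false := by
  intro op h
  obtain ⟨f, _, hf⟩ := List.mem_flatMap.1 h
  exact isQuery_ops f op hf

variable [Fintype Q] [DecidableEq Q] (U : Matrix (Q → Bool) (Q → Bool) ℂ)

theorem run_ops (f : Flip κ) (φ : (κ → Bool) → ℂ) :
    WireOp.run U f.ops φ = fun s => φ (f.act s) := by
  have cnotRun : ∀ (a t : κ), a ≠ t → ∀ φ : (κ → Bool) → ℂ,
      (WireOp.had t : WireOp Q κ).apply U ((WireOp.cphase Real.pi t a : WireOp Q κ).apply U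
        ((WireOp.had t : WireOp Q κ).apply U φ)) =
      fun s => φ (Function.update s t (s t ^^ s a)) := by
    intro a t h φ
    rw [WireOp.apply_cphase]
    exact WireOp.apply_had_sign_had U t (fun s => s a) (fun s v => Function.update_of_ne h v s) φ
  cases f with
  | not t =>
    simp only [ops, WireOp.run_cons, WireOp.run_nil, WireOp.apply_phase]
    have := WireOp.apply_had_sign_had (Q := Q) U t (fun _ => true) (fun _ _ => rfl) φ
    simpa [act] using this
  | cnot a t h =>
    simp only [ops, WireOp.run_cons, WireOp.run_nil]
    exact cnotRun a t h φ
  | toffoli a b t hab ha hb =>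
    simp only [ops, WireOp.run_cons, WireOp.run_nil]
    rw [cnotRun a b hab, cnotRun a b hab]
    have := WireOp.apply_had_sign_had (Q := Q) U t (fun s => s a && s b)
      (fun s v => by simp [ha, hb]) φ
    simp only [act]
    rw [← this]
    congr 1
    simp only [WireOp.apply_cphase]
    funext s
    simp only [Function.update_self, Function.update_of_ne hab, Function.update_of_ne hb.symm,
      Function.update_idem, ← mul_assoc, ← Complex.exp_add]
    have hs : Function.update s b (s b ^^ s a ^^ s a) = s := by simp
    rw [hs]
    congr 2
    cases s a <;> cases s b <;> cases s t <;> (simp; try ring)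

theorem run_circuit (L : List (Flip κ)) (φ : (κ → Bool) → ℂ) :
    WireOp.run U (circuit L) φ = fun s => φ (bwd L s) := by
  induction L generalizing φ with
  | nil => rfl
  | cons f L ih =>
    have h : (circuit (f :: L) : List (WireOp Q κ)) = f.ops ++ circuit L := rfl
    rw [h, WireOp.run_append, run_ops, ih]
    rfl

end Flip

/-! ### Boolean circuits -/

/-- `Derives G k H`: all Boolean functions in `H` can be computed from those in `G` by a circuit with
`k` binary gates. -/
inductive Derives {X : Type} : Set (X → Bool) → ℕ → Set (X → Bool) → Prop
  | done {G H : Set (X → Bool)} (h : H ⊆ G) : Derives G 0 H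
  | step {G H : Set (X → Bool)} {k : ℕ} (β : Bool → Bool → Bool) (f g : X → Bool)
      (hf : f ∈ G) (hg : g ∈ G) (h : Derives (insert (fun x => β (f x) (g x)) G) k H) :
      Derives G (k + 1) H

namespace Derives

variable {X : Type} {G G' H H' : Set (X → Bool)} {k k' : ℕ}

theorem mono_left (h : Derives G k H) (hG : G ⊆ G') : Derives G' k H := by
  induction h generalizing G' with
  | done h => exact done (h.trans hG)
  | step β f g hf hg _ ih => exact step β f g (hG hf) (hG hg) (ih (Set.insert_subset_insert hG))

theorem mono_right (h : Derives G k H) (hH : H' ⊆ H) : Derives G k H' := by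
  induction h with
  | done h => exact done (hH.trans h)
  | step β f g hf hg _ ih => exact step β f g hf hg (ih hH)

theorem union_of_subset (h : Derives G k H') (hH : H ⊆ G) : Derives G k (H ∪ H') := by
  induction h with
  | done h => exact done (Set.union_subset hH h)
  | step β f g hf hg _ ih => exact step β f g hf hg (ih (hH.trans (Set.subset_insert _ _)))

theorem trans (h : Derives G k H) (h' : Derives (G ∪ H) k' H') : Derives G (k + k') (H ∪ H') := by
  induction h with
  | done h =>
    rw [Set.union_eq_self_of_subset_right h] at h'
    rw [Nat.zero_add]
    exact h'.union_of_subset h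
  | step β f g hf hg _ ih =>
    rw [Nat.add_right_comm]
    refine step β f g hf hg (ih (h'.mono_left ?_))
    exact Set.union_subset_union_left _ (Set.subset_insert _ _)

theorem trans' (h : Derives G k H) (h' : Derives (G ∪ H) k' H') : Derives G (k + k') H' :=
  (h.trans h').mono_right Set.subset_union_right

theorem union (h : Derives G k H) (h' : Derives G k' H') : Derives G (k + k') (H ∪ H') :=
  h.trans (h'.mono_left Set.subset_union_left)

theorem gate (β : Bool → Bool → Bool) {f g : X → Bool} (hf : f ∈ G) (hg : g ∈ G) :
    Derives G 1 {fun x => β (f x) (g x)} :=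
  step β f g hf hg (done (by simp))

theorem pad (h : Derives G k H) (hk : k ≤ k') (hG : G.Nonempty) : Derives G k' H := by
  obtain ⟨f, hf⟩ := hG
  obtain ⟨d, rfl⟩ := Nat.exists_eq_add_of_le' hk
  clear hk
  induction d with
  | zero => simpa using h
  | succ d ih =>
    rw [Nat.add_right_comm]
    exact step (fun a _ => a) f f hf hf (ih.mono_left (Set.subset_insert _ _))

theorem iUnion {T : ℕ} {h : Fin T → Set (X → Bool)} (H : ∀ t, Derives G k (h t)) :
    Derives G (T * k) (⋃ t, h t) := by
  induction T with
  | zero =>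
    rw [Nat.zero_mul, Set.iUnion_of_empty]
    exact done (Set.empty_subset G)
  | succ T ih =>
    have h1 := (ih (h := fun t => h t.castSucc) fun t => H _).union (H (Fin.last T))
    rw [Nat.succ_mul]
    refine h1.mono_right ?_
    intro f hf
    obtain ⟨t, ht⟩ := Set.mem_iUnion.1 hf
    induction t using Fin.lastCases with
    | last => exact Or.inr ht
    | cast t => exact Or.inl (Set.mem_iUnion.2 ⟨t, ht⟩)

/-- A Boolean circuit runs reversibly: each gate writes its value on a fresh ancilla. The results are
found within any set `W` of wires that contains the inputs and the ancillas. -/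
theorem exists_flips {κ : Type} [DecidableEq κ] (h : Derives G k H) (anc : Fin k → κ)
    (hanc : Function.Injective anc) (σ : X → κ → Bool)
    (W : Set κ) (hW : ∀ i, anc i ∈ W)
    (hG : ∀ g ∈ G, ∃ w ∈ W, (∀ i, anc i ≠ w) ∧ ∀ x, σ x w = g x)
    (hσ : ∀ x i, σ x (anc i) = false) :
    ∃ L : List (Flip κ), L.length ≤ 4 * k ∧
      (∀ x w, (∀ i, anc i ≠ w) → Flip.fwd L (σ x) w = σ x w) ∧
      ∀ g ∈ H, ∃ w ∈ W, ∀ x, Flip.fwd L (σ x) w = g x := by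
  induction h generalizing σ with
  | done h =>
    refine ⟨[], by simp, fun _ _ _ => rfl, fun g hg => ?_⟩
    obtain ⟨w, hwW, _, hw⟩ := hG g (h hg)
    exact ⟨w, hwW, hw⟩
  | @step G H k β f g hf hg _ ih =>
    obtain ⟨a, _, ha, hfa⟩ := hG f hf
    obtain ⟨b, _, hb, hgb⟩ := hG g hg
    set t := anc 0 with ht
    obtain ⟨L₁, hL₁, hL₁'⟩ : ∃ L₁ : List (Flip κ), L₁.length ≤ 4 ∧
        ∀ s : κ → Bool, s t = false →
          Flip.fwd L₁ s = Function.update s t (β (s a) (s b)) := by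
      have hat : a ≠ t := (ha 0).symm
      have hbt : b ≠ t := (hb 0).symm
      -- The polynomial of `β` over the field with two elements.
      set c₀ := β false false
      set c₁ := β false false ^^ β true false
      set c₂ := β false false ^^ β false true
      set c₃ := β false false ^^ β true false ^^ β false true ^^ β true true
      have hβ : ∀ u v, β u v = (c₀ ^^ (c₁ && u) ^^ (c₂ && v) ^^ (c₃ && (u && v))) := by
        intro u v
        simp only [c₀, c₁, c₂, c₃]
        cases u <;> cases v <;> cases β false false <;> cases β true false <;>
          cases β false true <;> cases β true true <;> rfl
      obtain ⟨tof, htof⟩ : ∃ tof : Flip κ, ∀ s : κ → Bool,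
          tof.act s = Function.update s t (s t ^^ (s a && s b)) := by
        by_cases hab : a = b
        · subst hab
          exact ⟨.cnot a t hat, fun s => by simp [Flip.act]⟩
        · exact ⟨.toffoli a b t hab hat hbt, fun s => rfl⟩
      have hnot : ∀ s : κ → Bool, (Flip.not t).act s = Function.update s t (s t ^^ true) :=
        fun _ => rfl
      have hcnot : ∀ (c : κ) (h : c ≠ t) (s : κ → Bool),
          (Flip.cnot c t h).act s = Function.update s t (s t ^^ s c) := fun _ _ _ => rfl
      refine ⟨(if c₀ then [.not t] else []) ++ (if c₁ then [.cnot a t hat] else []) ++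
        (if c₂ then [.cnot b t hbt] else []) ++ (if c₃ then [tof] else []), ?_, ?_⟩
      · cases c₀ <;> cases c₁ <;> cases c₂ <;> cases c₃ <;> simp
      · intro s hs
        rw [hβ]
        cases c₀ <;> cases c₁ <;> cases c₂ <;> cases c₃ <;>
          simp [Flip.fwd, hnot, hcnot, htof, hat, hbt, hs]
    have hanc' : ∀ i : Fin k, anc i.succ ≠ t := fun i h =>
      Fin.succ_ne_zero i (hanc h)
    have hσ₁ : ∀ x, Flip.fwd L₁ (σ x) = Function.update (σ x) t (β (f x) (g x)) := by
      intro x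
      rw [hL₁' _ (hσ x 0), hfa, hgb]
    obtain ⟨L₂, hL₂, hL₂', hL₂''⟩ := ih (fun i => anc i.succ)
      (hanc.comp (Fin.succ_injective k)) (fun x => Flip.fwd L₁ (σ x)) (fun i => hW _) (by
        intro p hp
        rcases hp with rfl | hp
        · exact ⟨t, hW 0, hanc', fun x => by simp [hσ₁]⟩
        · obtain ⟨w, hwW, hw, hw'⟩ := hG p hp
          refine ⟨w, hwW, fun i => hw _, fun x => ?_⟩
          rw [hσ₁, Function.update_of_ne (hw 0).symm, hw'])
      (by
        intro x i
        rw [hσ₁, Function.update_of_ne (hanc' i), hσ])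
    refine ⟨L₁ ++ L₂, ?_, ?_, ?_⟩
    · rw [List.length_append]; omega
    · intro x w hw
      rw [Flip.fwd_append, hL₂' x w fun i => hw _, hσ₁, Function.update_of_ne (hw 0).symm]
    · intro p hp
      obtain ⟨w, hwW, hw⟩ := hL₂'' p hp
      exact ⟨w, hwW, fun x => by rw [Flip.fwd_append, hw]⟩

end Derives

/-! ### Counting -/

theorem bitsToNat_cons {k : ℕ} (z : Fin (k + 1) → Bool) :
    bitsToNat z = (z 0).toNat + 2 * bitsToNat (fun j => z j.succ) := by
  unfold bitsToNat
  rw [Fin.sum_univ_succ, Finset.mul_sum]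
  congr 1
  · cases z 0 <;> rfl
  · refine Finset.sum_congr rfl fun j _ => ?_
    split <;> simp [pow_succ, mul_comm]

theorem bitsToNat_snoc {k : ℕ} (z : Fin (k + 1) → Bool) :
    bitsToNat z = bitsToNat (fun j => z j.castSucc) + (z (Fin.last k)).toNat * 2 ^ k := by
  unfold bitsToNat
  rw [Fin.sum_univ_castSucc]
  congr 1
  cases z (Fin.last k) <;> simp

theorem bitsToNat_lt {k : ℕ} (z : Fin k → Bool) : bitsToNat z < 2 ^ k := by
  induction k with
  | zero => simp [bitsToNat]
  | succ k ih =>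
    rw [bitsToNat_snoc, pow_succ]
    have := ih fun j => z j.castSucc
    cases z (Fin.last k) <;> simp <;> omega

namespace Derives

variable {X : Type} {G : Set (X → Bool)}

/-- Adding a bit to a binary number, with a carry out. -/
theorem exists_increment (Q : ℕ) (G : Set (X → Bool)) (c : Fin Q → X → Bool) (e : X → Bool)
    (hc : ∀ j, c j ∈ G) (he : e ∈ G) :
    ∃ (c' : Fin Q → X → Bool) (o : X → Bool), Derives G (2 * Q) (insert o (Set.range c')) ∧
      ∀ x, bitsToNat (fun j => c' j x) + (o x).toNat * 2 ^ Q =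
        bitsToNat (fun j => c j x) + (e x).toNat := by
  induction Q generalizing G e with
  | zero =>
    refine ⟨c, e, done ?_, fun x => by simp [bitsToNat]⟩
    intro f hf
    rcases hf with rfl | ⟨j, _⟩
    · exact he
    · exact j.elim0
  | succ Q ih =>
    let d : X → Bool := fun x => xor (c 0 x) (e x)
    let a : X → Bool := fun x => and (c 0 x) (e x)
    have h1 : Derives G 2 ({d} ∪ {a}) := (gate xor (hc 0) he).union (gate and (hc 0) he)
    obtain ⟨c', o, h2, h3⟩ := ih (G ∪ ({d} ∪ {a})) (fun j => c j.succ) a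
      (fun j => Or.inl (hc _)) (by simp)
    refine ⟨Fin.cons d c', o, ?_, fun x => ?_⟩
    · have := h1.trans h2
      rw [show 2 * (Q + 1) = 2 + 2 * Q by ring]
      refine this.mono_right ?_
      intro f hf
      rcases hf with rfl | ⟨j, rfl⟩
      · simp
      · induction j using Fin.cases with
        | zero => simp
        | succ j => simp
    · have h4 := h3 x
      rw [bitsToNat_cons, bitsToNat_cons (fun j => c j x)]
      simp only [Fin.cons_zero, Fin.cons_succ, d, a] at h4 ⊢
      rw [pow_succ]
      cases h5 : c 0 x <;> cases h6 : e x <;> cases h7 : o x <;> simp [h5, h6, h7] at h4 ⊢ <;> omega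

/-- The number of ones among `T` bits, in binary. -/
theorem exists_count (Q T : ℕ) (hT : T < 2 ^ Q) (G : Set (X → Bool)) (hG : G.Nonempty)
    (e : Fin T → X → Bool) (he : ∀ t, e t ∈ G) :
    ∃ c : Fin Q → X → Bool, Derives G (1 + T * (2 * Q)) (Set.range c) ∧
      ∀ x, bitsToNat (fun j => c j x) = (Finset.univ.filter fun t => e t x = true).card := by
  induction T with
  | zero =>
    obtain ⟨f, hf⟩ := hG
    refine ⟨fun _ _ => false, ?_, fun x => by simp [bitsToNat]⟩
    refine (gate (fun _ _ => false) hf hf).mono_right ?_ |> fun h => by simpa using h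
    rintro _ ⟨j, rfl⟩
    rfl
  | succ T ih =>
    obtain ⟨c, h1, h2⟩ := ih (by omega) (fun t => e t.castSucc) fun t => he _
    obtain ⟨c', o, h3, h4⟩ := exists_increment Q (G ∪ Set.range c) c (e (Fin.last T))
      (fun j => Or.inr ⟨j, rfl⟩) (Or.inl (he _))
    refine ⟨c', ?_, fun x => ?_⟩
    · have := h1.trans' h3
      rw [show 1 + (T + 1) * (2 * Q) = 1 + T * (2 * Q) + 2 * Q by ring]
      exact this.mono_right (Set.subset_insert _ _)
    · have h5 := h4 x
      rw [h2 x] at h5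
      have h6 : (Finset.univ.filter fun t => e t x = true).card =
          (Finset.univ.filter fun t : Fin T => e t.castSucc x = true).card +
            (e (Fin.last T) x).toNat := by
        rw [Finset.card_filter, Finset.card_filter, Fin.sum_univ_castSucc]
        congr 1
        cases e (Fin.last T) x <;> rfl
      rw [← h6] at h5
      have h7 : (Finset.univ.filter fun t => e t x = true).card ≤ T + 1 :=
        (Finset.card_filter_le _ _).trans (by simp)
      cases ho : o x <;> simp [ho] at h5 <;> omega

/-- The majority of `2 ^ (q + 1) - 1` bits is the leading bit of their count. -/
theorem exists_majority (q T : ℕ) (hT : T + 1 = 2 ^ (q + 1)) (hG : G.Nonempty)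
    (e : Fin T → X → Bool) (he : ∀ t, e t ∈ G) :
    ∃ m : X → Bool, Derives G (1 + T * (2 * (q + 1))) {m} ∧
      ∀ x, m x = true ↔ T < 2 * (Finset.univ.filter fun t => e t x = true).card := by
  obtain ⟨c, h1, h2⟩ := exists_count (q + 1) T (by omega) G hG e he
  refine ⟨c (Fin.last q), h1.mono_right (by simp), fun x => ?_⟩
  have h3 := h2 x
  rw [bitsToNat_snoc] at h3
  have h4 := bitsToNat_lt fun j : Fin q => c j.castSucc x
  rw [← h3]
  rw [pow_succ] at hT
  cases c (Fin.last q) x <;> simp <;> omega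

end Derives

/-! ### A linear-size circuit for the median -/

namespace Derives

variable {X : Type} {G : Set (X → Bool)}

/-- First the `T` functions `e t`, with `k` gates each, then `H` from them. -/
theorem union_iUnion_singleton {T k k' : ℕ} {H : Set (X → Bool)} {e : Fin T → X → Bool}
    (h : ∀ t, Derives G k {e t}) (h' : Derives (G ∪ Set.range e) k' H) :
    Derives G (T * k + k') (Set.range e ∪ H) := by
  have h1 := iUnion h
  rw [Set.iUnion_singleton_eq_range] at h1
  exact h1.trans h'

/-- The bits of the median are determined from the leading one on, each as the majority of the
corresponding bits of the numbers, where a number `t` that differs from the median in an earlier bit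
is no longer alive and always votes for the value `val t` that it had in that bit. At most half of
the numbers can exceed, or fall below, the result. -/
theorem exists_median_aux (q T : ℕ) (hT : T + 1 = 2 ^ (q + 1)) (b : ℕ) (G : Set (X → Bool))
    (hG : G.Nonempty) (f : Fin T → Fin b → X → Bool) (alive val : Fin T → X → Bool)
    (hf : ∀ t l, f t l ∈ G) (ha : ∀ t, alive t ∈ G) (hv : ∀ t, val t ∈ G) :
    ∃ M : Fin b → X → Bool, Derives G (b * (T * (2 * q + 7) + 1)) (Set.range M) ∧ ∀ x,
      (2 * (Finset.univ.filter fun t => alive t x = false ∧ val t x = true).card ≤ T →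
        2 * (Finset.univ.filter fun t => (alive t x = false ∧ val t x = true) ∨ (alive t x = true ∧
          bitsToNat (fun l => M l x) < bitsToNat (fun l => f t l x))).card ≤ T) ∧
      (2 * (Finset.univ.filter fun t => alive t x = false ∧ val t x = false).card ≤ T →
        2 * (Finset.univ.filter fun t => (alive t x = false ∧ val t x = false) ∨ (alive t x = true ∧
          bitsToNat (fun l => f t l x) < bitsToNat (fun l => M l x))).card ≤ T) := by
  induction b generalizing G alive val with
  | zero =>
    refine ⟨fun l _ => l.elim0, ?_, fun x => ?_⟩
    · rw [Nat.zero_mul]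
      exact done (by rintro _ ⟨l, _⟩; exact l.elim0)
    · simp [bitsToNat]
  | succ b ih =>
    let e : Fin T → X → Bool := fun t x =>
      (alive t x && f t (Fin.last b) x) || (!alive t x && val t x)
    have he : ∀ t, Derives G 3 {e t} := by
      intro t
      have h1 : Derives G 2 ({fun x => alive t x && f t (Fin.last b) x} ∪
          {fun x => !alive t x && val t x}) :=
        (gate (fun a b => a && b) (ha t) (hf t (Fin.last b))).union
          (gate (fun a b => !a && b) (ha t) (hv t))
      exact h1.trans' (gate (fun a b => a || b) (Or.inr (Or.inl rfl)) (Or.inr (Or.inr rfl)))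
    obtain ⟨m, hm, hm'⟩ := exists_majority (G := G ∪ Set.range e) q T hT
      (hG.mono Set.subset_union_left) e (fun t => Or.inr ⟨t, rfl⟩)
    have h1 := union_iUnion_singleton he hm
    let alive' : Fin T → X → Bool := fun t x => alive t x && !(e t x ^^ m x)
    have ha' : ∀ t, Derives (G ∪ (Set.range e ∪ {m})) 2 {alive' t} := by
      intro t
      have h2 : Derives (G ∪ (Set.range e ∪ {m})) 1 {fun x => !(e t x ^^ m x)} :=
        gate (fun a b => !(a ^^ b)) (by simp) (by simp)
      exact h2.trans' (gate (fun a b => a && b) (Or.inl (Or.inl (ha t))) (Or.inr rfl))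
    obtain ⟨M, hM, hM'⟩ := ih (G ∪ (Set.range e ∪ {m}) ∪ Set.range alive')
      (hG.mono fun _ h => Or.inl (Or.inl h)) (fun t l => f t l.castSucc) alive' e
      (fun t l => Or.inl (Or.inl (hf _ _))) (fun t => Or.inr ⟨t, rfl⟩)
      (fun t => Or.inl (Or.inr (Or.inl ⟨t, rfl⟩)))
    have h2 := h1.trans (union_iUnion_singleton ha' hM)
    refine ⟨Fin.snoc (α := fun _ => X → Bool) M m, ?_, fun x => ?_⟩
    · refine (h2.pad (le_of_eq ?_) hG).mono_right ?_
      · ring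
      · rintro _ ⟨l, rfl⟩
        induction l using Fin.lastCases with
        | last => simp
        | cast l => simp
    · have hmx := hm' x
      obtain ⟨hhi, hlo⟩ := hM' x
      have hM₀ : bitsToNat (fun l => Fin.snoc (α := fun _ => X → Bool) M m l x) =
          bitsToNat (fun l => M l x) + (m x).toNat * 2 ^ b := by
        rw [bitsToNat_snoc]
        simp
      have hf₀ : ∀ t, bitsToNat (fun l => f t l x) =
          bitsToNat (fun l => f t l.castSucc x) + (f t (Fin.last b) x).toNat * 2 ^ b :=
        fun t => bitsToNat_snoc _
      have hMlt := bitsToNat_lt fun l => M l x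
      have hflt : ∀ t, bitsToNat (fun l => f t l.castSucc x) < 2 ^ b := fun t => bitsToNat_lt _
      have hcompl : (Finset.univ.filter fun t => e t x = true).card +
          (Finset.univ.filter fun t => e t x = false).card = T := by
        have := Finset.card_filter_add_card_filter_not (s := (Finset.univ : Finset (Fin T)))
          (fun t => e t x = true)
        simpa using this
      rw [hM₀]
      simp only [hf₀]
      constructor
      · intro h
        have h3 : 2 * (Finset.univ.filter fun t => alive' t x = false ∧ e t x = true).card ≤ T := by
          cases hmx' : m x with
          | true =>
            refine le_trans (Nat.mul_le_mul_left 2 (Finset.card_le_card ?_)) h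
            intro t
            simp only [Finset.mem_filter, Finset.mem_univ, true_and, alive', e, hmx']
            cases alive t x <;> cases val t x <;> simp
          | false =>
            have h4 : ¬ T < 2 * (Finset.univ.filter fun t => e t x = true).card := by
              rw [← hmx]; simp [hmx']
            refine le_trans (Nat.mul_le_mul_left 2 (Finset.card_le_card ?_)) (not_lt.1 h4)
            exact Finset.monotone_filter_right _ fun t _ ht => ht.2
        refine le_trans (Nat.mul_le_mul_left 2 (Finset.card_le_card ?_)) (hhi h3)
        intro t
        simp only [Finset.mem_filter, Finset.mem_univ, true_and]
        have h5 := hflt t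
        have h6 : e t x = ((alive t x && f t (Fin.last b) x) || (!alive t x && val t x)) := rfl
        have h7 : alive' t x = (alive t x && !(e t x ^^ m x)) := rfl
        rw [h7, h6]
        cases alive t x <;> cases f t (Fin.last b) x <;> cases val t x <;> cases m x <;>
          simp <;> omega
      · intro h
        have h3 : 2 * (Finset.univ.filter fun t => alive' t x = false ∧ e t x = false).card ≤
            T := by
          cases hmx' : m x with
          | false =>
            refine le_trans (Nat.mul_le_mul_left 2 (Finset.card_le_card ?_)) h
            intro t
            simp only [Finset.mem_filter, Finset.mem_univ, true_and, alive', e, hmx']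
            cases alive t x <;> cases val t x <;> simp
          | true =>
            have h4 := hmx.1 hmx'
            refine le_trans (Nat.mul_le_mul_left 2 (Finset.card_le_card
              (Finset.monotone_filter_right _ fun t _ ht => ht.2))) ?_
            omega
        refine le_trans (Nat.mul_le_mul_left 2 (Finset.card_le_card ?_)) (hlo h3)
        intro t
        simp only [Finset.mem_filter, Finset.mem_univ, true_and]
        have h5 := hflt t
        have h6 : e t x = ((alive t x && f t (Fin.last b) x) || (!alive t x && val t x)) := rfl
        have h7 : alive' t x = (alive t x && !(e t x ^^ m x)) := rfl
        rw [h7, h6]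
        cases alive t x <;> cases f t (Fin.last b) x <;> cases val t x <;> cases m x <;>
          simp <;> omega

/-- The median of `T = 2 ^ (q + 1) - 1` numbers of `b` bits is computed by `O(T * b * q)` gates. It
lies in every order-convex set that contains more than half of the numbers. -/
theorem exists_median (q T : ℕ) (hT : T + 1 = 2 ^ (q + 1)) (b : ℕ) (G : Set (X → Bool))
    (hG : G.Nonempty) (f : Fin T → Fin b → X → Bool) (hf : ∀ t l, f t l ∈ G) :
    ∃ M : Fin b → X → Bool, Derives G (1 + b * (T * (2 * q + 7) + 1)) (Set.range M) ∧
      ∀ x, ∀ S : Set ℕ, S.OrdConnected →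
        (∃ B : Finset (Fin T), (∀ t ∉ B, bitsToNat (fun l => f t l x) ∈ S) ∧ 2 * B.card < T) →
        bitsToNat (fun l => M l x) ∈ S := by
  obtain ⟨g, hg⟩ := hG
  obtain ⟨M, h1, h2⟩ := exists_median_aux q T hT b (G ∪ {fun _ => true}) ⟨g, Or.inl hg⟩ f
    (fun _ _ => true) (fun _ _ => true) (fun t l => Or.inl (hf t l)) (fun _ => Or.inr rfl)
    (fun _ => Or.inr rfl)
  refine ⟨M, (gate (fun _ _ => true) hg hg).trans' h1, ?_⟩
  rintro x S hS ⟨B, hB, hBT⟩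
  obtain ⟨h3, h4⟩ := h2 x
  simp only [Bool.true_eq_false, false_and, Finset.filter_false, Finset.card_empty, mul_zero,
    Nat.zero_le, true_and, false_or, forall_const] at h3 h4
  set p := bitsToNat (fun l => M l x)
  have hcard : B.card + Bᶜ.card = T := by simp [Finset.card_add_card_compl]
  have exists_of : ∀ F : Finset (Fin T), 2 * F.card ≤ T → ∃ t, t ∉ F ∧ t ∉ B := by
    intro F hF
    by_contra! h
    have h5 : Bᶜ ⊆ F := by
      intro t ht
      by_contra h6
      exact (Finset.mem_compl.1 ht) (h t h6)
    have := Finset.card_le_card h5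
    omega
  obtain ⟨t₁, ht₁, ht₁'⟩ := exists_of _ h3
  obtain ⟨t₂, ht₂, ht₂'⟩ := exists_of _ h4
  simp only [Finset.mem_filter, Finset.mem_univ, true_and, not_lt] at ht₁ ht₂
  exact hS.out (hB t₁ ht₁') (hB t₂ ht₂') ⟨ht₁, ht₂⟩

end Derives

/-! ### Concentration -/

/-- If each of `T` independent samples is bad with probability at most `1/3`, at least half of them
are bad with probability at most `((4/3) / √2) ^ T`, by Markov's inequality for `2 ^ #bad`. -/
theorem sum_prod_majority_bad_le {Z : Type} [Fintype Z] (p : Z → ℝ) (hp : ∀ z, 0 ≤ p z)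
    (hp1 : ∑ z, p z = 1) (bad : Z → Prop) [DecidablePred bad]
    (hbad : ∑ z, (if bad z then p z else 0) ≤ 1 / 3) (T : ℕ) :
    ∑ S : Fin T → Z, (if T ≤ 2 * (Finset.univ.filter fun t => bad (S t)).card then
      ∏ t, p (S t) else 0) ≤ (4 / 3 / Real.sqrt 2) ^ T := by
  have hs : 1 ≤ Real.sqrt 2 := Real.one_le_sqrt.2 (by norm_num)
  have hs2 : Real.sqrt 2 * Real.sqrt 2 = 2 := Real.mul_self_sqrt (by norm_num)
  rw [div_pow, le_div_iff₀ (by positivity), Finset.sum_mul]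
  calc ∑ S : Fin T → Z, (if T ≤ 2 * (Finset.univ.filter fun t => bad (S t)).card then
        ∏ t, p (S t) else 0) * Real.sqrt 2 ^ T
      ≤ ∑ S : Fin T → Z, ∏ t, (p (S t) + if bad (S t) then p (S t) else 0) := by
        refine Finset.sum_le_sum fun S _ => ?_
        have h1 : ∏ t, (p (S t) + if bad (S t) then p (S t) else 0) =
            (∏ t, p (S t)) * 2 ^ (Finset.univ.filter fun t => bad (S t)).card := by
          rw [← Finset.prod_const, Finset.prod_filter, ← Finset.prod_mul_distrib]
          refine Finset.prod_congr rfl fun t _ => ?_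
          split <;> ring
        have h2 : 0 ≤ ∏ t, p (S t) := Finset.prod_nonneg fun t _ => hp _
        rw [h1]
        split
        · next h =>
          refine mul_le_mul_of_nonneg_left ?_ h2
          calc Real.sqrt 2 ^ T
              ≤ Real.sqrt 2 ^ (2 * (Finset.univ.filter fun t => bad (S t)).card) :=
                pow_le_pow_right₀ hs h
            _ = 2 ^ (Finset.univ.filter fun t => bad (S t)).card := by
                rw [pow_mul, sq, hs2]
        · rw [zero_mul]
          positivity
    _ = (∑ z, (p z + if bad z then p z else 0)) ^ T :=
        (Fintype.sum_pow (fun z => p z + if bad z then p z else 0) T).symm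
    _ ≤ (4 / 3) ^ T := by
        rw [Finset.sum_add_distrib, hp1]
        refine pow_le_pow_left₀ ?_ (by linarith) T
        have : 0 ≤ ∑ z, (if bad z then p z else 0) :=
          Finset.sum_nonneg fun z _ => by split <;> simp [hp]
        linarith

/-! ### The outcome distribution of the truncated Fourier transform -/

/-- A bit string, continued by zeros. -/
def extendBits {m : ℕ} (z : Fin m → Bool) (n : ℕ) : Bool :=
  if h : n < m then z ⟨n, h⟩ else false

theorem extendBits_fin {m : ℕ} (z : Fin m → Bool) (l : Fin m) : extendBits z l = z l := by
  simp [extendBits]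

theorem extendBits_snoc {m : ℕ} (z : Fin m → Bool) (v : Bool) :
    extendBits (Fin.snoc (α := fun _ => Bool) z v) = Function.update (extendBits z) m v := by
  funext n
  rcases lt_trichotomy n m with h | rfl | h
  · rw [Function.update_of_ne h.ne]
    simp [extendBits, h, Nat.lt_succ_of_lt h, Fin.snoc]
  · simp [extendBits, Fin.snoc]
  · rw [Function.update_of_ne h.ne']
    simp [extendBits, h.not_gt, show ¬ n < m + 1 by omega]

theorem sum_extendBits_succ {m : ℕ} (F : (ℕ → Bool) → ℝ) :
    ∑ z : Fin (m + 1) → Bool, F (extendBits z) = ∑ z : Fin m → Bool,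
      (F (Function.update (extendBits z) m false) + F (Function.update (extendBits z) m true)) := by
  rw [← Equiv.sum_comp (Fin.snocEquiv fun _ => Bool), Fintype.sum_prod_type, Fintype.sum_bool,
    ← Finset.sum_add_distrib]
  refine Finset.sum_congr rfl fun z _ => ?_
  have h : ∀ v, extendBits (Fin.snocEquiv (fun _ => Bool) (v, z)) =
      Function.update (extendBits z) m v := extendBits_snoc z
  rw [h, h, add_comm]

/-- `p l z` is the conditional probability of the bit `z l`, given the bits `z 0, …, z (l - 1)`. -/
structure IsBitChain (p : ℕ → (ℕ → Bool) → ℝ) : Prop where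
  nonneg : ∀ l z, 0 ≤ p l z
  local' : ∀ l z z', (∀ n ≤ l, z n = z' n) → p l z = p l z'
  sum_one : ∀ l z, p l (Function.update z l false) + p l (Function.update z l true) = 1

namespace IsBitChain

variable {p p' : ℕ → (ℕ → Bool) → ℝ}

theorem prod_update (hp : IsBitChain p) (m : ℕ) (z : ℕ → Bool) (v : Bool) :
    ∏ l ∈ Finset.range m, p l (Function.update z m v) = ∏ l ∈ Finset.range m, p l z := by
  refine Finset.prod_congr rfl fun l hl => hp.local' _ _ _ fun n hn => ?_
  rw [Function.update_of_ne]
  have := Finset.mem_range.1 hl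
  omega

theorem sum_prod (hp : IsBitChain p) (m : ℕ) :
    ∑ z : Fin m → Bool, ∏ l ∈ Finset.range m, p l (extendBits z) = 1 := by
  induction m with
  | zero => simp
  | succ m ih =>
    rw [sum_extendBits_succ fun z => ∏ l ∈ Finset.range (m + 1), p l z, ← ih]
    refine Finset.sum_congr rfl fun z _ => ?_
    rw [Finset.prod_range_succ, Finset.prod_range_succ, hp.prod_update, hp.prod_update, ← mul_add,
      hp.sum_one, mul_one]

/-- Perturbing the conditional probabilities by `ε` changes the distribution of `m` bits by at most
`2 * m * ε` in the `ℓ¹` norm. -/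
theorem sum_abs_sub_le (hp : IsBitChain p) (hp' : IsBitChain p') {ε : ℝ}
    (h : ∀ l z, |p l z - p' l z| ≤ ε) (m : ℕ) :
    ∑ z : Fin m → Bool, |∏ l ∈ Finset.range m, p l (extendBits z) -
      ∏ l ∈ Finset.range m, p' l (extendBits z)| ≤ 2 * m * ε := by
  induction m with
  | zero => simp
  | succ m ih =>
    rw [sum_extendBits_succ fun z => |∏ l ∈ Finset.range (m + 1), p l z -
      ∏ l ∈ Finset.range (m + 1), p' l z|]
    have h1 : ∀ z : Fin m → Bool, ∀ v : Bool,
        |∏ l ∈ Finset.range (m + 1), p l (Function.update (extendBits z) m v) -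
          ∏ l ∈ Finset.range (m + 1), p' l (Function.update (extendBits z) m v)| ≤
        |∏ l ∈ Finset.range m, p l (extendBits z) - ∏ l ∈ Finset.range m, p' l (extendBits z)| *
          p m (Function.update (extendBits z) m v) +
        (∏ l ∈ Finset.range m, p' l (extendBits z)) * ε := by
      intro z v
      rw [Finset.prod_range_succ, Finset.prod_range_succ, hp.prod_update, hp'.prod_update]
      set A := ∏ l ∈ Finset.range m, p l (extendBits z)
      set A' := ∏ l ∈ Finset.range m, p' l (extendBits z) with hA'
      have hA'0 : 0 ≤ A' := Finset.prod_nonneg fun l _ => hp'.nonneg _ _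
      set w := Function.update (extendBits z) m v
      have : A * p m w - A' * p' m w = (A - A') * p m w + A' * (p m w - p' m w) := by ring
      rw [this]
      refine (abs_add_le _ _).trans ?_
      rw [abs_mul, abs_mul, abs_of_nonneg (hp.nonneg m w), abs_of_nonneg hA'0]
      have := mul_le_mul_of_nonneg_left (h m w) hA'0
      linarith
    calc _ ≤ ∑ z : Fin m → Bool, (|∏ l ∈ Finset.range m, p l (extendBits z) -
            ∏ l ∈ Finset.range m, p' l (extendBits z)| +
            2 * ε * ∏ l ∈ Finset.range m, p' l (extendBits z)) := by
          refine Finset.sum_le_sum fun z _ => ?_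
          have h2 := h1 z false
          have h3 := h1 z true
          have h4 := hp.sum_one m (extendBits z)
          set D := |∏ l ∈ Finset.range m, p l (extendBits z) -
            ∏ l ∈ Finset.range m, p' l (extendBits z)|
          have h5 : D * p m (Function.update (extendBits z) m false) +
              D * p m (Function.update (extendBits z) m true) = D := by
            rw [← mul_add, h4, mul_one]
          linarith
      _ ≤ 2 * (m + 1 : ℕ) * ε := by
          rw [Finset.sum_add_distrib, ← Finset.mul_sum, hp'.sum_prod]
          push_cast
          linarith

end IsBitChain

/-- The rotation angle, from the last `d` outcomes, before bit `l` is read in the truncated Fourier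
transform. -/
def fourierAngle (d l : ℕ) (z : ℕ → Bool) : ℝ :=
  ∑ k ∈ Finset.range d, if k < l ∧ z (l - 1 - k) = true then 2 * Real.pi / 2 ^ (k + 2) else 0

theorem fourierAngle_congr (d l : ℕ) {z z' : ℕ → Bool} (h : ∀ n < l, z n = z' n) :
    fourierAngle d l z = fourierAngle d l z' := by
  refine Finset.sum_congr rfl fun k _ => ?_
  by_cases hk : k < l
  · rw [h (l - 1 - k) (by omega)]
  · simp [hk]

/-- Truncation drops the rotations `2 * π / 2 ^ (k + 2)` with `k ≥ d`, a geometric series. -/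
theorem fourierAngle_add_sub (d e l : ℕ) (z : ℕ → Bool) :
    0 ≤ fourierAngle (d + e) l z - fourierAngle d l z ∧
      fourierAngle (d + e) l z - fourierAngle d l z ≤
        Real.pi / 2 ^ d - Real.pi / 2 ^ (d + e) := by
  induction e with
  | zero => simp
  | succ e ih =>
    have h1 : fourierAngle (d + (e + 1)) l z = fourierAngle (d + e) l z +
        if d + e < l ∧ z (l - 1 - (d + e)) = true then 2 * Real.pi / 2 ^ (d + e + 2) else 0 := by
      unfold fourierAngle
      rw [← add_assoc, Finset.sum_range_succ]
    have h2 : Real.pi / 2 ^ (d + e) - Real.pi / 2 ^ (d + (e + 1)) =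
        2 * Real.pi / 2 ^ (d + e + 2) := by
      rw [← add_assoc, pow_succ, pow_add _ (d + e) 2]
      field_simp
      norm_num
    have h3 : 0 ≤ 2 * Real.pi / 2 ^ (d + e + 2) := by positivity
    rw [h1]
    constructor
    · split <;> linarith [ih.1]
    · split <;> linarith [ih.2]

/-- The conditional probability of the outcome `z l` in the truncated Fourier transform of a product
state with phases `β`. -/
def fourierProb (d : ℕ) (β : ℕ → ℝ) (l : ℕ) (z : ℕ → Bool) : ℝ :=
  (1 + Real.cos (β l - fourierAngle d l z - if z l then Real.pi else 0)) / 2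

theorem isBitChain_fourierProb (d : ℕ) (β : ℕ → ℝ) : IsBitChain (fourierProb d β) where
  nonneg l z := by
    have := Real.neg_one_le_cos (β l - fourierAngle d l z - if z l then Real.pi else 0)
    unfold fourierProb
    linarith
  local' l z z' h := by
    unfold fourierProb
    rw [fourierAngle_congr d l fun n hn => h n hn.le, h l le_rfl]
  sum_one l z := by
    have h : ∀ v, fourierAngle d l (Function.update z l v) = fourierAngle d l z := fun v =>
      fourierAngle_congr d l fun n hn => Function.update_of_ne hn.ne _ _
    simp only [fourierProb, h, Function.update_self]
    simp [Real.cos_sub_pi]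
    ring

theorem abs_fourierProb_sub_le (d e : ℕ) (β : ℕ → ℝ) (l : ℕ) (z : ℕ → Bool) :
    |fourierProb d β l z - fourierProb (d + e) β l z| ≤ Real.pi / 2 ^ d / 2 := by
  obtain ⟨h1, h2⟩ := fourierAngle_add_sub d e l z
  have h3 : 0 ≤ Real.pi / 2 ^ (d + e) := by positivity
  have h4 := Real.abs_cos_sub_cos_le (β l - fourierAngle d l z - if z l then Real.pi else 0)
    (β l - fourierAngle (d + e) l z - if z l then Real.pi else 0)
  unfold fourierProb
  rw [← sub_div, abs_div, abs_two]
  refine div_le_div_of_nonneg_right ?_ (by norm_num)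
  calc _ = |Real.cos (β l - fourierAngle d l z - if z l then Real.pi else 0) -
        Real.cos (β l - fourierAngle (d + e) l z - if z l then Real.pi else 0)| := by
          congr 1; ring
    _ ≤ _ := h4
    _ = |fourierAngle (d + e) l z - fourierAngle d l z| := by congr 1; ring
    _ ≤ _ := by rw [abs_of_nonneg h1]; linarith

/-- The number with binary digits `z 0, …, z (m - 1)`. -/
def prefixNat (z : ℕ → Bool) (m : ℕ) : ℕ := ∑ j ∈ Finset.range m, (z j).toNat * 2 ^ j

theorem prefixNat_extendBits {m : ℕ} (z : Fin m → Bool) :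
    prefixNat (extendBits z) m = bitsToNat z := by
  unfold prefixNat bitsToNat
  rw [← Fin.sum_univ_eq_sum_range (fun j => (extendBits z j).toNat * 2 ^ j) m]
  refine Finset.sum_congr rfl fun l _ => ?_
  rw [extendBits_fin]
  cases z l <;> simp

theorem fourierAngle_eq (d l : ℕ) (hl : l ≤ d) (z : ℕ → Bool) :
    fourierAngle d l z = 2 * Real.pi * prefixNat z l / 2 ^ (l + 1) := by
  have h1 : fourierAngle d l z = fourierAngle l l z := by
    unfold fourierAngle
    symm
    apply Finset.sum_subset (Finset.range_mono hl)
    intro k _ hk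
    have : ¬ k < l := by simpa using hk
    simp [this]
  rw [h1, fourierAngle, prefixNat, ← Finset.sum_range_reflect]
  push_cast
  rw [Finset.mul_sum, Finset.sum_div]
  refine Finset.sum_congr rfl fun k hk => ?_
  have hk := Finset.mem_range.1 hk
  have h2 : l - 1 - (l - 1 - k) = k := by omega
  have h3 : (2 : ℝ) ^ (l + 1) = 2 ^ k * 2 ^ (l - 1 - k + 2) := by
    rw [← pow_add]; congr 1; omega
  rw [h2, h3]
  have h4 : l - 1 - k < l := by omega
  cases z k <;> simp [h4]
  field_simp

theorem prefixNat_add_dvd (z : ℕ → Bool) (l e : ℕ) :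
    ∃ q : ℕ, prefixNat z (l + e) = prefixNat z l + 2 ^ l * q := by
  induction e with
  | zero => exact ⟨0, by simp⟩
  | succ e ih =>
    obtain ⟨q, hq⟩ := ih
    refine ⟨q + (z (l + e)).toNat * 2 ^ e, ?_⟩
    have : prefixNat z (l + (e + 1)) = prefixNat z (l + e) + (z (l + e)).toNat * 2 ^ (l + e) := by
      unfold prefixNat
      rw [← add_assoc, Finset.sum_range_succ]
    rw [this, hq, pow_add]
    ring

/-- Without truncation, the factor of bit `l` depends on the distance of the encoded phase from the
outcome alone. -/
theorem fourierProb_eq (d m l : ℕ) (hl : l < m) (hd : m ≤ d) (φ : ℝ) (z : ℕ → Bool) :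
    fourierProb d (fun l => 2 * Real.pi * φ / 2 ^ (l + 1)) l z =
      Real.cos (Real.pi * (φ - prefixNat z m) / 2 ^ (l + 1)) ^ 2 := by
  obtain ⟨q, hq⟩ := prefixNat_add_dvd z (l + 1) (m - (l + 1))
  rw [show l + 1 + (m - (l + 1)) = m by omega] at hq
  have h1 : prefixNat z (l + 1) = prefixNat z l + (z l).toNat * 2 ^ l := by
    unfold prefixNat
    rw [Finset.sum_range_succ]
  rw [Real.cos_sq, fourierProb, fourierAngle_eq d l (by omega)]
  have h2 : (if z l = true then Real.pi else 0) =
      2 * Real.pi * ((z l).toNat * 2 ^ l : ℕ) / 2 ^ (l + 1) := by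
    cases z l <;> simp
    rw [pow_succ]
    field_simp
  have h3 : 2 * Real.pi * φ / 2 ^ (l + 1) - 2 * Real.pi * (prefixNat z l) / 2 ^ (l + 1) -
      2 * Real.pi * ((z l).toNat * 2 ^ l : ℕ) / 2 ^ (l + 1) =
      2 * (Real.pi * (φ - prefixNat z m) / 2 ^ (l + 1)) + q * (2 * Real.pi) := by
    rw [hq, h1]
    push_cast
    field_simp
    ring
  rw [h2, h3, Real.cos_add_nat_mul_two_pi]
  ring

/-- Iterated angle doubling. It turns the product of the factors of all bits into the Dirichlet
kernel. -/
theorem prod_cos_mul_sin (m : ℕ) (t : ℝ) :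
    (∏ l ∈ Finset.range m, Real.cos (t / 2 ^ (l + 1))) * (2 ^ m * Real.sin (t / 2 ^ m)) =
      Real.sin t := by
  induction m with
  | zero => simp
  | succ m ih =>
    rw [Finset.prod_range_succ, ← ih]
    have : Real.sin (t / 2 ^ m) =
        2 * Real.sin (t / 2 ^ (m + 1)) * Real.cos (t / 2 ^ (m + 1)) := by
      rw [← Real.sin_two_mul]
      congr 1
      rw [pow_succ]
      field_simp
    rw [this, pow_succ]
    ring

theorem sum_one_div_sq_le (M : ℕ) :
    ∑ j ∈ Finset.range M, 1 / ((3 : ℝ) + j) ^ 2 ≤ 2 / 5 := by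
  -- `1 / x ^ 2 ≤ 1 / (x - 1 / 2) - 1 / (x + 1 / 2)` makes the sum telescope.
  have h : ∀ M : ℕ, ∑ j ∈ Finset.range M, 1 / ((3 : ℝ) + j) ^ 2 ≤
      2 / 5 - 1 / ((5 / 2 : ℝ) + M) := by
    intro M
    induction M with
    | zero => norm_num
    | succ M ih =>
      rw [Finset.sum_range_succ]
      have h1 : 1 / ((3 : ℝ) + M) ^ 2 ≤ 1 / ((5 / 2 : ℝ) + M) - 1 / ((5 / 2 : ℝ) + (M + 1 : ℕ)) := by
        have hM : (0 : ℝ) ≤ M := Nat.cast_nonneg M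
        push_cast
        rw [div_sub_div _ _ (by positivity) (by positivity),
          div_le_div_iff₀ (by positivity) (by positivity)]
        nlinarith
      linarith
  have := h M
  have h2 : 0 ≤ 1 / ((5 / 2 : ℝ) + M) := by positivity
  linarith

/-- The inverse squares of the distances of `φ` to the integers more than `3` above it have sum at
most `2/5`. -/
theorem sum_one_div_sq_above_le (φ : ℝ) (S : Finset ℤ) (hS : ∀ n ∈ S, φ + 3 < n) :
    ∑ n ∈ S, 1 / ((n : ℝ) - φ) ^ 2 ≤ 2 / 5 := by
  have hfloor := Int.floor_le φ
  have hge : ∀ n ∈ S, ⌊φ⌋ + 4 ≤ n := by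
    intro n hn
    have h1 : (⌊φ⌋ + 3 : ℝ) < n := by linarith [hS n hn]
    have h2 : ⌊φ⌋ + 3 < n := by exact_mod_cast h1
    omega
  let ι : ℤ → ℕ := fun n => (n - ⌊φ⌋ - 4).toNat
  have hι : Set.InjOn ι S := by
    intro n hn n' hn' h
    have h1 := hge n hn
    have h2 := hge n' hn'
    simp only [ι] at h
    omega
  obtain ⟨M, hM⟩ : ∃ M, S.image ι ⊆ Finset.range M := by
    refine ⟨(S.image ι).sup id + 1, fun j hj => ?_⟩
    exact Finset.mem_range.2 (Nat.lt_succ_of_le (Finset.le_sup (f := id) hj))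
  calc ∑ n ∈ S, 1 / ((n : ℝ) - φ) ^ 2
      ≤ ∑ n ∈ S, 1 / ((3 : ℝ) + ι n) ^ 2 := by
        refine Finset.sum_le_sum fun n hn => ?_
        have h1 := hge n hn
        have h2 : ((ι n : ℕ) : ℤ) = n - ⌊φ⌋ - 4 := by simp only [ι]; omega
        have h3 : ((ι n : ℕ) : ℝ) = n - ⌊φ⌋ - 4 := by exact_mod_cast h2
        have h4 := Int.lt_floor_add_one φ
        have h5 : (0 : ℝ) ≤ ι n := Nat.cast_nonneg _
        apply one_div_le_one_div_of_le (by positivity)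
        apply pow_le_pow_left₀ (by positivity)
        linarith
    _ = ∑ j ∈ S.image ι, 1 / ((3 : ℝ) + j) ^ 2 := (Finset.sum_image (f := fun j : ℕ => 1 / ((3 : ℝ) + j) ^ 2) hι).symm
    _ ≤ ∑ j ∈ Finset.range M, 1 / ((3 : ℝ) + j) ^ 2 :=
        Finset.sum_le_sum_of_subset_of_nonneg hM fun _ _ _ => by positivity
    _ ≤ 2 / 5 := sum_one_div_sq_le M

theorem sum_one_div_sq_far_le (φ : ℝ) (S : Finset ℤ) (hS : ∀ n ∈ S, 3 < |φ - n|) :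
    ∑ n ∈ S, 1 / (2 * (φ - n)) ^ 2 ≤ 1 / 5 := by
  have h1 := sum_one_div_sq_above_le φ (S.filter fun n : ℤ => φ < n) (by
    intro n hn
    obtain ⟨hn, hlt⟩ := Finset.mem_filter.1 hn
    have := hS n hn
    rw [abs_of_neg (by linarith)] at this
    linarith)
  have h2 := sum_one_div_sq_above_le (-φ) ((S.filter fun n : ℤ => ¬ φ < n).image Neg.neg) (by
    intro n hn
    obtain ⟨n, hn', rfl⟩ := Finset.mem_image.1 hn
    obtain ⟨hnS, hlt⟩ := Finset.mem_filter.1 hn'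
    have := hS n hnS
    rw [abs_of_nonneg (by linarith)] at this
    push_cast
    linarith)
  rw [Finset.sum_image (fun _ _ _ _ h => neg_injective h)] at h2
  rw [← Finset.sum_filter_add_sum_filter_not S fun n : ℤ => φ < n]
  have h3 : ∀ n : ℤ, 1 / (2 * (φ - n)) ^ 2 = 1 / 4 * (1 / ((n : ℝ) - φ) ^ 2) := by
    intro n
    rw [mul_pow, one_div_mul_one_div, show ((n : ℝ) - φ) ^ 2 = (φ - n) ^ 2 by ring]
    norm_num
  have h4 : ∀ n : ℤ, 1 / (2 * (φ - n)) ^ 2 = 1 / 4 * (1 / (((-n : ℤ) : ℝ) - -φ) ^ 2) := by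
    intro n
    push_cast
    rw [mul_pow, one_div_mul_one_div, show (-(n : ℝ) - -φ) ^ 2 = (φ - n) ^ 2 by ring]
    norm_num
  rw [Finset.sum_congr rfl fun n _ => h3 n,
    Finset.sum_congr (s₁ := S.filter fun n : ℤ => ¬ φ < n) rfl fun n _ => h4 n,
    ← Finset.mul_sum, ← Finset.mul_sum]
  linarith

theorem bitsToNat_injective (m : ℕ) : Function.Injective (bitsToNat (k := m)) := by
  induction m with
  | zero => exact fun _ _ _ => Subsingleton.elim _ _
  | succ m ih =>
    intro z z' h
    rw [bitsToNat_snoc, bitsToNat_snoc z'] at h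
    have h1 := bitsToNat_lt fun j => z j.castSucc
    have h2 := bitsToNat_lt fun j => z' j.castSucc
    have h3 : z (Fin.last m) = z' (Fin.last m) ∧ bitsToNat (fun j => z j.castSucc) =
        bitsToNat (fun j => z' j.castSucc) := by
      cases hz : z (Fin.last m) <;> cases hz' : z' (Fin.last m) <;> simp [hz, hz'] at h ⊢ <;> omega
    funext j
    induction j using Fin.lastCases with
    | last => exact h3.1
    | cast j => exact congrFun (ih h3.2) j

/-- In the exact Fourier transform, an outcome more than `3` away from the encoded phase `φ` has
probability at most `1/5`. Distances are taken modulo `2 ^ m`, since outcomes at both ends of the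
range are neighbours. -/
theorem sum_exact_far_le (d m : ℕ) (hm : 4 ≤ m) (hd : m ≤ d) (φ : ℝ) (h1 : 2 ^ m / 4 ≤ φ)
    (h2 : φ ≤ 3 * 2 ^ m / 4) :
    ∑ z : Fin m → Bool, (if 3 < |φ - bitsToNat z| then ∏ l ∈ Finset.range m,
      fourierProb d (fun l => 2 * Real.pi * φ / 2 ^ (l + 1)) l (extendBits z) else 0) ≤ 1 / 5 := by
  have hN : (16 : ℝ) ≤ 2 ^ m := by
    calc (16 : ℝ) = 2 ^ 4 := by norm_num
      _ ≤ 2 ^ m := pow_le_pow_right₀ (by norm_num) hm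
  have hπ := Real.pi_pos
  -- The representative modulo `2 ^ m` nearest to `φ`.
  let c : ℕ → ℤ := fun k =>
    if 2 ^ m / 2 < φ - k then k + 2 ^ m else if φ - k < -(2 ^ m / 2) then k - 2 ^ m else k
  have hc : ∀ k : ℕ, k < 2 ^ m → |φ - c k| ≤ 2 ^ m / 2 ∧ (3 < |φ - k| → 3 < |φ - c k|) ∧
      ∃ a : ℤ, c k = k + a * 2 ^ m ∧ (a = 0 ∨ a = 1 ∨ a = -1) := by
    intro k hk
    have hk' : (k : ℝ) < 2 ^ m := by exact_mod_cast hk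
    have hk0 : (0 : ℝ) ≤ k := Nat.cast_nonneg k
    simp only [c]
    split_ifs with h3 h4
    · refine ⟨?_, fun _ => ?_, 1, by ring, by simp⟩
      · push_cast
        rw [abs_le]; constructor <;> linarith
      · push_cast
        rw [abs_of_neg (by linarith)]; linarith
    · refine ⟨?_, fun _ => ?_, -1, by ring, by simp⟩
      · push_cast
        rw [abs_le]; constructor <;> linarith
      · push_cast
        rw [abs_of_pos (by linarith)]; linarith
    · refine ⟨?_, fun h => ?_, 0, by ring, by simp⟩
      · push_cast
        rw [abs_le]; constructor <;> linarith
      · push_cast; exact h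
  have hcinj : ∀ k k' : ℕ, k < 2 ^ m → k' < 2 ^ m → c k = c k' → k = k' := by
    intro k k' hk hk' h
    obtain ⟨_, _, a, ha, _⟩ := hc k hk
    obtain ⟨_, _, a', ha', _⟩ := hc k' hk'
    rw [ha, ha'] at h
    have h5 : (k : ℤ) % 2 ^ m = k' % 2 ^ m := by
      have := congrArg (fun x : ℤ => x % 2 ^ m) h
      simpa using this
    rw [Int.emod_eq_of_lt (by positivity) (by exact_mod_cast hk),
      Int.emod_eq_of_lt (by positivity) (by exact_mod_cast hk')] at h5
    exact_mod_cast h5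
  have hterm : ∀ z : Fin m → Bool, 3 < |φ - bitsToNat z| → ∏ l ∈ Finset.range m,
      fourierProb d (fun l => 2 * Real.pi * φ / 2 ^ (l + 1)) l (extendBits z) ≤
        1 / (2 * (φ - c (bitsToNat z))) ^ 2 := by
    intro z hz
    set k := bitsToNat z with hk
    obtain ⟨h3, h4, a, ha, _⟩ := hc k (bitsToNat_lt z)
    have h5 := h4 hz
    set t := φ - c k with ht
    have ht0 : 0 < (2 * t) ^ 2 := by
      have : t ≠ 0 := by
        intro h
        rw [h, abs_zero] at h5
        linarith
      positivity
    rw [le_div_iff₀ ht0]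
    have h6 : ∏ l ∈ Finset.range m,
        fourierProb d (fun l => 2 * Real.pi * φ / 2 ^ (l + 1)) l (extendBits z) =
        (∏ l ∈ Finset.range m, Real.cos (Real.pi * (φ - k) / 2 ^ (l + 1))) ^ 2 := by
      rw [← Finset.prod_pow]
      refine Finset.prod_congr rfl fun l hl => ?_
      rw [fourierProb_eq d m l (Finset.mem_range.1 hl) hd, prefixNat_extendBits]
    have h7 := prod_cos_mul_sin m (Real.pi * (φ - k))
    have h8 : (2 * t) ^ 2 ≤ (2 ^ m * Real.sin (Real.pi * (φ - k) / 2 ^ m)) ^ 2 := by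
      have h9 : Real.sin (Real.pi * (φ - k) / 2 ^ m) ^ 2 = Real.sin (Real.pi * |t| / 2 ^ m) ^ 2 := by
        have h10 : Real.pi * (φ - k) / 2 ^ m = Real.pi * t / 2 ^ m + a * Real.pi := by
          rw [ht, ha]
          push_cast
          field_simp
          ring
        rw [h10, Real.sin_add_int_mul_pi, mul_pow]
        have h11 : (((-1 : ℝ) ^ a) ^ 2) = 1 := by
          rw [← zpow_natCast, ← zpow_mul, mul_comm, zpow_mul]
          norm_num
        rw [h11, one_mul]
        rcases abs_choice t with h | h <;> rw [h]
        rw [mul_neg, neg_div, Real.sin_neg, neg_sq]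
      have h12 : 2 / Real.pi * (Real.pi * |t| / 2 ^ m) ≤ Real.sin (Real.pi * |t| / 2 ^ m) := by
        apply Real.mul_le_sin (by positivity)
        rw [div_le_iff₀ (by positivity)]
        nlinarith
      have h13 : 2 / Real.pi * (Real.pi * |t| / 2 ^ m) = 2 * |t| / 2 ^ m := by
        field_simp
      rw [h13, div_le_iff₀ (by positivity)] at h12
      rw [mul_pow (2 ^ m), h9, ← mul_pow, ← sq_abs (2 * t), abs_mul, abs_two]
      apply pow_le_pow_left₀ (by positivity)
      linarith
    rw [h6]
    calc _ ≤ (∏ l ∈ Finset.range m, Real.cos (Real.pi * (φ - k) / 2 ^ (l + 1))) ^ 2 *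
          (2 ^ m * Real.sin (Real.pi * (φ - k) / 2 ^ m)) ^ 2 :=
          mul_le_mul_of_nonneg_left h8 (sq_nonneg _)
      _ = Real.sin (Real.pi * (φ - k)) ^ 2 := by rw [← mul_pow, h7]
      _ ≤ 1 := Real.sin_sq_le_one _
  calc _ ≤ ∑ z : Fin m → Bool, (if 3 < |φ - bitsToNat z| then
        1 / (2 * (φ - c (bitsToNat z))) ^ 2 else 0) := by
        refine Finset.sum_le_sum fun z _ => ?_
        split
        · next h => exact hterm z h
        · exact le_rfl
    _ = ∑ n ∈ (Finset.univ.filter fun z : Fin m → Bool => 3 < |φ - bitsToNat z|).image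
          (fun z => c (bitsToNat z)), 1 / (2 * (φ - n)) ^ 2 := by
        rw [← Finset.sum_filter, Finset.sum_image]
        intro z _ z' _ h
        exact bitsToNat_injective m (hcinj _ _ (bitsToNat_lt z) (bitsToNat_lt z') h)
    _ ≤ 1 / 5 := by
        apply sum_one_div_sq_far_le
        intro n hn
        obtain ⟨z, hz, rfl⟩ := Finset.mem_image.1 hn
        exact (hc _ (bitsToNat_lt z)).2.1 (Finset.mem_filter.1 hz).2

/-- The same for the Fourier transform with rotations truncated to `d = log₂ m + O(1)` bits. -/
theorem sum_truncated_far_le (d m : ℕ) (hm : 4 ≤ m) (hd : 700 * m ≤ 2 ^ d) (φ : ℝ)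
    (h1 : 2 ^ m / 4 ≤ φ) (h2 : φ ≤ 3 * 2 ^ m / 4) :
    ∑ z : Fin m → Bool, (if 3 < |φ - bitsToNat z| then ∏ l ∈ Finset.range m,
      fourierProb d (fun l => 2 * Real.pi * φ / 2 ^ (l + 1)) l (extendBits z) else 0) ≤
        21 / 100 := by
  have h3 := sum_exact_far_le (d + m) m hm (by omega) φ h1 h2
  set β : ℕ → ℝ := fun l => 2 * Real.pi * φ / 2 ^ (l + 1)
  have h4 := (isBitChain_fourierProb d β).sum_abs_sub_le (isBitChain_fourierProb (d + m) β)
    (abs_fourierProb_sub_le d m β) m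
  have h5 : 2 * m * (Real.pi / 2 ^ d / 2) ≤ 1 / 100 := by
    have h6 : (700 * m : ℝ) ≤ 2 ^ d := by exact_mod_cast hd
    have h7 := Real.pi_lt_four
    have h8 : 2 * m * (Real.pi / 2 ^ d / 2) = m * Real.pi / 2 ^ d := by ring
    rw [h8, div_le_iff₀ (by positivity)]
    nlinarith [(Nat.cast_nonneg m : (0 : ℝ) ≤ m)]
  have h6 : ∑ z : Fin m → Bool, (if 3 < |φ - bitsToNat z| then ∏ l ∈ Finset.range m,
      fourierProb d β l (extendBits z) else 0) ≤
      ∑ z : Fin m → Bool, ((if 3 < |φ - bitsToNat z| then ∏ l ∈ Finset.range m,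
        fourierProb (d + m) β l (extendBits z) else 0) +
        |∏ l ∈ Finset.range m, fourierProb d β l (extendBits z) -
          ∏ l ∈ Finset.range m, fourierProb (d + m) β l (extendBits z)|) := by
    refine Finset.sum_le_sum fun z _ => ?_
    split
    · linarith [le_abs_self (∏ l ∈ Finset.range m, fourierProb d β l (extendBits z) -
          ∏ l ∈ Finset.range m, fourierProb (d + m) β l (extendBits z))]
    · rw [zero_add]; exact abs_nonneg _
  rw [Finset.sum_add_distrib] at h6
  linarith

/-! ### The truncated Fourier transform as a circuit -/

namespace WireOp

variable {Q : Type}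

/-- The rotations of wire `l` by the outcomes on the `d` preceding wires. -/
def fourierRotations (m d : ℕ) (l : Fin m) : List (WireOp Q (Fin m)) :=
  (List.range d).map fun k =>
    if h : k < (l : ℕ) then cphase (-(2 * Real.pi / 2 ^ (k + 2))) ⟨(l : ℕ) - 1 - k, by omega⟩ l
    else phase 0 l

/-- Reading of the bit `l` in the Fourier transform: a fixed phase `γ`, rotations by the outcomes on
the preceding wires, and a Hadamard gate. -/
def fourierStep (m d : ℕ) (γ : ℕ → ℝ) (l : Fin m) : List (WireOp Q (Fin m)) :=
  phase (γ l) l :: (fourierRotations m d l ++ [had l])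

/-- The Fourier transform on `m` wires, with rotations truncated to `d` bits. It leaves the bits of
the outcome in the order in which they are read, the least significant one first. -/
def fourierCircuit (m d : ℕ) (γ : ℕ → ℝ) : List (WireOp Q (Fin m)) :=
  (List.finRange m).flatMap (fourierStep m d γ)

theorem length_fourierCircuit (m d : ℕ) (γ : ℕ → ℝ) :
    (fourierCircuit m d γ : List (WireOp Q (Fin m))).length = m * (d + 2) := by
  have h : ∀ l : Fin m, (fourierStep m d γ l : List (WireOp Q (Fin m))).length = d + 2 := by
    intro l
    simp [fourierStep, fourierRotations]
  rw [fourierCircuit, List.length_flatMap]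
  simp [h]

theorem isQuery_fourierCircuit (m d : ℕ) (γ : ℕ → ℝ) :
    ∀ op ∈ (fourierCircuit m d γ : List (WireOp Q (Fin m))), op.isQuery = false := by
  intro op hop
  obtain ⟨l, _, hl⟩ := List.mem_flatMap.1 hop
  simp only [fourierStep, fourierRotations, List.mem_cons, List.mem_append, List.mem_map,
    List.not_mem_nil, or_false] at hl
  rcases hl with rfl | ⟨k, _, rfl⟩ | rfl
  · rfl
  · split
    · exact isQuery_cphase _ _ _
    · rfl
  · rfl

variable [Fintype Q] [DecidableEq Q] (U : Matrix (Q → Bool) (Q → Bool) ℂ)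

theorem run_fourierRotations (m d : ℕ) (l : Fin m) (φ : (Fin m → Bool) → ℂ) :
    run U (fourierRotations m d l) φ = fun z =>
      Complex.exp ((if z l then -fourierAngle d l (extendBits z) else 0 : ℝ) * Complex.I) *
        φ z := by
  induction d with
  | zero =>
    funext z
    simp [fourierRotations, fourierAngle]
  | succ d ih =>
    have h : (fourierRotations m (d + 1) l : List (WireOp Q (Fin m))) =
        fourierRotations m d l ++ [if h : d < (l : ℕ) then
          cphase (-(2 * Real.pi / 2 ^ (d + 2))) ⟨(l : ℕ) - 1 - d, by omega⟩ l
          else phase 0 l] := by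
      simp [fourierRotations, List.range_succ]
    rw [h, run_append, ih, run_cons, run_nil]
    have h1 : ∀ z : Fin m → Bool, fourierAngle (d + 1) l (extendBits z) =
        fourierAngle d l (extendBits z) +
          if d < (l : ℕ) ∧ extendBits z (l - 1 - d) = true then 2 * Real.pi / 2 ^ (d + 2)
          else 0 := by
      intro z
      unfold fourierAngle
      rw [Finset.sum_range_succ]
    funext z
    rw [h1]
    by_cases hd : d < (l : ℕ)
    · have h2 : extendBits z (l - 1 - d) = z ⟨(l : ℕ) - 1 - d, by omega⟩ :=
        extendBits_fin z ⟨(l : ℕ) - 1 - d, by omega⟩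
      simp only [hd, dif_pos, apply_cphase, true_and, h2]
      rw [← mul_assoc, ← Complex.exp_add, ← add_mul, ← Complex.ofReal_add]
      congr 3
      cases z l <;> cases z ⟨(l : ℕ) - 1 - d, by omega⟩ <;> simp
    · simp [hd, apply_phase]

/-- The amplitude of the outcome of wire `l` when the transform is applied to a product state with
phases `β`. -/
def fourierFactor (d : ℕ) (β γ : ℕ → ℝ) (l : ℕ) (z : ℕ → Bool) : ℂ :=
  (1 + Complex.exp ((β l + γ l - fourierAngle d l z - if z l then Real.pi else 0 : ℝ) *
    Complex.I)) / 2

theorem normSq_fourierFactor (d : ℕ) (β γ : ℕ → ℝ) (l : ℕ) (z : ℕ → Bool) :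
    ‖fourierFactor d β γ l z‖ ^ 2 = fourierProb d (fun l => β l + γ l) l z := by
  unfold fourierFactor fourierProb
  set θ : ℝ := β l + γ l - fourierAngle d l z - if z l then Real.pi else 0
  rw [norm_div, div_pow, Complex.norm_two, ← Complex.normSq_eq_norm_sq, Complex.normSq_apply]
  simp only [Complex.add_re, Complex.one_re, Complex.add_im, Complex.one_im,
    Complex.exp_ofReal_mul_I_re, Complex.exp_ofReal_mul_I_im]
  have := Real.sin_sq_add_cos_sq θ
  linear_combination (1 / 4) * this

/-- The state after the bits `l < j` are read: a product, since the outcome on a wire only rotates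
wires that are read later. -/
def fourierState (m d : ℕ) (β γ : ℕ → ℝ) (j : ℕ) (z : Fin m → Bool) : ℂ :=
  ∏ l : Fin m, if (l : ℕ) < j then fourierFactor d β γ l (extendBits z)
    else Complex.exp ((if z l then β l else 0 : ℝ) * Complex.I) / (Real.sqrt 2 : ℂ)

theorem run_fourierStep (m d : ℕ) (β γ : ℕ → ℝ) (l : Fin m) :
    run U (fourierStep m d γ l) (fourierState m d β γ l) = fourierState m d β γ (l + 1) := by
  rw [fourierStep, run_cons, run_append, run_fourierRotations, run_cons, run_nil, apply_phase,
    apply_had]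
  funext z
  let R : (Fin m → Bool) → ℂ := fun z => ∏ l' ∈ Finset.univ.erase l,
    if (l' : ℕ) < l then fourierFactor d β γ l' (extendBits z)
    else Complex.exp ((if z l' then β l' else 0 : ℝ) * Complex.I) / (Real.sqrt 2 : ℂ)
  have hne : ∀ (n : ℕ) (v : Bool), n ≠ l →
      extendBits (Function.update z l v) n = extendBits z n := by
    intro n v hn
    unfold extendBits
    split
    · rw [Function.update_of_ne]
      intro h
      exact hn (congrArg Fin.val h)
    · rfl
  have hangle : ∀ v, fourierAngle d l (extendBits (Function.update z l v)) =
      fourierAngle d l (extendBits z) := fun v =>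
    fourierAngle_congr d l fun n hn => hne n v hn.ne
  have hR : ∀ v, R (Function.update z l v) = R z := by
    intro v
    refine Finset.prod_congr rfl fun l' hl' => ?_
    have h1 : l' ≠ l := Finset.ne_of_mem_erase hl'
    rw [Function.update_of_ne h1]
    by_cases h2 : (l' : ℕ) < l
    · rw [if_pos h2, if_pos h2, fourierFactor, fourierFactor, hne l' v h2.ne,
        fourierAngle_congr d l' fun n hn => hne n v (hn.trans h2).ne]
    · rw [if_neg h2, if_neg h2]
  have hold : ∀ z, fourierState m d β γ l z =
      Complex.exp ((if z l then β l else 0 : ℝ) * Complex.I) / (Real.sqrt 2 : ℂ) * R z := by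
    intro z
    rw [fourierState, ← Finset.mul_prod_erase Finset.univ _ (Finset.mem_univ l), if_neg (lt_irrefl _)]
  have hnew : fourierState m d β γ (l + 1) z = fourierFactor d β γ l (extendBits z) * R z := by
    rw [fourierState, ← Finset.mul_prod_erase Finset.univ _ (Finset.mem_univ l),
      if_pos (Nat.lt_succ_self _)]
    congr 1
    refine Finset.prod_congr rfl fun l' hl' => ?_
    have h1 : (l' : ℕ) ≠ l := fun h => Finset.ne_of_mem_erase hl' (Fin.ext h)
    have h2 : (l' : ℕ) < l + 1 ↔ (l' : ℕ) < l := by omega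
    simp only [h2]
  rw [hnew]
  simp only [hold, hR, hangle, Function.update_self, fourierFactor, extendBits_fin]
  have hexp : Complex.exp ((β l + γ l - fourierAngle d l (extendBits z) : ℝ) * Complex.I) =
      Complex.exp ((-fourierAngle d l (extendBits z) : ℝ) * Complex.I) *
        (Complex.exp ((γ l : ℝ) * Complex.I) * Complex.exp ((β l : ℝ) * Complex.I)) := by
    rw [← Complex.exp_add, ← Complex.exp_add]
    congr 1
    push_cast
    ring
  have hπ : ∀ θ : ℝ, Complex.exp ((θ - Real.pi : ℝ) * Complex.I) =
      -Complex.exp (θ * Complex.I) := by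
    intro θ
    rw [Complex.ofReal_sub, sub_mul, Complex.exp_sub_pi_mul_I]
  have h2 := sqrt_two_mul_sqrt_two
  have h0 := sqrt_two_ne_zero
  cases z l
  · simp only [Bool.false_eq_true, if_false, if_true, sub_zero, hexp]
    simp
    field_simp
    simp [sq, h2]
    ring
  · simp only [Bool.false_eq_true, if_false, if_true, hπ, hexp]
    simp
    field_simp
    simp [sq, h2]
    ring

theorem run_fourierCircuit (m d : ℕ) (β γ : ℕ → ℝ) :
    run U (fourierCircuit m d γ) (fun z => ∏ l : Fin m,
      Complex.exp ((if z l then β l else 0 : ℝ) * Complex.I) / (Real.sqrt 2 : ℂ)) =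
    fun z => ∏ l : Fin m, fourierFactor d β γ l (extendBits z) := by
  have key : ∀ j ≤ m, run U (((List.finRange m).take j).flatMap (fourierStep m d γ))
      (fourierState m d β γ 0) = fourierState m d β γ j := by
    intro j
    induction j with
    | zero => intro _; simp
    | succ j ih =>
      intro hj
      rw [List.take_succ_eq_append_getElem (by simpa using hj), List.flatMap_append, run_append,
        ih (by omega)]
      have := run_fourierStep U m d β γ ⟨j, hj⟩
      simpa using this
  have h := key m le_rfl
  rw [List.take_of_length_le (by simp)] at h
  have h0 : fourierState m d β γ 0 = fun z => ∏ l : Fin m,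
      Complex.exp ((if z l then β l else 0 : ℝ) * Complex.I) / (Real.sqrt 2 : ℂ) := by
    funext z
    simp [fourierState]
  have hm : fourierState m d β γ m = fun z => ∏ l : Fin m,
      fourierFactor d β γ l (extendBits z) := by
    funext z
    simp [fourierState]
  rw [← h0, ← hm]
  exact h

theorem normSq_prod_fourierFactor (m d : ℕ) (β γ : ℕ → ℝ) (z : Fin m → Bool) :
    ‖∏ l : Fin m, fourierFactor d β γ l (extendBits z)‖ ^ 2 =
      ∏ l ∈ Finset.range m, fourierProb d (fun l => β l + γ l) l (extendBits z) := by
  rw [norm_prod, ← Finset.prod_pow, ← Fin.prod_univ_eq_prod_range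
    (fun l => fourierProb d (fun l => β l + γ l) l (extendBits z)) m]
  exact Finset.prod_congr rfl fun l _ => normSq_fourierFactor d β γ l _

end WireOp

/-! ### Medians and phases as quantum circuits -/

/-- The number of gates of the Boolean circuit for the median of `T = 2 ^ (q + 1) - 1` numbers of `b`
bits. -/
def medianCost (q b : ℕ) : ℕ := 1 + b * ((2 ^ (q + 1) - 1) * (2 * q + 7) + 1)

/-- Reversible computation of several medians of the numbers held by the wires `inp`, with clean
ancillas `anc`; the results appear on the wires `w`. -/
theorem exists_median_flips {κ : Type} [DecidableEq κ] (n q b T N : ℕ) (hT : T + 1 = 2 ^ (q + 1))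
    (hN : N = n * medianCost q b) (anc : Fin N → κ) (hanc : Function.Injective anc)
    (inp : Fin n → Fin T → Fin b → κ) (hinp : ∀ i t l a, anc a ≠ inp i t l)
    (W : Set κ) (hancW : ∀ a, anc a ∈ W) (hinpW : ∀ i t l, inp i t l ∈ W) :
    ∃ (L : List (Flip κ)) (w : Fin n → Fin b → κ), L.length ≤ 4 * N ∧ (∀ i l, w i l ∈ W) ∧
      ∀ s : κ → Bool, (∀ a, s (anc a) = false) →
        (∀ v, (∀ a, anc a ≠ v) → Flip.fwd L s v = s v) ∧
        ∀ i, ∀ S : Set ℕ, S.OrdConnected →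
          (∃ B : Finset (Fin T),
            (∀ t ∉ B, bitsToNat (fun l => s (inp i t l)) ∈ S) ∧ 2 * B.card < T) →
          bitsToNat (fun l => Flip.fwd L s (w i l)) ∈ S := by
  subst hN
  have hpow := hT
  obtain rfl : T = 2 ^ (q + 1) - 1 := by omega
  have hpos : 0 < 2 ^ (q + 1) - 1 := by
    have : 2 ^ 1 ≤ 2 ^ (q + 1) := Nat.pow_le_pow_right (by norm_num) (by omega)
    omega
  rcases Nat.eq_zero_or_pos b with rfl | hb
  · refine ⟨[], fun _ l => l.elim0, by simp, fun _ l => l.elim0, fun s _ => ⟨fun _ _ => rfl, ?_⟩⟩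
    rintro i S hS ⟨B, hB, hB'⟩
    obtain ⟨t, ht⟩ : ∃ t, t ∉ B := by
      by_contra! h
      have : B = Finset.univ := Finset.eq_univ_iff_forall.2 h
      rw [this, Finset.card_univ, Fintype.card_fin] at hB'
      omega
    simpa [bitsToNat] using hB t ht
  · let X := {s : κ → Bool // ∀ a, s (anc a) = false}
    let f : Fin n → Fin (2 ^ (q + 1) - 1) → Fin b → X → Bool := fun i t l s => s.1 (inp i t l)
    let G : Set (X → Bool) := {g | ∃ i t l, f i t l = g}
    have hM : ∀ i : Fin n, ∃ M : Fin b → X → Bool, Derives G (medianCost q b) (Set.range M) ∧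
        ∀ x, ∀ S : Set ℕ, S.OrdConnected →
          (∃ B : Finset (Fin (2 ^ (q + 1) - 1)),
            (∀ t ∉ B, bitsToNat (fun l => f i t l x) ∈ S) ∧ 2 * B.card < 2 ^ (q + 1) - 1) →
          bitsToNat (fun l => M l x) ∈ S := fun i =>
      Derives.exists_median q _ hpow b G ⟨_, i, ⟨0, hpos⟩, ⟨0, hb⟩, rfl⟩ (f i)
        (fun t l => ⟨i, t, l, rfl⟩)
    choose M hM₁ hM₂ using hM
    obtain ⟨L, hL, hL', hL''⟩ := (Derives.iUnion hM₁).exists_flips anc hanc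
      (fun x : X => x.1) W hancW (by
        rintro _ ⟨i, t, l, rfl⟩
        exact ⟨inp i t l, hinpW i t l, hinp i t l, fun _ => rfl⟩) (fun x => x.2)
    have hw : ∀ i l, ∃ w ∈ W, ∀ x : X, Flip.fwd L x.1 w = M i l x := fun i l =>
      hL'' _ (Set.mem_iUnion.2 ⟨i, l, rfl⟩)
    choose w hwW hw using hw
    refine ⟨L, w, hL, hwW, fun s hs => ⟨fun v hv => hL' ⟨s, hs⟩ v hv, fun i S hS h => ?_⟩⟩
    have := hM₂ i ⟨s, hs⟩ S hS h
    simpa only [← hw] using this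

namespace WireOp

/-- The adjoint queries undo the queries. -/
theorem run_unquery {Q κ : Type} [Fintype Q] [DecidableEq Q]
    {U : Matrix (Q → Bool) (Q → Bool) ℂ} (hU : U ∈ Matrix.unitaryGroup (Q → Bool) ℂ) (l : List (Q ↪ κ))
    (φ : (κ → Bool) → ℂ) :
    run U (l.reverse.map queryAdjoint) (run U (l.map query) φ) = φ := by
  induction l generalizing φ with
  | nil => rfl
  | cons e l ih =>
    rw [List.reverse_cons, List.map_append, run_append, List.map_cons (f := query), run_cons, ih]
    have : U.conjTranspose * U = 1 := Matrix.mem_unitaryGroup_iff'.1 hU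
    simp only [List.map_cons, List.map_nil, run_cons, run_nil, apply, applyOn_applyOn, this,
      applyOn_one]

theorem run_phases {Q κ I : Type} [Fintype Q] [DecidableEq Q]
    (U : Matrix (Q → Bool) (Q → Bool) ℂ) (l : List I) (w : I → κ) (θ : I → ℝ) (φ : (κ → Bool) → ℂ) :
    run U (l.map fun i => phase (θ i) (w i)) φ = fun s =>
      Complex.exp (((l.map fun i => if s (w i) then θ i else 0).sum : ℝ) * Complex.I) * φ s := by
  induction l generalizing φ with
  | nil => simp
  | cons i l ih =>
    rw [List.map_cons, run_cons, ih, apply_phase]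
    funext s
    rw [← mul_assoc, ← Complex.exp_add, List.map_cons, List.sum_cons, Complex.ofReal_add, add_mul,
      add_comm]

variable {Q κ : Type} [DecidableEq κ]

/-- Phases `θ l` on the wires `w l`, as they are after the classical circuit `L`, which is then
undone. -/
def computedPhase {b : ℕ} (L : List (Flip κ)) (w : Fin b → κ) (θ : Fin b → ℝ) :
    List (WireOp Q κ) :=
  Flip.circuit L ++ (List.finRange b).map (fun l => phase (θ l) (w l)) ++ Flip.circuit L.reverse

theorem length_computedPhase_le {b : ℕ} (L : List (Flip κ)) (w : Fin b → κ) (θ : Fin b → ℝ) :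
    (computedPhase L w θ : List (WireOp Q κ)).length ≤ 22 * L.length + b := by
  have h1 := Flip.length_circuit_le (Q := Q) L
  have h2 := Flip.length_circuit_le (Q := Q) L.reverse
  rw [List.length_reverse] at h2
  simp only [computedPhase, List.length_append, List.length_map, List.length_finRange]
  omega

theorem isQuery_computedPhase {b : ℕ} (L : List (Flip κ)) (w : Fin b → κ) (θ : Fin b → ℝ) :
    ∀ op ∈ (computedPhase L w θ : List (WireOp Q κ)), op.isQuery = false := by
  intro op hop
  simp only [computedPhase, List.mem_append, List.mem_map] at hop
  rcases hop with (h | ⟨l, _, rfl⟩) | h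
  · exact Flip.isQuery_circuit L op h
  · rfl
  · exact Flip.isQuery_circuit L.reverse op h

variable [Fintype Q] [DecidableEq Q] (U : Matrix (Q → Bool) (Q → Bool) ℂ)

theorem run_computedPhase {b : ℕ} (L : List (Flip κ)) (w : Fin b → κ) (θ : Fin b → ℝ)
    (φ : (κ → Bool) → ℂ) :
    run U (computedPhase L w θ) φ = fun s =>
      Complex.exp ((∑ l, if Flip.fwd L s (w l) then θ l else 0 : ℝ) * Complex.I) * φ s := by
  rw [computedPhase, run_append, run_append, Flip.run_circuit, run_phases, Flip.run_circuit,
    Flip.bwd_reverse]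
  funext s
  simp only [Flip.bwd_fwd]
  rw [← Fin.sum_univ_def]

/-- Hadamard gates on distinct wires prepare a uniform superposition. -/
theorem run_hadamards [Fintype κ] (l : List κ) (hl : l.Nodup) :
    run U (l.map had) (Pi.single (fun _ => false) 1) =
      fun s => ∏ v : κ, if v ∈ l then ((Real.sqrt 2 : ℂ))⁻¹ else if s v then 0 else 1 := by
  have key : ∀ l l' : List κ, (l ++ l').Nodup → run U (l'.map had)
      (fun s => ∏ v : κ, if v ∈ l then ((Real.sqrt 2 : ℂ))⁻¹ else if s v then 0 else 1) =
      fun s => ∏ v : κ, if v ∈ l ++ l' then ((Real.sqrt 2 : ℂ))⁻¹ else if s v then 0 else 1 := by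
    intro l l' h
    induction l' generalizing l with
    | nil => simp
    | cons a l' ih =>
      have ha : a ∉ l := by
        intro h1
        exact (List.nodup_append.1 h).2.2 a h1 a (by simp) rfl
      rw [List.append_cons] at h
      rw [List.append_cons, ← ih (l ++ [a]) h, List.map_cons, run_cons]
      congr 1
      rw [apply_had]
      funext s
      have h1 : ∀ x : Bool, (∏ v : κ, if v ∈ l then ((Real.sqrt 2 : ℂ))⁻¹
          else if Function.update s a x v then 0 else 1) =
          (if x then 0 else 1) * ∏ v ∈ Finset.univ.erase a,
            if v ∈ l ++ [a] then ((Real.sqrt 2 : ℂ))⁻¹ else if s v then 0 else 1 := by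
        intro x
        rw [← Finset.mul_prod_erase Finset.univ _ (Finset.mem_univ a), if_neg ha,
          Function.update_self]
        congr 1
        refine Finset.prod_congr rfl fun v hv => ?_
        have hva := Finset.ne_of_mem_erase hv
        rw [Function.update_of_ne hva]
        simp [hva]
      rw [h1, h1, ← Finset.mul_prod_erase Finset.univ _ (Finset.mem_univ a)]
      simp
      ring
  have h := key [] l (by simpa using hl)
  rw [List.nil_append] at h
  rw [← h]
  congr 1
  funext s
  simp only [List.not_mem_nil, if_false]
  by_cases hs : s = fun _ => false
  · subst hs
    simp
  · rw [Pi.single_eq_of_ne hs]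
    obtain ⟨v, hv⟩ := Function.ne_iff.1 hs
    symm
    apply Finset.prod_eq_zero (Finset.mem_univ v)
    simp only [ne_eq, Bool.not_eq_false] at hv
    simp [hv]

end WireOp

/-! ### Registers -/

/-- The wires of a circuit with a register `ι`, `R` copies of a register `Y`, and `k` ancillas. In a
single run, `ι` is the query register and `Y` consists of an answer and a workspace register; in the
whole algorithm, `ι` is the output register and `Y` holds the wires of a single run. -/
abbrev RegWire (ι Y : Type) (R k : ℕ) : Type := ι ⊕ (Fin R × Y) ⊕ Fin k

namespace RegWire

variable {ι Y : Type} {R k : ℕ}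

/-- The position of the registers of the `r`-th query. -/
def queryWires (k : ℕ) (r : Fin R) : ι ⊕ Y ↪ RegWire ι Y R k :=
  ⟨Sum.elim Sum.inl fun y => Sum.inr (Sum.inl (r, y)), by
    rintro (i | y) (i' | y') h <;> simp_all⟩

/-- The contents of the three groups of registers. -/
def split : (RegWire ι Y R k → Bool) ≃ (ι → Bool) × (Fin R → Y → Bool) × (Fin k → Bool) where
  toFun s := (fun i => s (.inl i), fun r y => s (.inr (.inl (r, y))), fun j => s (.inr (.inr j)))
  invFun p := Sum.elim p.1 (Sum.elim (fun q => p.2.1 q.1 q.2) p.2.2)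
  left_inv s := by
    funext v
    rcases v with i | ⟨r, y⟩ | j <;> rfl
  right_inv p := rfl

end RegWire

/-- The amplitude of `y` in the all-zero basis state. -/
def zeroAmp {α : Type} [Fintype α] (y : α → Bool) : ℂ :=
  ∏ v : α, if y v then 0 else 1

theorem zeroAmp_eq {α : Type} [Fintype α] [DecidableEq α] (y : α → Bool) :
    zeroAmp y = if y = fun _ => false then 1 else 0 := by
  unfold zeroAmp
  split
  · next h => subst h; simp
  · next h =>
    obtain ⟨v, hv⟩ := Function.ne_iff.1 h
    apply Finset.prod_eq_zero (Finset.mem_univ v)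
    simpa using hv

theorem sum_mul_normSq_zeroAmp {α : Type} [Fintype α] [DecidableEq α] (F : (α → Bool) → ℝ) :
    ∑ y, F y * ‖zeroAmp y‖ ^ 2 = F fun _ => false := by
  rw [Finset.sum_eq_single fun _ => false]
  · simp [zeroAmp_eq]
  · intro y _ hy
    simp [zeroAmp_eq, hy]
  · simp

section Queries

variable {ι Y : Type} [Fintype ι] [DecidableEq ι] [Fintype Y] [DecidableEq Y] {R k : ℕ}
  {U : Matrix (ι ⊕ Y → Bool) (ι ⊕ Y → Bool) ℂ}

/-- The amplitude of the answer and workspace `y` on the query `x`. -/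
def answerAmp (U : Matrix (ι ⊕ Y → Bool) (ι ⊕ Y → Bool) ℂ) (x : ι → Bool) (y : Y → Bool) : ℂ :=
  U (Sum.elim x y) (Sum.elim x fun _ => false)

open RegWire in
/-- All `R` queries share the query register and use separate answer and workspace registers. They
turn a superposition of queries with clean registers into one of queries with `R` independent
answers. -/
theorem run_queries (hU : ∀ x x' y, x' ≠ x → U (Sum.elim x' y) (Sum.elim x fun _ => false) = 0)
    (c : (ι → Bool) → ℂ) :
    WireOp.run U ((List.finRange R).map fun r => WireOp.query (queryWires k r))
      (fun s => c (split s).1 * (∏ r, zeroAmp ((split s).2.1 r)) * zeroAmp (split s).2.2) =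
    fun s => c (split s).1 * (∏ r, answerAmp U (split s).1 ((split s).2.1 r)) *
      zeroAmp (split s).2.2 := by
  let st : List (Fin R) → (RegWire ι Y R k → Bool) → ℂ := fun l s =>
    c (split s).1 * (∏ r, if r ∈ l then answerAmp U (split s).1 ((split s).2.1 r)
      else zeroAmp ((split s).2.1 r)) * zeroAmp (split s).2.2
  have key : ∀ l l' : List (Fin R), (l ++ l').Nodup →
      WireOp.run U (l'.map fun r => WireOp.query (queryWires k r)) (st l) = st (l ++ l') := by
    intro l l' h
    induction l' generalizing l with
    | nil => simp
    | cons r l' ih =>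
      have hr : r ∉ l := by
        intro h1
        exact (List.nodup_append.1 h).2.2 r h1 r (by simp) rfl
      rw [List.append_cons] at h
      rw [List.append_cons, ← ih (l ++ [r]) h, List.map_cons, WireOp.run_cons]
      congr 1
      funext s
      -- Replacing the registers of the query by `(x', y')`.
      have hext : ∀ (x' : ι → Bool) (y' : Y → Bool),
          split (Function.extend (queryWires k r) (Sum.elim x' y') s) =
            (x', Function.update (split s).2.1 r y', (split s).2.2) := by
        intro x' y'
        have hin : ∀ q, Function.extend (queryWires k r) (Sum.elim x' y') s (queryWires k r q) =
            Sum.elim x' y' q := fun q => (queryWires k r).injective.extend_apply _ _ q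
        refine Prod.ext ?_ (Prod.ext ?_ ?_)
        · funext i
          exact hin (.inl i)
        · funext r' y
          by_cases hrr : r' = r
          · subst hrr
            simp only [Function.update_self]
            exact hin (.inr y)
          · simp only [Function.update_of_ne hrr]
            refine Function.extend_apply' _ _ _ ?_
            rintro ⟨i | y'', hq⟩
            · cases hq
            · have hq' : (Sum.inr (Sum.inl (r, y'')) : RegWire ι Y R k) =
                  Sum.inr (Sum.inl (r', y)) := hq
              simp only [Sum.inr.injEq, Sum.inl.injEq, Prod.mk.injEq] at hq'
              exact hrr hq'.1.symm
        · funext j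
          refine Function.extend_apply' _ _ _ ?_
          rintro ⟨i | y'', hq⟩ <;> cases hq
      have hcomp : s ∘ queryWires k r = Sum.elim (split s).1 ((split s).2.1 r) := by
        funext q
        rcases q with i | y <;> rfl
      simp only [WireOp.apply, applyOn, hcomp]
      rw [Finset.sum_eq_single (Sum.elim (split s).1 fun _ => false)]
      · simp only [st, hext]
        rw [← Finset.mul_prod_erase Finset.univ _ (Finset.mem_univ r),
          ← Finset.mul_prod_erase Finset.univ (fun r' => if r' ∈ l ++ [r] then
            answerAmp U (split s).1 ((split s).2.1 r') else zeroAmp ((split s).2.1 r'))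
            (Finset.mem_univ r)]
        have h1 : ∏ x ∈ Finset.univ.erase r, (if x ∈ l then
            answerAmp U (split s).1 (Function.update (split s).2.1 r (fun _ => false) x) else
            zeroAmp (Function.update (split s).2.1 r (fun _ => false) x)) =
            ∏ r' ∈ Finset.univ.erase r, (if r' ∈ l ++ [r] then
              answerAmp U (split s).1 ((split s).2.1 r') else zeroAmp ((split s).2.1 r')) := by
          refine Finset.prod_congr rfl fun r' hr' => ?_
          have := Finset.ne_of_mem_erase hr'
          rw [Function.update_of_ne this]
          simp [this]
        rw [h1, if_neg hr, Function.update_self, if_pos (by simp), zeroAmp_eq, if_pos rfl]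
        simp only [answerAmp]
        ring
      · intro t _ ht
        obtain ⟨x', y', rfl⟩ : ∃ x' y', t = Sum.elim x' y' :=
          ⟨t ∘ Sum.inl, t ∘ Sum.inr, (Sum.elim_comp_inl_inr t).symm⟩
        by_cases hy : y' = fun _ => false
        · subst hy
          have hx : x' ≠ (split s).1 := by
            rintro rfl
            exact ht rfl
          rw [hU _ _ _ hx.symm, zero_mul]
        · simp only [st, hext]
          rw [Finset.prod_eq_zero (Finset.mem_univ r)]
          · simp
          · rw [if_neg hr, Function.update_self, zeroAmp_eq, if_neg hy]
      · simp
  have h := key [] (List.finRange R) (by simpa using List.nodup_finRange R)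
  simpa [st] using h

theorem sum_normSq_answerAmp (hU' : U ∈ Matrix.unitaryGroup (ι ⊕ Y → Bool) ℂ)
    (hU : ∀ x x' y, x' ≠ x → U (Sum.elim x' y) (Sum.elim x fun _ => false) = 0) (x : ι → Bool) :
    ∑ y, ‖answerAmp U x y‖ ^ 2 = 1 := by
  have h1 := congrFun (congrFun (Matrix.mem_unitaryGroup_iff'.1 hU')
    (Sum.elim x fun _ => false)) (Sum.elim x fun _ => false)
  rw [Matrix.mul_apply, Matrix.one_apply_eq,
    ← Equiv.sum_comp (Equiv.sumArrowEquivProdArrow ι Y Bool).symm, Fintype.sum_prod_type,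
    Finset.sum_eq_single x] at h1
  · have h2 : ((∑ y, ‖answerAmp U x y‖ ^ 2 : ℝ) : ℂ) = 1 := by
      rw [← h1]
      push_cast
      refine Finset.sum_congr rfl fun y _ => ?_
      rw [← Complex.conj_mul']
      rfl
    exact_mod_cast h2
  · intro x' _ hx'
    refine Finset.sum_eq_zero fun y _ => ?_
    have : U ((Equiv.sumArrowEquivProdArrow ι Y Bool).symm (x', y)) (Sum.elim x fun _ => false) =
        0 := hU x x' y hx'
    rw [this, mul_zero]
  · simp

/-- A relational oracle preserves the query, and the answer is invalid with probability at most `ε`.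
-/
theorem sum_normSq_bad_answerAmp {κ ω : Type} [Fintype κ] [DecidableEq κ] [Fintype ω]
    [DecidableEq ω] {F : (ι → Bool) → Set (κ → Bool)} {ε : ℝ}
    {U : Matrix (ι ⊕ κ ⊕ ω → Bool) (ι ⊕ κ ⊕ ω → Bool) ℂ} (h : IsRelationalOracle F ε U) :
    (∀ x x' y, x' ≠ x → U (Sum.elim x' y) (Sum.elim x fun _ => false) = 0) ∧
    ∀ x, ∀ bad : (κ ⊕ ω → Bool) → Prop, ∀ _ : DecidablePred bad,
      (∀ y, bad y → y ∘ Sum.inl ∉ F x) →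
      ∑ y, (if bad y then ‖answerAmp U x y‖ ^ 2 else 0) ≤ ε := by
  obtain ⟨hU, h⟩ := h
  have hzero : (Sum.elim (fun _ => false) fun _ => false : κ ⊕ ω → Bool) = fun _ => false := by
    funext q; cases q <;> rfl
  have hU0 : ∀ x x' y, x' ≠ x → U (Sum.elim x' y) (Sum.elim x fun _ => false) = 0 := by
    intro x x' y hx
    obtain ⟨α, ψ, _, h2, _⟩ := h x
    have := h2 x' (y ∘ Sum.inl) (y ∘ Sum.inr)
    rw [hzero, if_neg hx, Sum.elim_comp_inl_inr] at this
    exact this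
  refine ⟨hU0, fun x bad _ hbad => ?_⟩
  obtain ⟨α, ψ, h1, h2, h3⟩ := h x
  have hamp : ∀ y v, answerAmp U x (Sum.elim y v) = α y * ψ y v := by
    intro y v
    have := h2 x y v
    rw [hzero, if_pos rfl] at this
    exact this
  have hsum : ∀ p : (κ → Bool) → ℝ, ∑ y : κ ⊕ ω → Bool, p (y ∘ Sum.inl) * ‖answerAmp U x y‖ ^ 2 =
      ∑ y, p y * ‖α y‖ ^ 2 := by
    intro p
    rw [← Equiv.sum_comp (Equiv.sumArrowEquivProdArrow κ ω Bool).symm, Fintype.sum_prod_type]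
    refine Finset.sum_congr rfl fun y _ => ?_
    have : ∀ v, p ((Equiv.sumArrowEquivProdArrow κ ω Bool).symm (y, v) ∘ Sum.inl) *
        ‖answerAmp U x ((Equiv.sumArrowEquivProdArrow κ ω Bool).symm (y, v))‖ ^ 2 =
        p y * ‖α y‖ ^ 2 * ‖ψ y v‖ ^ 2 := by
      intro v
      have h4 : answerAmp U x ((Equiv.sumArrowEquivProdArrow κ ω Bool).symm (y, v)) =
        α y * ψ y v := hamp y v
      rw [h4, norm_mul, mul_pow, ← mul_assoc]
      rfl
    rw [Finset.sum_congr rfl fun v _ => this v, ← Finset.mul_sum, h1, mul_one]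
  classical
  have htot : ∑ y, ‖α y‖ ^ 2 = 1 := by
    have h4 := hsum fun _ => 1
    simp only [one_mul] at h4
    rw [← h4]
    exact sum_normSq_answerAmp hU hU0 x
  calc _ ≤ ∑ y : κ ⊕ ω → Bool,
        (if y ∘ Sum.inl ∈ F x then 0 else 1) * ‖answerAmp U x y‖ ^ 2 := by
        refine Finset.sum_le_sum fun y _ => ?_
        split
        · next hy => rw [if_neg (hbad y hy), one_mul]
        · split <;> simp
    _ = ∑ y, (if y ∈ F x then 0 else 1) * ‖α y‖ ^ 2 := hsum fun y => if y ∈ F x then 0 else 1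
    _ = ∑ y, ‖α y‖ ^ 2 - ∑ y, (F x).indicator (fun y => ‖α y‖ ^ 2) y := by
        rw [← Finset.sum_sub_distrib]
        refine Finset.sum_congr rfl fun y _ => ?_
        by_cases hy : y ∈ F x <;> simp [hy]
    _ ≤ ε := by rw [htot]; linarith

end Queries

/-! ### The error of the phase oracle -/

theorem norm_exp_sub_exp_le (a b : ℝ) :
    ‖Complex.exp (a * Complex.I) - Complex.exp (b * Complex.I)‖ ≤ |a - b| := by
  have h : Complex.exp (a * Complex.I) - Complex.exp (b * Complex.I) =
      Complex.exp (b * Complex.I) * (Complex.exp (Complex.I * (a - b : ℝ)) - 1) := by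
    rw [mul_sub, ← Complex.exp_add, mul_one]
    congr 2
    push_cast
    ring
  rw [h, norm_mul, Complex.norm_exp_ofReal_mul_I, one_mul]
  exact Real.norm_exp_I_mul_ofReal_sub_one_le

theorem norm_exp_sub_exp_le_two (a b : ℝ) :
    ‖Complex.exp (a * Complex.I) - Complex.exp (b * Complex.I)‖ ≤ 2 := by
  refine (norm_sub_le _ _).trans ?_
  rw [Complex.norm_exp_ofReal_mul_I, Complex.norm_exp_ofReal_mul_I]
  norm_num

/-- With `127` queries, the majority of the answers is invalid with probability at most `1/1000`. -/
theorem majority_bad_const_le : (4 / 3 / Real.sqrt 2) ^ (2 ^ (6 + 1) - 1) ≤ (1 / 1000 : ℝ) := by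
  have hs : 0 < Real.sqrt 2 := by positivity
  have h2 : (4 / 3 / Real.sqrt 2) ^ 2 = 8 / 9 := by
    rw [div_pow, Real.sq_sqrt (by norm_num)]
    norm_num
  have h1 : 4 / 3 / Real.sqrt 2 ≤ 1 := by
    rw [div_le_one hs]
    apply Real.le_sqrt_of_sq_le
    norm_num
  rw [show 2 ^ (6 + 1) - 1 = 2 * 63 + 1 by norm_num, pow_succ, pow_mul, h2]
  calc _ ≤ ((8 : ℝ) / 9) ^ 63 * 1 := mul_le_mul_of_nonneg_left h1 (by positivity)
    _ ≤ 1 / 1000 := by norm_num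

open RegWire in
/-- If the phase `Θ` agrees with `Λ x` up to `1/28` for nearly all queries `x` whenever the majority
of the `127` answers is valid, then the resulting states are close. -/
theorem sum_normSq_phase_sub_le {ι Y : Type} [Fintype ι] [DecidableEq ι] [Fintype Y]
    [DecidableEq Y] {R k : ℕ} (hR : R + 1 = 2 ^ (6 + 1))
    (A : (ι → Bool) → (Y → Bool) → ℂ) (hA : ∀ x, ∑ y, ‖A x y‖ ^ 2 = 1)
    (bad : (ι → Bool) → (Y → Bool) → Prop) [∀ x, DecidablePred (bad x)]
    (hbad : ∀ x, ∑ y, (if bad x y then ‖A x y‖ ^ 2 else 0) ≤ 1 / 3)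
    (c : ℂ) (hc : ‖c‖ ^ 2 * Fintype.card (ι → Bool) = 1) (good : Finset (ι → Bool))
    (hgood : 999 / 1000 * (Fintype.card (ι → Bool) : ℝ) ≤ good.card)
    (Θ : (RegWire ι Y R k → Bool) → ℝ) (Λ : (ι → Bool) → ℝ)
    (h : ∀ x ∈ good, ∀ S, 2 * (Finset.univ.filter fun r => bad x (S r)).card < R →
      |Θ (split.symm (x, S, fun _ => false)) - Λ x| ≤ 1 / 28) :
    ∑ s : RegWire ι Y R k → Bool,
      ‖Complex.exp (Θ s * Complex.I) *
          (c * (∏ r, A (split s).1 ((split s).2.1 r)) * zeroAmp (split s).2.2) -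
        Complex.exp (Λ (split s).1 * Complex.I) *
          (c * (∏ r, A (split s).1 ((split s).2.1 r)) * zeroAmp (split s).2.2)‖ ^ 2 ≤
      93 / 10000 := by
  obtain rfl : R = 2 ^ (6 + 1) - 1 := by omega
  let D : (ι → Bool) → (Fin (2 ^ (6 + 1) - 1) → Y → Bool) → ℝ := fun x S =>
    ‖Complex.exp (Θ (split.symm (x, S, fun _ => false)) * Complex.I) -
      Complex.exp (Λ x * Complex.I)‖ ^ 2
  let P : (ι → Bool) → (Fin (2 ^ (6 + 1) - 1) → Y → Bool) → ℝ := fun x S =>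
    ∏ r, ‖A x (S r)‖ ^ 2
  have hP0 : ∀ x S, 0 ≤ P x S := fun x S => Finset.prod_nonneg fun r _ => by positivity
  have hP1 : ∀ x, ∑ S, P x S = 1 := by
    intro x
    rw [← Fintype.sum_pow (fun y => ‖A x y‖ ^ 2), hA, one_pow]
  have hD4 : ∀ x S, D x S ≤ 4 := by
    intro x S
    have := norm_exp_sub_exp_le_two (Θ (split.symm (x, S, fun _ => false))) (Λ x)
    calc D x S ≤ 2 ^ 2 := pow_le_pow_left₀ (norm_nonneg _) this 2
      _ = 4 := by norm_num
  have hrewrite : ∑ s : RegWire ι Y (2 ^ (6 + 1) - 1) k → Bool,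
      ‖Complex.exp (Θ s * Complex.I) *
          (c * (∏ r, A (split s).1 ((split s).2.1 r)) * zeroAmp (split s).2.2) -
        Complex.exp (Λ (split s).1 * Complex.I) *
          (c * (∏ r, A (split s).1 ((split s).2.1 r)) * zeroAmp (split s).2.2)‖ ^ 2 =
      ‖c‖ ^ 2 * ∑ x, ∑ S, P x S * D x S := by
    rw [← Equiv.sum_comp split.symm, Fintype.sum_prod_type, Finset.mul_sum]
    refine Finset.sum_congr rfl fun x _ => ?_
    rw [Fintype.sum_prod_type, Finset.mul_sum]
    refine Finset.sum_congr rfl fun S _ => ?_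
    simp only [Equiv.apply_symm_apply]
    rw [← sum_mul_normSq_zeroAmp (fun z => ‖c‖ ^ 2 * (P x S *
      ‖Complex.exp (Θ (split.symm (x, S, z)) * Complex.I) -
        Complex.exp (Λ x * Complex.I)‖ ^ 2))]
    refine Finset.sum_congr rfl fun z _ => ?_
    rw [← sub_mul, norm_mul, norm_mul, norm_mul, norm_prod, mul_pow, mul_pow, mul_pow,
      ← Finset.prod_pow]
    ring
  have hx : ∀ x ∈ good, ∑ S, P x S * D x S ≤ 1 / 784 + 4 / 1000 := by
    intro x hx
    have h1 := sum_prod_majority_bad_le (fun y => ‖A x y‖ ^ 2) (fun y => by positivity) (hA x)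
      (bad x) (hbad x) (2 ^ (6 + 1) - 1)
    have h2 := h1.trans majority_bad_const_le
    calc ∑ S, P x S * D x S ≤ ∑ S, (P x S * (1 / 784) +
          4 * (if 2 ^ (6 + 1) - 1 ≤ 2 * (Finset.univ.filter fun r => bad x (S r)).card then
            ∏ r, ‖A x (S r)‖ ^ 2 else 0)) := by
          refine Finset.sum_le_sum fun S _ => ?_
          have h3 := hP0 x S
          by_cases hS : 2 ^ (6 + 1) - 1 ≤ 2 * (Finset.univ.filter fun r => bad x (S r)).card
          · rw [if_pos hS]
            have := mul_le_mul_of_nonneg_left (hD4 x S) h3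
            change P x S * D x S ≤ P x S * (1 / 784) + 4 * P x S
            linarith
          · rw [if_neg hS]
            have h4 := h x hx S (not_le.1 hS)
            have h5 := (norm_exp_sub_exp_le (Θ (split.symm (x, S, fun _ => false))) (Λ x)).trans h4
            have h6 : D x S ≤ (1 / 28) ^ 2 := pow_le_pow_left₀ (norm_nonneg _) h5 2
            have := mul_le_mul_of_nonneg_left h6 h3
            linarith
      _ ≤ 1 / 784 + 4 / 1000 := by
          rw [Finset.sum_add_distrib, ← Finset.sum_mul, ← Finset.mul_sum, hP1]
          linarith
  have hx' : ∀ x, ∑ S, P x S * D x S ≤ 4 := by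
    intro x
    calc ∑ S, P x S * D x S ≤ ∑ S, P x S * 4 :=
          Finset.sum_le_sum fun S _ => mul_le_mul_of_nonneg_left (hD4 x S) (hP0 x S)
      _ = 4 := by rw [← Finset.sum_mul, hP1, one_mul]
  rw [hrewrite]
  have hsum : ∑ x, ∑ S, P x S * D x S ≤
      Fintype.card (ι → Bool) * (1 / 784 + 4 / 1000) + (1 / 1000 * Fintype.card (ι → Bool)) * 4 := by
    rw [← Finset.sum_add_sum_compl good]
    refine add_le_add ?_ ?_
    · refine (Finset.sum_le_sum hx).trans ?_
      rw [Finset.sum_const, nsmul_eq_mul]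
      refine mul_le_mul_of_nonneg_right ?_ (by norm_num)
      exact_mod_cast Finset.card_le_univ good
    · refine (Finset.sum_le_sum fun x _ => hx' x).trans ?_
      rw [Finset.sum_const, nsmul_eq_mul]
      refine mul_le_mul_of_nonneg_right ?_ (by norm_num)
      have h1 : ((goodᶜ.card : ℕ) : ℝ) = Fintype.card (ι → Bool) - good.card := by
        rw [Finset.card_compl, Nat.cast_sub (Finset.card_le_univ good)]
      rw [h1]
      linarith
  have h0 : 0 ≤ ‖c‖ ^ 2 := by positivity
  calc _ ≤ ‖c‖ ^ 2 * (Fintype.card (ι → Bool) * (1 / 784 + 4 / 1000) +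
        (1 / 1000 * Fintype.card (ι → Bool)) * 4) := mul_le_mul_of_nonneg_left hsum h0
    _ = (‖c‖ ^ 2 * Fintype.card (ι → Bool)) * (1 / 784 + 8 / 1000) := by ring
    _ ≤ 93 / 10000 := by rw [hc]; norm_num

/-! ### A single run -/

open RegWire

section SingleRun

variable {n m R k : ℕ} {Y : Type}

/-- The query register of coordinate `i`, with the leading bit first. -/
def fourierWires (Y : Type) (R k : ℕ) (i : Fin n) : Fin m ↪ RegWire (Fin n × Fin m) Y R k :=
  ⟨fun l => .inl (i, l.rev), fun l l' h => by simpa using h⟩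

/-- The query register as `n` registers with leading bits first. -/
def coordEquiv (n m : ℕ) : (Fin n × Fin m → Bool) ≃ (Fin n → Fin m → Bool) where
  toFun x i l := x (i, l.rev)
  invFun X p := X p.1 p.2.rev
  left_inv x := by funext p; simp
  right_inv X := by funext i l; simp

variable (Y) in
/-- The circuit of a single run: a uniform superposition of queries, `R` oracle calls, a phase
computed from the answers, the adjoint calls, and a Fourier transform of each coordinate. -/
def runCircuit (d : ℕ) (γ : ℕ → ℝ)
    (P : List (WireOp (Fin n × Fin m ⊕ Y) (RegWire (Fin n × Fin m) Y R k))) :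
    List (WireOp (Fin n × Fin m ⊕ Y) (RegWire (Fin n × Fin m) Y R k)) :=
  ((Finset.univ : Finset (Fin n × Fin m)).toList.map Sum.inl).map WireOp.had ++
  (((List.finRange R).map (queryWires k)).map WireOp.query ++ (P ++
  (((List.finRange R).map (queryWires k)).reverse.map WireOp.queryAdjoint ++
  (List.finRange n).flatMap fun i =>
    (WireOp.fourierCircuit m d γ).map (WireOp.map (fourierWires Y R k i)))))

theorem length_runCircuit (d : ℕ) (γ : ℕ → ℝ)
    (P : List (WireOp (Fin n × Fin m ⊕ Y) (RegWire (Fin n × Fin m) Y R k))) :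
    (runCircuit Y d γ P).length = n * m + 2 * R + P.length + n * (m * (d + 2)) := by
  simp only [runCircuit, List.length_append, List.length_map, Finset.length_toList,
    Finset.card_univ, Fintype.card_prod, Fintype.card_fin, List.length_finRange,
    List.length_reverse, List.length_flatMap, WireOp.length_fourierCircuit, List.map_const',
    List.sum_replicate, smul_eq_mul]
  ring

theorem countP_runCircuit (d : ℕ) (γ : ℕ → ℝ)
    (P : List (WireOp (Fin n × Fin m ⊕ Y) (RegWire (Fin n × Fin m) Y R k)))
    (hP : ∀ op ∈ P, op.isQuery = false) :
    (runCircuit Y d γ P).countP WireOp.isQuery = 2 * R := by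
  have hzero : ∀ L : List (WireOp (Fin n × Fin m ⊕ Y) (RegWire (Fin n × Fin m) Y R k)),
      (∀ op ∈ L, op.isQuery = false) → L.countP WireOp.isQuery = 0 := by
    intro L hL
    rw [List.countP_eq_zero]
    intro op hop
    simp [hL op hop]
  have hall : ∀ L : List (WireOp (Fin n × Fin m ⊕ Y) (RegWire (Fin n × Fin m) Y R k)),
      (∀ op ∈ L, op.isQuery = true) → L.countP WireOp.isQuery = L.length := by
    intro L hL
    rw [List.countP_eq_length]
    exact hL
  rw [runCircuit, List.countP_append, List.countP_append, List.countP_append, List.countP_append,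
    hzero _, hall _, hzero _ hP, hall _, hzero _]
  · simp
    ring
  · intro op hop
    obtain ⟨i, _, hop⟩ := List.mem_flatMap.1 hop
    obtain ⟨op', hop', rfl⟩ := List.mem_map.1 hop
    rw [WireOp.isQuery_map]
    exact WireOp.isQuery_fourierCircuit m d γ op' hop'
  · intro op hop
    obtain ⟨e, _, rfl⟩ := List.mem_map.1 hop
    rfl
  · intro op hop
    obtain ⟨e, _, rfl⟩ := List.mem_map.1 hop
    rfl
  · intro op hop
    obtain ⟨e, _, rfl⟩ := List.mem_map.1 hop
    rfl

variable [Fintype Y] [DecidableEq Y]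

/-- The outcome of one coordinate register of a product state is distributed according to the factor
of this register. -/
theorem sum_normSq_coord (amp : Fin n → (Fin m → Bool) → ℂ) (hamp : ∀ i, ∑ z, ‖amp i z‖ ^ 2 = 1)
    (u : ℂ) (hu : ‖u‖ = 1) (i₀ : Fin n) (bad : (Fin m → Bool) → Prop) [DecidablePred bad] :
    ∑ s : RegWire (Fin n × Fin m) Y R k → Bool, (if bad (fun l => s (.inl (i₀, l.rev))) then
      ‖(∏ i, amp i (s ∘ fourierWires Y R k i)) *
        (u * (∏ r, zeroAmp ((split s).2.1 r)) * zeroAmp (split s).2.2)‖ ^ 2 else 0) =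
    ∑ z, if bad z then ‖amp i₀ z‖ ^ 2 else 0 := by
  let p : Fin n → (Fin m → Bool) → ℝ := fun i z =>
    if i = i₀ then (if bad z then ‖amp i z‖ ^ 2 else 0) else ‖amp i z‖ ^ 2
  have hzero : ∑ S : Fin R → Y → Bool, ∏ r, ‖zeroAmp (S r)‖ ^ 2 = 1 := by
    rw [← Fintype.sum_pow (fun y : Y → Bool => ‖zeroAmp y‖ ^ 2)]
    have := sum_mul_normSq_zeroAmp (α := Y) fun _ => 1
    simp only [one_mul] at this
    rw [this, one_pow]
  have hp : ∀ x : Fin n × Fin m → Bool, (if bad (coordEquiv n m x i₀) then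
      ∏ i, ‖amp i (coordEquiv n m x i)‖ ^ 2 else 0) = ∏ i, p i (coordEquiv n m x i) := by
    intro x
    rw [← Finset.mul_prod_erase Finset.univ (fun i => p i (coordEquiv n m x i)) (Finset.mem_univ i₀),
      ← Finset.mul_prod_erase Finset.univ (fun i => ‖amp i (coordEquiv n m x i)‖ ^ 2)
        (Finset.mem_univ i₀)]
    have h1 : ∏ i ∈ Finset.univ.erase i₀, p i (coordEquiv n m x i) =
        ∏ i ∈ Finset.univ.erase i₀, ‖amp i (coordEquiv n m x i)‖ ^ 2 :=
      Finset.prod_congr rfl fun i hi => if_neg (Finset.ne_of_mem_erase hi)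
    rw [h1]
    simp only [p, if_true]
    split <;> simp
  calc _ = ∑ x : Fin n × Fin m → Bool, ∑ S : Fin R → Y → Bool, ∑ z : Fin k → Bool,
        (∏ i, p i (coordEquiv n m x i)) * (∏ r, ‖zeroAmp (S r)‖ ^ 2) * ‖zeroAmp z‖ ^ 2 := by
        rw [← Equiv.sum_comp split.symm, Fintype.sum_prod_type]
        refine Finset.sum_congr rfl fun x _ => ?_
        rw [Fintype.sum_prod_type]
        refine Finset.sum_congr rfl fun S _ => Finset.sum_congr rfl fun z _ => ?_
        rw [← hp]
        have hc : ∀ i, (split.symm (x, S, z)) ∘ fourierWires Y R k i = coordEquiv n m x i :=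
          fun i => rfl
        have hc' : (fun l : Fin m => (split.symm (x, S, z) : RegWire (Fin n × Fin m) Y R k → Bool)
            (.inl (i₀, l.rev))) = coordEquiv n m x i₀ := rfl
        simp only [hc, hc', Equiv.apply_symm_apply]
        split
        · rw [norm_mul, norm_mul, norm_mul, hu, norm_prod, norm_prod, mul_pow, mul_pow, mul_pow,
            ← Finset.prod_pow, ← Finset.prod_pow]
          ring
        · simp
    _ = ∑ x : Fin n × Fin m → Bool, ∏ i, p i (coordEquiv n m x i) := by
        refine Finset.sum_congr rfl fun x _ => ?_
        have h1 : ∀ S : Fin R → Y → Bool, ∑ z : Fin k → Bool,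
            (∏ i, p i (coordEquiv n m x i)) * (∏ r, ‖zeroAmp (S r)‖ ^ 2) * ‖zeroAmp z‖ ^ 2 =
            (∏ i, p i (coordEquiv n m x i)) * (∏ r, ‖zeroAmp (S r)‖ ^ 2) := fun S =>
          sum_mul_normSq_zeroAmp fun _ => _
        rw [Finset.sum_congr rfl fun S _ => h1 S, ← Finset.mul_sum, hzero, mul_one]
    _ = ∏ i, ∑ z, p i z := by
        rw [Equiv.sum_comp (coordEquiv n m) fun X => ∏ i, p i (X i), Finset.prod_univ_sum,
          Fintype.piFinset_univ]
    _ = _ := by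
        rw [← Finset.mul_prod_erase Finset.univ _ (Finset.mem_univ i₀), Finset.prod_eq_one]
        · simp [p]
        · intro i hi
          simp only [p, if_neg (Finset.ne_of_mem_erase hi), hamp]

theorem sum_normSq_fourierFactor (d : ℕ) (β γ : ℕ → ℝ) :
    ∑ z : Fin m → Bool, ‖∏ l : Fin m, WireOp.fourierFactor d β γ l (extendBits z)‖ ^ 2 = 1 := by
  simp only [WireOp.normSq_prod_fourierFactor]
  exact (isBitChain_fourierProb d _).sum_prod m

/-- The weights are chosen such that probability `21/100` in the ideal state `y` and squared distance
`93/10000` give probability at most `1/3` in the actual state `x`. -/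
theorem normSq_le_of_sub (x y : ℂ) : ‖x‖ ^ 2 ≤ 6 / 5 * ‖y‖ ^ 2 + 6 * ‖x - y‖ ^ 2 := by
  have h : ‖x‖ ≤ ‖y‖ + ‖x - y‖ := by
    have := norm_add_le y (x - y)
    rwa [add_sub_cancel] at this
  have h1 := pow_le_pow_left₀ (norm_nonneg x) h 2
  nlinarith [sq_nonneg (‖y‖ - 5 * ‖x - y‖)]

end SingleRun

/-- The phase that makes the Fourier transform read `φ` on every coordinate, for `|φ i|` smaller than
half the number of grid points. -/
def linearPhase {n m : ℕ} (φ : Fin n → ℝ) (x : Fin n × Fin m → Bool) : ℝ :=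
  ∑ i, ∑ l : Fin m, if x (i, l.rev) then 2 * Real.pi * φ i / 2 ^ ((l : ℕ) + 1) else 0

/-- A linear phase is a product over the coordinates, so that the Fourier transforms act on the
factors of a product state. -/
theorem run_fourier_linearPhase {n m d R k : ℕ} {Y : Type} [Fintype Y] [DecidableEq Y]
    (U : Matrix (Fin n × Fin m ⊕ Y → Bool) (Fin n × Fin m ⊕ Y → Bool) ℂ) (γ : ℕ → ℝ)
    (φ : Fin n → ℝ) (μ : ℝ) :
    WireOp.run U ((List.finRange n).flatMap fun i =>
        (WireOp.fourierCircuit m d γ).map (WireOp.map (fourierWires Y R k i)))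
      (fun s => Complex.exp ((μ + linearPhase φ (split s).1 : ℝ) * Complex.I) *
        (∏ _p : Fin n × Fin m, ((Real.sqrt 2 : ℂ))⁻¹) * (∏ r, zeroAmp ((split s).2.1 r)) *
          zeroAmp (split s).2.2) =
    fun s => (∏ i, ∏ l : Fin m, WireOp.fourierFactor d
        (fun l => 2 * Real.pi * φ i / 2 ^ (l + 1)) γ l (extendBits (s ∘ fourierWires Y R k i))) *
      (Complex.exp (μ * Complex.I) * (∏ r, zeroAmp ((split s).2.1 r)) * zeroAmp (split s).2.2) := by
  let χ : Fin n → (Fin m → Bool) → ℂ := fun i z => ∏ l : Fin m,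
    Complex.exp ((if z l then 2 * Real.pi * φ i / 2 ^ ((l : ℕ) + 1) else 0 : ℝ) * Complex.I) /
      (Real.sqrt 2 : ℂ)
  let ψ : (RegWire (Fin n × Fin m) Y R k → Bool) → ℂ := fun s =>
    Complex.exp (μ * Complex.I) * (∏ r, zeroAmp ((split s).2.1 r)) * zeroAmp (split s).2.2
  have h1 : (fun s : RegWire (Fin n × Fin m) Y R k → Bool =>
      Complex.exp ((μ + linearPhase φ (split s).1 : ℝ) * Complex.I) *
        (∏ _p : Fin n × Fin m, ((Real.sqrt 2 : ℂ))⁻¹) * (∏ r, zeroAmp ((split s).2.1 r)) *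
          zeroAmp (split s).2.2) =
      fun s => (∏ i, χ i (s ∘ fourierWires Y R k i)) * ψ s := by
    funext s
    have h2 : ∏ i, χ i (s ∘ fourierWires Y R k i) =
        Complex.exp ((linearPhase φ (split s).1 : ℝ) * Complex.I) *
          ∏ _p : Fin n × Fin m, ((Real.sqrt 2 : ℂ))⁻¹ := by
      simp only [χ, linearPhase, div_eq_mul_inv, Finset.prod_mul_distrib, Complex.ofReal_sum,
        Finset.sum_mul, Complex.exp_sum, Fintype.prod_prod_type]
      rfl
    rw [h2, Complex.ofReal_add, add_mul, Complex.exp_add]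
    ring
  have h3 : ∀ i, IndepOf (fourierWires Y R k i) ψ := by
    intro i s s' h
    have h4 : (split s).2 = (split s').2 := by
      refine Prod.ext ?_ ?_
      · funext r y
        apply h
        rintro ⟨l, hl⟩
        cases hl
      · funext j
        apply h
        rintro ⟨l, hl⟩
        cases hl
    simp only [ψ, h4]
  rw [h1, WireOp.run_flatMap_map U (fourierWires Y R k) _ (WireOp.fourierCircuit m d γ)
    (List.finRange n) (List.nodup_finRange n) χ ψ h3]
  · funext s
    simp only [List.mem_finRange, if_true]
    congr 1
    refine Finset.prod_congr rfl fun i _ => ?_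
    exact congrFun (WireOp.run_fourierCircuit U m d
      (fun l => 2 * Real.pi * φ i / 2 ^ (l + 1)) γ) _
  · intro i i' l l' h
    have : ((Sum.inl (i, l.rev)) : RegWire (Fin n × Fin m) Y R k) = Sum.inl (i', l'.rev) := h
    simp only [Sum.inl.injEq, Prod.mk.injEq] at this
    exact this.1

theorem run_hadamards_regWire {n m R k : ℕ} {Y : Type} [Fintype Y] [DecidableEq Y]
    (U : Matrix (Fin n × Fin m ⊕ Y → Bool) (Fin n × Fin m ⊕ Y → Bool) ℂ) :
    WireOp.run U (((Finset.univ : Finset (Fin n × Fin m)).toList.map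
        (Sum.inl : _ → RegWire (Fin n × Fin m) Y R k)).map WireOp.had)
      (Pi.single (fun _ => false) 1) =
    fun s => (∏ _p : Fin n × Fin m, ((Real.sqrt 2 : ℂ))⁻¹) * (∏ r, zeroAmp ((split s).2.1 r)) *
      zeroAmp (split s).2.2 := by
  rw [WireOp.run_hadamards U _ ((Finset.nodup_toList _).map Sum.inl_injective)]
  funext s
  rw [Fintype.prod_sum_type, Fintype.prod_sum_type, mul_assoc]
  congr 1
  · simp
  · congr 1
    · rw [Fintype.prod_prod_type]
      simp only [zeroAmp, List.mem_map, reduceCtorEq, and_false, exists_false, if_false]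
      rfl
    · simp only [zeroAmp, List.mem_map, reduceCtorEq, and_false, exists_false, if_false]
      rfl

theorem ordConnected_abs_sub_le (v a₀ a δ : ℝ) :
    {k : ℕ | |v - (a₀ + a * k)| ≤ δ}.OrdConnected := by
  constructor
  intro k₁ h₁ k₂ h₂ k ⟨hk₁, hk₂⟩
  simp only [Set.mem_ofPred_eq, abs_le] at h₁ h₂ ⊢
  have c₁ : (k₁ : ℝ) ≤ k := by exact_mod_cast hk₁
  have c₂ : (k : ℝ) ≤ k₂ := by exact_mod_cast hk₂
  rcases le_total 0 a with ha | ha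
  · have e₁ := mul_le_mul_of_nonneg_left c₁ ha
    have e₂ := mul_le_mul_of_nonneg_left c₂ ha
    constructor <;> linarith
  · have e₁ := mul_le_mul_of_nonpos_left c₁ ha
    have e₂ := mul_le_mul_of_nonpos_left c₂ ha
    constructor <;> linarith

/-- A circuit that reads each coordinate of `φ`, up to `3`, with probability `2/3`, if the phase
`2 * π * σ * F x` is, for nearly all queries `x`, close to the linear phase with slope `φ`. -/
theorem exists_run (n m b w d R K : ℕ) (hR : R + 1 = 2 ^ (6 + 1))
    (hK : K = 1 * medianCost 6 b) (hm : 4 ≤ m) (hd : 700 * m ≤ 2 ^ d) (a₀ a σ δ : ℝ) (hσ : 0 ≤ σ)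
    (hσδ : 2 * Real.pi * σ * δ ≤ 1 / 56) :
    ∃ C : List (WireOp (Fin n × Fin m ⊕ Fin b ⊕ Fin w) (RegWire (Fin n × Fin m) (Fin b ⊕ Fin w)
        R K)),
      C.countP WireOp.isQuery = 2 * R ∧
      C.length ≤ n * m + 2 * R + (22 * (4 * K) + b) + n * (m * (d + 2)) ∧
      ∀ U (F : (Fin n × Fin m → Bool) → ℝ) (φ : Fin n → ℝ) (μ : ℝ),
        IsUnitaryApproximator a₀ a δ F U → (∀ i, |φ i| ≤ 2 ^ m / 4) →
        999 / 1000 * (Fintype.card (Fin n × Fin m → Bool) : ℝ) ≤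
          ({x | |2 * Real.pi * σ * F x - (μ + linearPhase φ x)| ≤ 1 / 56} : Finset _).card →
        ∀ i, ∑ s, (if 3 < |φ i + 2 ^ m / 2 - bitsToNat fun l : Fin m => s (.inl (i, l.rev))| then
          ‖WireOp.run U C (Pi.single (fun _ => false) 1) s‖ ^ 2 else 0) ≤ 1 / 3 := by
  obtain ⟨L, v, hL, -, hLv⟩ := exists_median_flips
    (κ := RegWire (Fin n × Fin m) (Fin b ⊕ Fin w) R K) 1 6 b R K hR hK
    (fun j => .inr (.inr j)) (fun j j' h => by simpa using h)
    (fun _ r l => .inr (.inl (r, .inl l))) (fun _ _ _ _ h => by cases h)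
    Set.univ (fun _ => trivial) (fun _ _ _ => trivial)
  let θ : Fin b → ℝ := fun l => 2 * Real.pi * σ * a * 2 ^ (l : ℕ)
  -- The constant part of the phase shifts the range of the readings to `[2^m / 4, 3 * 2^m / 4]`.
  let γ : ℕ → ℝ := fun l => 2 * Real.pi * (2 ^ m / 2) / 2 ^ (l + 1)
  let P : List (WireOp (Fin n × Fin m ⊕ Fin b ⊕ Fin w) _) := WireOp.computedPhase L (v 0) θ
  refine ⟨runCircuit _ d γ P, ?_, ?_, ?_⟩
  · rw [countP_runCircuit d γ P (WireOp.isQuery_computedPhase L (v 0) θ)]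
  · rw [length_runCircuit]
    have h1 : P.length ≤ 22 * L.length + b := WireOp.length_computedPhase_le L (v 0) θ
    omega
  intro U F φ μ hU hφ hgood i₀
  have hU' : U ∈ Matrix.unitaryGroup (Fin n × Fin m ⊕ Fin b ⊕ Fin w → Bool) ℂ := hU.1
  obtain ⟨hU0, hUbad⟩ := sum_normSq_bad_answerAmp hU
  let c : ℂ := ∏ _p : Fin n × Fin m, ((Real.sqrt 2 : ℂ))⁻¹
  let Θ : (RegWire (Fin n × Fin m) (Fin b ⊕ Fin w) R K → Bool) →
    ℝ := fun s => ∑ l, if Flip.fwd L s (v 0 l) then θ l else 0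
  let Λ : (Fin n × Fin m → Bool) → ℝ := fun x => μ - 2 * Real.pi * σ * a₀ + linearPhase φ x
  have hΘ : ∀ s, Θ s = 2 * Real.pi * σ * a * bitsToNat fun l => Flip.fwd L s (v 0 l) := by
    intro s
    simp only [Θ, θ, bitsToNat, Nat.cast_sum, Finset.mul_sum]
    refine Finset.sum_congr rfl fun l _ => ?_
    split <;> simp
  let Ψ : (RegWire (Fin n × Fin m) (Fin b ⊕ Fin w) R K → Bool) →
    ℂ := fun s => c * (∏ r, answerAmp U (split s).1 ((split s).2.1 r)) * zeroAmp (split s).2.2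
  let W : List (WireOp (Fin n × Fin m ⊕ Fin b ⊕ Fin w) (RegWire (Fin n × Fin m) (Fin b ⊕ Fin w)
      R K)) :=
    ((List.finRange R).map (queryWires K)).reverse.map
      WireOp.queryAdjoint ++ (List.finRange n).flatMap fun i =>
        (WireOp.fourierCircuit m d γ).map (WireOp.map (fourierWires _ _ _ i))
  have hrun : WireOp.run U (runCircuit _ d γ P) (Pi.single (fun _ => false) 1) =
      WireOp.run U W (fun s => Complex.exp (Θ s * Complex.I) * Ψ s) := by
    rw [runCircuit, WireOp.run_append, WireOp.run_append, WireOp.run_append,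
      run_hadamards_regWire]
    congr 1
    rw [List.map_map]
    have h2 := run_queries (R := R) (k := K) hU0 fun _ => c
    have h3 : WireOp.run U P Ψ = fun s => Complex.exp (Θ s * Complex.I) * Ψ s :=
      WireOp.run_computedPhase U L (v 0) θ Ψ
    rw [← h3]
    congr 1
  have hideal : WireOp.run U W (fun s => Complex.exp (Λ (split s).1 * Complex.I) * Ψ s) =
      fun s => (∏ i, ∏ l : Fin m, WireOp.fourierFactor d
        (fun l => 2 * Real.pi * φ i / 2 ^ (l + 1)) γ l
          (extendBits (s ∘ fourierWires _ _ _ i))) *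
      (Complex.exp ((μ - 2 * Real.pi * σ * a₀ : ℝ) * Complex.I) *
        (∏ r, zeroAmp ((split s).2.1 r)) * zeroAmp (split s).2.2) := by
    have h1 := run_queries (R := R) (k := K) hU0 fun x =>
      Complex.exp (Λ x * Complex.I) * c
    have h2 : (fun s => Complex.exp (Λ (split s).1 * Complex.I) * Ψ s) =
        WireOp.run U (((List.finRange R).map
          (queryWires K)).map WireOp.query)
          (fun s => Complex.exp (Λ (split s).1 * Complex.I) * c * (∏ r, zeroAmp ((split s).2.1 r)) *
            zeroAmp (split s).2.2) := by
      rw [List.map_map]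
      refine Eq.trans ?_ h1.symm
      funext s
      simp only [Ψ]
      ring
    rw [WireOp.run_append, h2, WireOp.run_unquery hU']
    exact run_fourier_linearPhase U γ φ (μ - 2 * Real.pi * σ * a₀)
  let bad : (Fin n × Fin m → Bool) → (Fin b ⊕ Fin w → Bool) → Prop := fun x y =>
    δ < |F x - fixedPoint a₀ a (y ∘ Sum.inl)|
  have herr : ∑ s, ‖WireOp.run U (runCircuit _ d γ P) (Pi.single (fun _ => false) 1) s -
      WireOp.run U W (fun s => Complex.exp (Λ (split s).1 * Complex.I) * Ψ s) s‖ ^ 2 ≤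
        93 / 10000 := by
    classical
    have h1 := WireOp.sum_normSq_run hU' W ((fun s => Complex.exp (Θ s * Complex.I) * Ψ s) -
      fun s => Complex.exp (Λ (split s).1 * Complex.I) * Ψ s)
    rw [WireOp.run_sub] at h1
    rw [hrun]
    refine h1.le.trans ?_
    refine sum_normSq_phase_sub_le hR (answerAmp U) (sum_normSq_answerAmp hU' hU0) bad
      (fun x => hUbad x (bad x) _ fun y hy h => not_le.2 hy h) c ?_ _ hgood Θ Λ ?_
    · have h2 : ‖((Real.sqrt 2 : ℂ))⁻¹‖ ^ 2 = 1 / 2 := by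
        rw [norm_inv, Complex.norm_real, Real.norm_eq_abs, abs_of_nonneg (Real.sqrt_nonneg 2),
          inv_pow, Real.sq_sqrt (by norm_num)]
        norm_num
      simp only [c]
      rw [norm_prod, ← Finset.prod_pow, h2, Finset.prod_const, Finset.card_univ]
      simp
    · intro x hx S hS
      have hx := (Finset.mem_filter.1 hx).2
      obtain ⟨-, h3⟩ := hLv (split.symm (x, S, fun _ => false)) fun _ => rfl
      have h4 := h3 0 {k | |F x - (a₀ + a * k)| ≤ δ} (ordConnected_abs_sub_le _ _ _ _)
        ⟨_, fun r hr => not_lt.1 fun h => hr (Finset.mem_filter.2 ⟨Finset.mem_univ r, h⟩), hS⟩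
      rw [hΘ]
      set k : ℕ := (bitsToNat fun l =>
        Flip.fwd L (split.symm (x, S, fun _ => false)) (v 0 l))
      have h5 : |F x - (a₀ + a * (k : ℝ))| ≤ δ := h4
      have h6 : 2 * Real.pi * σ * a * k - Λ x =
          (2 * Real.pi * σ * F x - (μ + linearPhase φ x)) -
            2 * Real.pi * σ * (F x - (a₀ + a * (k : ℝ))) := by
        simp only [Λ]; ring
      have hσ' : 0 ≤ 2 * Real.pi * σ := by positivity
      rw [h6]
      refine (abs_sub _ _).trans ?_
      rw [abs_mul, abs_of_nonneg hσ']
      have h7 := mul_le_mul_of_nonneg_left h5 hσ'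
      linarith
  have hprob : ∑ s, (if 3 < |φ i₀ + 2 ^ m / 2 - bitsToNat fun l : Fin m => s (.inl (i₀, l.rev))| then
      ‖WireOp.run U W (fun s => Complex.exp (Λ (split s).1 * Complex.I) * Ψ s) s‖ ^ 2 else 0) ≤
        21 / 100 := by
    rw [hideal]
    have h1 := sum_normSq_coord (Y := Fin b ⊕ Fin w) (R := R)
      (k := K) (fun i z => ∏ l : Fin m, WireOp.fourierFactor d
        (fun l => 2 * Real.pi * φ i / 2 ^ (l + 1)) γ l (extendBits z))
      (fun i => sum_normSq_fourierFactor d (fun l => 2 * Real.pi * φ i / 2 ^ (l + 1)) γ)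
      (Complex.exp ((μ - 2 * Real.pi * σ * a₀ : ℝ) * Complex.I))
      (Complex.norm_exp_ofReal_mul_I _) i₀
      (fun z => 3 < |φ i₀ + 2 ^ m / 2 - bitsToNat z|)
    beta_reduce at h1
    rw [h1]
    simp only [WireOp.normSq_prod_fourierFactor]
    have hβ : (fun l : ℕ => 2 * Real.pi * φ i₀ / 2 ^ (l + 1) + γ l) =
        fun l => 2 * Real.pi * (φ i₀ + 2 ^ m / 2) / 2 ^ (l + 1) := by
      funext l
      simp only [γ]
      ring
    rw [hβ]
    obtain ⟨h2, h3⟩ := abs_le.1 (hφ i₀)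
    exact sum_truncated_far_le d m hm hd _ (by linarith) (by linarith)
  calc _ ≤ ∑ s, (6 / 5 * (if 3 < |φ i₀ + 2 ^ m / 2 -
          bitsToNat fun l : Fin m => s (.inl (i₀, l.rev))| then
          ‖WireOp.run U W (fun s => Complex.exp (Λ (split s).1 * Complex.I) * Ψ s) s‖ ^ 2 else 0) +
        6 * ‖WireOp.run U (runCircuit _ d γ P) (Pi.single (fun _ => false) 1) s -
          WireOp.run U W (fun s => Complex.exp (Λ (split s).1 * Complex.I) * Ψ s) s‖ ^ 2) := by
        refine Finset.sum_le_sum fun s _ => ?_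
        split
        · exact normSq_le_of_sub _ _
        · rw [mul_zero, zero_add]; positivity
    _ ≤ 1 / 3 := by
        rw [Finset.sum_add_distrib, ← Finset.mul_sum, ← Finset.mul_sum]
        linarith

/-! ### Independent runs and the final median -/

/-- Copying the contents of the wires `src` onto the wires `tgt`. -/
theorem Flip.fwd_copies {κ I : Type} [DecidableEq κ] (src tgt : I → κ)
    (h : ∀ p p', src p ≠ tgt p') (htgt : Function.Injective tgt) (l : List I) (hl : l.Nodup)
    (s : κ → Bool) :
    (∀ v, (∀ p ∈ l, tgt p ≠ v) →
      Flip.fwd (l.map fun p => Flip.cnot (src p) (tgt p) (h p p)) s v = s v) ∧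
    ∀ p ∈ l, Flip.fwd (l.map fun p => Flip.cnot (src p) (tgt p) (h p p)) s (tgt p) =
      (s (tgt p) ^^ s (src p)) := by
  induction l generalizing s with
  | nil => exact ⟨fun _ _ => rfl, fun p hp => by simp at hp⟩
  | cons p l ih =>
    obtain ⟨h1, h2⟩ := ih (List.nodup_cons.1 hl).2
      (Function.update s (tgt p) (s (tgt p) ^^ s (src p)))
    have h3 : ∀ v, Flip.fwd ((p :: l).map fun p => Flip.cnot (src p) (tgt p) (h p p)) s v =
        Flip.fwd (l.map fun p => Flip.cnot (src p) (tgt p) (h p p))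
          (Function.update s (tgt p) (s (tgt p) ^^ s (src p))) v := fun v => rfl
    constructor
    · intro v hv
      rw [h3, h1 v fun p' hp' => hv p' (by simp [hp']), Function.update_of_ne]
      exact (hv p (by simp)).symm
    · intro p' hp'
      rw [h3]
      rcases List.mem_cons.1 hp' with rfl | hp'
      · rw [h1 _ fun p hp he => (List.nodup_cons.1 hl).1 (by rwa [← htgt he]),
          Function.update_self]
      · rw [h2 p' hp', Function.update_of_ne (h _ _), Function.update_of_ne]
        rintro he
        exact (List.nodup_cons.1 hl).1 (by rwa [← htgt he])

/-- A circuit on an arbitrary finite set of wires as a query algorithm. -/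
theorem exists_queryAlgorithm {Q κ : Type} [Fintype Q] [DecidableEq Q] [Fintype κ] [DecidableEq κ]
    {n prec : ℕ} (L : List (WireOp Q κ)) (out : Fin n × Fin prec ↪ κ) (offset scale : ℝ) :
    ∃ A : QueryAlgorithm Q n, A.queryCount = L.countP WireOp.isQuery ∧ A.gateCount = L.length ∧
      ∀ (U : Matrix (Q → Bool) (Q → Bool) ℂ) (S : Set (Fin n → ℝ)), A.outputProb U S =
        ∑ s, ((fun (s : κ → Bool) i => fixedPoint offset scale fun j => s (out (i, j))) ⁻¹' S).indicator
          (fun s => ‖WireOp.run U L (Pi.single (fun _ => false) 1) s‖ ^ 2) s := by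
  let e := Fintype.equivFin κ
  let A : QueryAlgorithm Q n :=
    { qubits := Fintype.card κ
      ops := (L.map (WireOp.map e.toEmbedding)).map WireOp.toCircuitOp
      prec := prec
      out := out.trans e.toEmbedding
      offset := offset
      scale := scale }
  refine ⟨A, ?_, ?_, fun U S => ?_⟩
  · simp only [QueryAlgorithm.queryCount, A, List.countP_map]
    congr 1
    funext op
    simp
  · simp [QueryAlgorithm.gateCount, A]
  · have hstate : ∀ z, A.finalState U z =
        WireOp.run U L (Pi.single (fun _ => false) 1) (z ∘ e) := by
      intro z
      have h1 : A.finalState U = WireOp.run U (L.map (WireOp.map e.toEmbedding))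
          (Pi.single (fun _ => false) 1) := WireOp.foldl_toCircuitOp U _ _
      have h2 : (Pi.single (fun _ => false) 1 : (Fin (Fintype.card κ) → Bool) → ℂ) =
          fun s => (Pi.single (fun _ => false) 1 : (κ → Bool) → ℂ) (s ∘ e.toEmbedding) * 1 := by
        funext s
        rw [Pi.single_apply, Pi.single_apply, mul_one]
        congr 1
        refine propext ⟨fun h => by subst h; rfl, fun h => ?_⟩
        funext w
        have := congrFun h (e.symm w)
        simpa using this
      rw [h1, h2, WireOp.run_map U e.toEmbedding L _ (fun _ => 1) (fun _ _ _ => rfl)]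
      exact mul_one _
    unfold QueryAlgorithm.outputProb
    rw [← Equiv.sum_comp (Equiv.arrowCongr e (Equiv.refl Bool))]
    refine Finset.sum_congr rfl fun s _ => ?_
    have h3 : ∀ w, (Equiv.arrowCongr e (Equiv.refl Bool) s) (e w) = s w := fun w => by simp
    have h4 : (Equiv.arrowCongr e (Equiv.refl Bool) s) ∘ e = s := funext h3
    have h5 : A.output (Equiv.arrowCongr e (Equiv.refl Bool) s) =
        fun i => fixedPoint offset scale fun j => s (out (i, j)) := by
      funext i
      simp only [QueryAlgorithm.output, A]
      congr 1
      funext j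
      exact h3 _
    have h6 : (Equiv.arrowCongr e (Equiv.refl Bool) s ∈ A.output ⁻¹' S) ↔
        s ∈ (fun (s : κ → Bool) i => fixedPoint offset scale fun j => s (out (i, j))) ⁻¹' S := by
      rw [Set.mem_preimage, Set.mem_preimage, h5]
    classical
    rw [Set.indicator_apply, Set.indicator_apply, hstate, h4]
    simp only [h6]

/-- Repeating a circuit on independent registers and taking the median of the readings of each
coordinate. The failure probability is exponentially small in the number `T = 2 ^ (q + 1) - 1` of
repetitions. -/
theorem exists_medianAlgorithm {Q RW : Type} [Fintype Q] [DecidableEq Q] [Fintype RW]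
    [DecidableEq RW] {n m : ℕ} (q T : ℕ) (hT : T + 1 = 2 ^ (q + 1)) (C : List (WireOp Q RW))
    (reading : Fin n → Fin m → RW) (offset scale : ℝ) :
    ∃ A : QueryAlgorithm Q n, A.queryCount = T * C.countP WireOp.isQuery ∧
      A.gateCount ≤ T * C.length + 11 * (4 * (n * medianCost q m) + n * m) ∧
      ∀ U ∈ Matrix.unitaryGroup (Q → Bool) ℂ, ∀ (G : Fin n → Set ℕ) [∀ i, DecidablePred (· ∈ G i)],
        (∀ i, (G i).OrdConnected) →
        (∀ i, ∑ s, (if bitsToNat (fun l => s (reading i l)) ∉ G i then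
          ‖WireOp.run U C (Pi.single (fun _ => false) 1) s‖ ^ 2 else 0) ≤ 1 / 3) →
        ∀ S : Set (Fin n → ℝ),
          (∀ v ∈ S, ¬ ∀ i, ∃ k ∈ G i, v i = offset + scale * (k : ℕ)) →
          A.outputProb U S ≤ n * (4 / 3 / Real.sqrt 2) ^ T := by
  obtain ⟨N, hN⟩ : ∃ N, N = n * medianCost q m := ⟨_, rfl⟩
  let κ := RegWire (Fin n × Fin m) RW T N
  obtain ⟨L, w, hL, hwW, hLw⟩ := exists_median_flips (κ := κ) n q m T N hT hN
    (fun j => .inr (.inr j)) (fun _ _ h => Sum.inr_injective (Sum.inr_injective h))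
    (fun i t l => .inr (.inl (t, reading i l))) (fun _ _ _ _ h => by cases h)
    {v | ∀ p, v ≠ .inl p} (fun _ _ h => by cases h) (fun _ _ _ _ h => by cases h)
  let run : Fin T → RW ↪ κ := fun t =>
    ⟨fun y => .inr (.inl (t, y)), fun _ _ h => (Prod.mk.inj (Sum.inl_injective (Sum.inr_injective h))).2⟩
  have hsrc : ∀ p p' : Fin n × Fin m, w p.1 p.2 ≠ .inl p' := fun p p' => hwW p.1 p.2 p'
  let copies : List (Flip κ) := (Finset.univ : Finset (Fin n × Fin m)).toList.map fun p =>
    Flip.cnot (w p.1 p.2) (.inl p) (hsrc p p)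
  let D : List (WireOp Q κ) := ((List.finRange T).flatMap fun t => C.map (WireOp.map (run t))) ++
    Flip.circuit (L ++ copies)
  obtain ⟨A, hA₁, hA₂, hA₃⟩ := exists_queryAlgorithm D
    (⟨fun p => .inl p, fun _ _ h => Sum.inl_injective h⟩ : Fin n × Fin m ↪ κ) offset scale
  refine ⟨A, ?_, ?_, ?_⟩
  · have h1 : (Flip.circuit (L ++ copies) : List (WireOp Q κ)).countP WireOp.isQuery = 0 := by
      rw [List.countP_eq_zero]
      intro op hop
      simp [Flip.isQuery_circuit _ op hop]
    have h2 : ∀ t, (WireOp.isQuery ∘ WireOp.map (run t) : WireOp Q RW → Bool) = WireOp.isQuery :=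
      fun t => by funext op; simp
    rw [hA₁, List.countP_append, h1, add_zero, List.countP_flatMap]
    simp [Function.comp_def, List.countP_map]
  · have h1 := Flip.length_circuit_le (Q := Q) (L ++ copies)
    have h2 : copies.length = n * m := by simp [copies]
    rw [List.length_append, h2] at h1
    have h3 : ((List.finRange T).flatMap fun t => C.map (WireOp.map (run t))).length =
        T * C.length := by
      rw [List.length_flatMap]
      simp
    rw [hA₂, List.length_append, h3]
    rw [hN] at hL
    refine Nat.add_le_add_left (h1.trans (Nat.mul_le_mul_left 11 ?_)) _
    omega
  intro U hU G _ hG hprob S hS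
  let Φ := WireOp.run U C (Pi.single (fun _ => false) 1)
  let ψ : (κ → Bool) → ℂ := fun s => zeroAmp (RegWire.split s).1 * zeroAmp (RegWire.split s).2.2
  let p : (RW → Bool) → ℝ := fun s => ‖Φ s‖ ^ 2
  have hp1 : ∑ s, p s = 1 := by
    have h1 := WireOp.sum_normSq_run hU C (Pi.single (fun _ => false) 1)
    simp only [p, Φ]
    rw [h1, Finset.sum_eq_single fun _ => false]
    · simp
    · intro s _ hs
      simp [Pi.single_eq_of_ne hs]
    · simp
  have hruns : WireOp.run U ((List.finRange T).flatMap fun t => C.map (WireOp.map (run t)))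
      (Pi.single (fun _ => false) 1) = fun s => (∏ t, Φ (s ∘ run t)) * ψ s := by
    have h0 : ∀ {α : Type} [Fintype α] [DecidableEq α] (y : α → Bool),
        (Pi.single (fun _ => false) 1 : (α → Bool) → ℂ) y = zeroAmp y := by
      intro α _ _ y
      rw [zeroAmp_eq, Pi.single_apply]
    have h1 : (Pi.single (fun _ => false) 1 : (κ → Bool) → ℂ) = fun s =>
        (∏ t : Fin T, (Pi.single (fun _ => false) 1 : (RW → Bool) → ℂ) (s ∘ run t)) * ψ s := by
      funext s
      simp only [h0, ψ]
      unfold zeroAmp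
      have h1 : (∏ p : Fin T × RW, if s (.inr (.inl p)) = true then (0 : ℂ) else 1) =
          ∏ t, ∏ y, if s (.inr (.inl (t, y))) = true then (0 : ℂ) else 1 :=
        Fintype.prod_prod_type _
      rw [Fintype.prod_sum_type, Fintype.prod_sum_type, h1]
      have h2 : (RegWire.split s).1 = fun i => s (.inl i) := rfl
      have h3 : (RegWire.split s).2.2 = fun j => s (.inr (.inr j)) := rfl
      have h4 : ∀ t y, (s ∘ run t) y = s (.inr (.inl (t, y))) := fun _ _ => rfl
      simp only [h2, h3, h4]
      ring
    have h2 : ∀ t, IndepOf (run t) ψ := by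
      intro t s s' h
      have h3 : (RegWire.split s).1 = (RegWire.split s').1 := by
        funext i
        apply h
        rintro ⟨y, hy⟩
        cases hy
      have h4 : (RegWire.split s).2.2 = (RegWire.split s').2.2 := by
        funext i
        apply h
        rintro ⟨y, hy⟩
        cases hy
      simp only [ψ, h3, h4]
    rw [h1, WireOp.run_flatMap_map U run _ C (List.finRange T) (List.nodup_finRange T) _ ψ h2]
    · simp only [List.mem_finRange, if_true]
      rfl
    · intro t t' y y' h
      have : (Sum.inr (Sum.inl (t, y)) : κ) = Sum.inr (Sum.inl (t', y')) := h
      simp only [Sum.inr.injEq, Sum.inl.injEq, Prod.mk.injEq] at this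
      exact this.1
  -- The output, if the output register and the ancillas are initially clean.
  have hout : ∀ s : κ → Bool, (RegWire.split s).1 = (fun _ => false) →
      (RegWire.split s).2.2 = (fun _ => false) → ∀ i l,
      Flip.fwd (L ++ copies) s (.inl (i, l)) = Flip.fwd L s (w i l) := by
    intro s hs₁ hs₂ i l
    obtain ⟨h1, -⟩ := hLw s fun a => congrFun hs₂ a
    obtain ⟨-, h2⟩ := Flip.fwd_copies (fun p : Fin n × Fin m => w p.1 p.2)
      (fun p => (.inl p : κ)) hsrc Sum.inl_injective (Finset.univ : Finset (Fin n × Fin m)).toList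
      (Finset.nodup_toList _) (Flip.fwd L s)
    rw [Flip.fwd_append]
    refine (h2 (i, l) (by simp)).trans ?_
    have h3 : Flip.fwd L s (.inl (i, l)) = false :=
      (h1 _ fun a h => by cases h).trans (congrFun hs₁ (i, l))
    rw [h3, Bool.false_xor]
  let fails : (Fin T → RW → Bool) → Fin n → Prop := fun Z i =>
    T ≤ 2 * (Finset.univ.filter fun t => bitsToNat (fun l => Z t (reading i l)) ∉ G i).card
  have hfail : ∀ s : κ → Bool, (RegWire.split s).1 = (fun _ => false) →
      (RegWire.split s).2.2 = (fun _ => false) →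
      (fun i => fixedPoint offset scale fun l => Flip.fwd (L ++ copies) s (.inl (i, l))) ∈ S →
      ∃ i, fails (RegWire.split s).2.1 i := by
    intro s hs₁ hs₂ hs
    by_contra! h
    refine hS _ hs fun i => ⟨bitsToNat fun l => Flip.fwd L s (w i l), ?_, ?_⟩
    · refine (hLw s fun a => congrFun hs₂ a).2 i (G i) (hG i) ⟨_, fun t ht => ?_, not_le.1 (h i)⟩
      by_contra h1
      exact ht (Finset.mem_filter.2 ⟨Finset.mem_univ t, h1⟩)
    · simp only [fixedPoint, hout s hs₁ hs₂]
  classical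
  have hsum : A.outputProb U S ≤
      ∑ Z : Fin T → RW → Bool, if ∃ i, fails Z i then ∏ t, p (Z t) else 0 := by
    rw [hA₃, WireOp.run_append, hruns, Flip.run_circuit,
      ← Equiv.sum_comp (Flip.fwdEquiv (L ++ copies)), ← Equiv.sum_comp RegWire.split.symm,
      Fintype.sum_prod_type]
    simp only [Fintype.sum_prod_type]
    calc _ ≤ ∑ o : Fin n × Fin m → Bool, ∑ Z : Fin T → RW → Bool, ∑ z : Fin N → Bool,
          (if ∃ i, fails Z i then ∏ t, p (Z t) else 0) * ‖zeroAmp z‖ ^ 2 * ‖zeroAmp o‖ ^ 2 := by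
          refine Finset.sum_le_sum fun o _ => Finset.sum_le_sum fun Z _ =>
            Finset.sum_le_sum fun z _ => ?_
          set s : κ → Bool := RegWire.split.symm (o, Z, z)
          have hs : RegWire.split s = (o, Z, z) := RegWire.split.apply_symm_apply _
          have h0 : 0 ≤ ∏ t, p (Z t) := Finset.prod_nonneg fun t _ => by positivity
          have h1 : ‖(∏ t, Φ (s ∘ run t)) * ψ s‖ ^ 2 =
              (∏ t, p (Z t)) * ‖zeroAmp z‖ ^ 2 * ‖zeroAmp o‖ ^ 2 := by
            simp only [ψ, hs, p]
            rw [norm_mul, norm_mul, norm_prod, mul_pow, mul_pow, ← Finset.prod_pow]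
            have h2 : ∀ t, s ∘ run t = Z t := fun t => rfl
            simp only [h2]
            ring
          have h3 : Flip.bwd (L ++ copies) (Flip.fwdEquiv (L ++ copies) s) = s := Flip.bwd_fwd _ _
          rw [Set.indicator_apply, h3, h1]
          by_cases ho : o = fun _ => false
          · by_cases hz : z = fun _ => false
            · split
              · next hmem =>
                have h4 : ∃ i, fails Z i := by
                  have := hfail s (by rw [hs]; exact ho) (by rw [hs]; exact hz) hmem
                  rwa [hs] at this
                rw [if_pos h4]
              · split <;> positivity
            · simp [zeroAmp_eq, hz]
          · simp [zeroAmp_eq, ho]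
      _ = _ := by
          have h1 : ∀ o : Fin n × Fin m → Bool, ∑ Z : Fin T → RW → Bool, ∑ z : Fin N → Bool,
              (if ∃ i, fails Z i then ∏ t, p (Z t) else 0) * ‖zeroAmp z‖ ^ 2 * ‖zeroAmp o‖ ^ 2 =
              (∑ Z : Fin T → RW → Bool, if ∃ i, fails Z i then ∏ t, p (Z t) else 0) *
                ‖zeroAmp o‖ ^ 2 := by
            intro o
            rw [Finset.sum_mul]
            refine Finset.sum_congr rfl fun Z _ => ?_
            rw [← Finset.sum_mul]
            congr 1
            exact sum_mul_normSq_zeroAmp fun _ => _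
          rw [Finset.sum_congr rfl fun o _ => h1 o]
          exact sum_mul_normSq_zeroAmp fun _ => _
  refine hsum.trans ?_
  calc _ ≤ ∑ Z : Fin T → RW → Bool, ∑ i, if fails Z i then ∏ t, p (Z t) else 0 := by
        refine Finset.sum_le_sum fun Z _ => ?_
        have h0 : 0 ≤ ∏ t, p (Z t) := Finset.prod_nonneg fun t _ => by positivity
        split
        · next h =>
          obtain ⟨i, hi⟩ := h
          have h1 : (if fails Z i then ∏ t, p (Z t) else 0) ≤
              ∑ i, if fails Z i then ∏ t, p (Z t) else 0 :=
            Finset.single_le_sum (f := fun i => if fails Z i then ∏ t, p (Z t) else 0)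
              (fun i _ => by split <;> simp [h0]) (Finset.mem_univ i)
          rwa [if_pos hi] at h1
        · exact Finset.sum_nonneg fun i _ => by split <;> simp [h0]
    _ = ∑ i, ∑ Z : Fin T → RW → Bool, if fails Z i then ∏ t, p (Z t) else 0 := Finset.sum_comm
    _ ≤ ∑ _i : Fin n, (4 / 3 / Real.sqrt 2) ^ T := by
        refine Finset.sum_le_sum fun i _ => ?_
        have h1 := sum_prod_majority_bad_le p (fun s => by positivity) hp1
          (fun s => bitsToNat (fun l => s (reading i l)) ∉ G i) (hprob i) T
        refine le_trans (le_of_eq ?_) h1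
        refine Finset.sum_congr rfl fun Z _ => ?_
        congr 1
    _ = _ := by simp

/-! ### The grid -/

theorem gridPoint_injective {n k : ℕ} :
    Function.Injective (gridPoint : (Fin n × Fin k → Bool) → Fin n → ℝ) := by
  intro x y h
  funext ⟨i, j⟩
  have h1 := congrFun h i
  simp only [gridPoint, gridCoord] at h1
  have h2 : (2 : ℝ) ^ k ≠ 0 := by positivity
  have h3 : ((bitsToNat fun j => x (i, j) : ℕ) : ℝ) = (bitsToNat fun j => y (i, j) : ℕ) := by
    have h4 := add_right_cancel h1
    rw [sub_left_inj, div_left_inj' h2] at h4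
    exact h4
  exact congrFun (bitsToNat_injective _ (Nat.cast_injective h3)) j

theorem image_gridPoint (n k : ℕ) :
    (Finset.univ : Finset (Fin n × Fin k → Bool)).image gridPoint = hyperGrid n k := by
  refine Finset.eq_of_subset_of_card_le ?_ ?_
  · intro p hp
    obtain ⟨x, -, rfl⟩ := Finset.mem_image.1 hp
    exact Fintype.mem_piFinset.2 fun i => Finset.mem_image_of_mem _
      (Finset.mem_range.2 (bitsToNat_lt _))
  · rw [Finset.card_image_of_injective _ gridPoint_injective, hyperGrid,
      Fintype.card_piFinset_const]
    have h1 : (grid k).card ≤ 2 ^ k := Finset.card_image_le.trans (by simp)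
    refine (Nat.pow_le_pow_left h1 n).trans (le_of_eq ?_)
    rw [Finset.card_univ, Fintype.card_fun, Fintype.card_bool, Fintype.card_prod, Fintype.card_fin,
      Fintype.card_fin, ← pow_mul, mul_comm]

theorem card_filter_hyperGrid (n k : ℕ) (P : (Fin n → ℝ) → Prop) [DecidablePred P] :
    {x ∈ hyperGrid n k | P x}.card =
      (Finset.univ.filter fun x : Fin n × Fin k → Bool => P (gridPoint x)).card := by
  rw [← image_gridPoint, Finset.filter_image, Finset.card_image_of_injective _ gridPoint_injective]

/-- The phase of a linear function on the grid is a linear phase in the indices of the grid points,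
up to a constant that comes from the centering of the grid. -/
theorem linearPhase_add {n m : ℕ} (φ : Fin n → ℝ) (x : Fin n × Fin m → Bool) :
    linearPhase φ x + 2 * Real.pi * ((∑ i, φ i) * (1 / 2 ^ (m + 1) - 1 / 2)) =
      2 * Real.pi * (φ ⬝ᵥ gridPoint x) := by
  have h1 : ∀ i, (∑ l : Fin m, if x (i, l.rev) then 2 * Real.pi * φ i / 2 ^ ((l : ℕ) + 1) else 0) =
      2 * Real.pi * (φ i * ((bitsToNat fun j => x (i, j) : ℕ) / 2 ^ m)) := by
    intro i
    rw [← Equiv.sum_comp Fin.revPerm]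
    simp only [Fin.revPerm_apply, Fin.rev_rev, bitsToNat]
    push_cast
    rw [Finset.sum_div, Finset.mul_sum, Finset.mul_sum]
    refine Finset.sum_congr rfl fun j _ => ?_
    split
    · have h2 : (2 : ℝ) ^ m = 2 ^ (j : ℕ) * 2 ^ ((j.rev : ℕ) + 1) := by
        rw [← pow_add]
        congr 1
        rw [Fin.val_rev]
        omega
      rw [h2]
      field_simp
    · simp
  simp only [linearPhase, h1]
  rw [← Finset.mul_sum, ← mul_add, Finset.sum_mul, ← Finset.sum_add_distrib, dotProduct]
  congr 1
  refine Finset.sum_congr rfl fun i _ => ?_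
  simp only [gridPoint, gridCoord]
  ring

/-! ### The gradient algorithm -/

/-- The phase `2π f / (112 π δ)` turns the tolerance `δ` into `1 / 56` and the gradient into
frequencies of modulus at most `2 ^ m / 4`. Resolving each frequency up to `3` yields the gradient
up to `3 · 112 π δ / r`. -/
theorem exists_gradientAlgorithm (n m b w q T d : ℕ) (hT : T + 1 = 2 ^ (q + 1)) (hm : 4 ≤ m)
    (hd : 700 * m ≤ 2 ^ d) (δ B r a₀ a : ℝ) (hδ : 0 < δ) (hr : 0 < r)
    (hB : B ≤ 28 * Real.pi * δ * 2 ^ m) :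
    ∃ A : QueryAlgorithm ((Fin n × Fin m) ⊕ Fin b ⊕ Fin w) n,
      A.queryCount = T * 254 ∧
      A.gateCount ≤ T * (n * m + 254 + (88 * medianCost 6 b + b) + n * (m * (d + 2))) +
        11 * (4 * (n * medianCost q m) + n * m) ∧
      ∀ (x₀ g : Fin n → ℝ) (c : ℝ) (f : (Fin n → ℝ) → ℝ)
        (U : Matrix ((Fin n × Fin m) ⊕ Fin b ⊕ Fin w → Bool)
          ((Fin n × Fin m) ⊕ Fin b ⊕ Fin w → Bool) ℂ),
        ‖g‖ ≤ B / r →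
        (999 / 1000 : ℝ) * ((hyperGrid n m).card : ℝ) ≤
          ({x ∈ hyperGrid n m | |f (x₀ + r • x) - g ⬝ᵥ (r • x) - c| ≤ δ}.card : ℝ) →
        IsUnitaryApproximator a₀ a δ (fun x => f (x₀ + r • gridPoint x)) U →
        A.outputProb U {v | 8 * 42 * Real.pi * δ / r < ‖v - g‖} ≤
          n * (4 / 3 / Real.sqrt 2) ^ T := by
  have hπ := Real.pi_pos
  obtain ⟨σ, hσ⟩ : ∃ σ, σ = 1 / (112 * Real.pi * δ) := ⟨_, rfl⟩
  have hσ0 : 0 < σ := by rw [hσ]; positivity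
  have hσδ : 2 * Real.pi * σ * δ = 1 / 56 := by
    rw [hσ]
    field_simp
    norm_num
  obtain ⟨C, hC₁, hC₂, hC₃⟩ := exists_run n m b w d 127 (1 * medianCost 6 b) (by norm_num) rfl hm hd
    a₀ a σ δ hσ0.le hσδ.le
  obtain ⟨A, hA₁, hA₂, hA₃⟩ := exists_medianAlgorithm q T hT C (fun i l => .inl (i, l.rev))
    (-(2 ^ m / 2) / (σ * r)) (1 / (σ * r))
  refine ⟨A, by rw [hA₁, hC₁], hA₂.trans ?_, ?_⟩
  · gcongr
    refine hC₂.trans (le_of_eq ?_)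
    ring
  intro x₀ g c f U hg hcard hU
  obtain ⟨φ, hφ⟩ : ∃ φ : Fin n → ℝ, φ = fun i => σ * r * g i := ⟨_, rfl⟩
  have hφle : ∀ i, |φ i| ≤ 2 ^ m / 4 := by
    intro i
    have h1 : |g i| ≤ B / r := (norm_le_pi_norm g i).trans hg
    rw [hφ]
    simp only
    rw [abs_mul, abs_of_pos (by positivity : 0 < σ * r)]
    calc σ * r * |g i| ≤ σ * r * (B / r) := by gcongr
      _ = σ * B := by field_simp
      _ ≤ σ * (28 * Real.pi * δ * 2 ^ m) := by gcongr
      _ = 2 ^ m / 4 := by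
        rw [hσ]
        field_simp
        norm_num
  obtain ⟨μ, hμ⟩ : ∃ μ, μ = 2 * Real.pi * σ * c +
      2 * Real.pi * ((∑ i, φ i) * (1 / 2 ^ (m + 1) - 1 / 2)) := ⟨_, rfl⟩
  have hgood : (999 / 1000 : ℝ) * Fintype.card (Fin n × Fin m → Bool) ≤
      ((Finset.univ.filter fun x : Fin n × Fin m → Bool =>
        |2 * Real.pi * σ * f (x₀ + r • gridPoint x) - (μ + linearPhase φ x)| ≤ 1 / 56).card : ℝ) := by
    have h1 : (hyperGrid n m).card = Fintype.card (Fin n × Fin m → Bool) := by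
      rw [← image_gridPoint, Finset.card_image_of_injective _ gridPoint_injective, Finset.card_univ]
    rw [h1, card_filter_hyperGrid] at hcard
    refine hcard.trans (Nat.cast_le.2 (Finset.card_le_card fun x hx => ?_))
    simp only [Finset.mem_filter, Finset.mem_univ, true_and] at hx ⊢
    have h2 : φ ⬝ᵥ gridPoint x = σ * (g ⬝ᵥ (r • gridPoint x)) := by
      simp only [dotProduct, hφ, Finset.mul_sum, Pi.smul_apply, smul_eq_mul]
      exact Finset.sum_congr rfl fun i _ => by ring
    have h3 : 2 * Real.pi * σ * f (x₀ + r • gridPoint x) - (μ + linearPhase φ x) =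
        2 * Real.pi * σ * (f (x₀ + r • gridPoint x) - g ⬝ᵥ (r • gridPoint x) - c) := by
      have := linearPhase_add φ x
      rw [h2] at this
      rw [hμ]
      linear_combination -this
    rw [h3, abs_mul, abs_of_pos (by positivity), ← hσδ]
    gcongr
  have hrun := hC₃ U _ φ μ hU hφle hgood
  classical
  refine hA₃ U hU.1 (fun i => {k : ℕ | |φ i + 2 ^ m / 2 - k| ≤ 3}) (fun i => ?_) (fun i => ?_) _ ?_
  · simpa using ordConnected_abs_sub_le (φ i + 2 ^ m / 2) 0 1 3
  · simpa only [Set.mem_ofPred_eq, not_le] using hrun i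
  · intro v hv h
    refine not_le.2 hv ((pi_norm_le_iff_of_nonneg (by positivity)).2 fun i => ?_)
    obtain ⟨k, hk, hvk⟩ := h i
    have h1 : (v - g) i = -(φ i + 2 ^ m / 2 - k) / (σ * r) := by
      rw [Pi.sub_apply, hvk, hφ]
      field_simp
      ring
    have h2 : 8 * 42 * Real.pi * δ / r = 3 / (σ * r) := by
      rw [hσ]
      field_simp
      norm_num
    rw [h1, h2, Real.norm_eq_abs, abs_div, abs_neg, abs_of_pos (by positivity : 0 < σ * r)]
    gcongr
    exact hk

/-! ### Number of repetitions and gate count -/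

/-- A number of repetitions that is logarithmic in `n / ρ` and brings the failure probability
below `ρ`. -/
theorem exists_repetitions (n : ℕ) (ρ : ℝ) (hn : 1 ≤ n) (hρ : 0 < ρ) (hρ' : ρ ≤ 1 / 3) :
    1 ≤ Real.log (n / ρ) ∧ 1 / 20 ≤ Real.log (Real.log (n / ρ)) ∧
    ∃ q T : ℕ, T + 1 = 2 ^ (q + 1) ∧ (T : ℝ) ≤ 38 * Real.log (n / ρ) ∧
      (2 * q + 7 : ℝ) ≤ 344 * Real.log (Real.log (n / ρ)) ∧
      n * (4 / 3 / Real.sqrt 2) ^ T ≤ ρ := by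
  have hn1 : (1 : ℝ) ≤ n := by exact_mod_cast hn
  have hy : 0 < (n : ℝ) / ρ := by positivity
  have hy3 : 3 ≤ (n : ℝ) / ρ := by
    rw [le_div_iff₀ hρ]
    linarith
  have hlog3 : 1.09 ≤ Real.log 3 := by
    have h1 := Real.one_sub_inv_le_log_of_pos (x := 3 / Real.exp 1) (by positivity)
    rw [Real.log_div (by norm_num) (Real.exp_pos 1).ne', Real.log_exp, inv_div] at h1
    have := Real.exp_one_lt_d9
    linarith
  obtain ⟨ℓ, hℓ⟩ : ∃ ℓ, ℓ = Real.log (n / ρ) := ⟨_, rfl⟩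
  rw [← hℓ]
  have hℓ1 : 1.09 ≤ ℓ := hlog3.trans (hℓ ▸ Real.log_le_log (by norm_num) hy3)
  have hℓ0 : 0 < ℓ := by linarith
  have hlogℓ : 1 / 20 ≤ Real.log ℓ := by
    have h1 := Real.one_sub_inv_le_log_of_pos hℓ0
    have h2 : ℓ⁻¹ ≤ (1.09 : ℝ)⁻¹ := inv_anti₀ (by norm_num) hℓ1
    norm_num at h2
    linarith
  refine ⟨by linarith, hlogℓ, ?_⟩
  -- The failure probability of the median is at most `exp (-(T / 18))`.
  obtain ⟨N, hN⟩ : ∃ N, N = ⌈18 * ℓ⌉₊ := ⟨_, rfl⟩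
  have hN1 : 18 * ℓ ≤ N := hN ▸ Nat.le_ceil _
  have hN2 : (N : ℝ) < 18 * ℓ + 1 := hN ▸ Nat.ceil_lt_add_one (by positivity)
  have hN0 : N ≠ 0 := by
    rintro rfl
    simp only [Nat.cast_zero] at hN1
    linarith
  obtain ⟨q, hq⟩ : ∃ q, q = Nat.log 2 N := ⟨_, rfl⟩
  have hq1 : 2 ^ q ≤ N := hq ▸ Nat.pow_log_le_self 2 hN0
  have hq2 : N < 2 ^ (q + 1) := hq ▸ Nat.lt_pow_succ_log_self (by norm_num) N
  have hq1' : (2 : ℝ) ^ q ≤ N := by exact_mod_cast hq1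
  obtain ⟨T, hT⟩ : ∃ T, T + 1 = 2 ^ (q + 1) := ⟨2 ^ (q + 1) - 1, Nat.sub_add_cancel Nat.one_le_two_pow⟩
  have hT' : (T : ℝ) + 1 = 2 ^ (q + 1) := by exact_mod_cast hT
  have hTN : (N : ℝ) ≤ T := by
    have : N ≤ T := by omega
    exact_mod_cast this
  refine ⟨q, T, hT, ?_, ?_, ?_⟩
  · rw [pow_succ] at hT'
    linarith
  · have h1 : (2 : ℝ) ^ q ≤ 2 ^ 5 * ℓ := by linarith
    have h2 := Real.log_le_log (by positivity) h1
    rw [Real.log_mul (by positivity) hℓ0.ne', Real.log_pow, Real.log_pow] at h2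
    have h3 := Real.log_two_gt_d9
    have h4 : ((q : ℝ) - 5) * Real.log 2 ≤ Real.log ℓ := by
      push_cast at h2
      linarith
    have h5 : (q : ℝ) ≤ 5 + 2 * Real.log ℓ := by
      by_contra! h6
      nlinarith
    linarith
  · have h1 : 4 / 3 / Real.sqrt 2 ≤ Real.exp (-(1 / 18)) := by
      refine le_of_sq_le_sq ?_ (Real.exp_pos _).le
      rw [← Real.exp_nat_mul, div_pow, Real.sq_sqrt (by norm_num)]
      have := Real.add_one_le_exp (((2 : ℕ) : ℝ) * -(1 / 18))
      norm_num at this ⊢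
      linarith
    calc n * (4 / 3 / Real.sqrt 2) ^ T ≤ n * Real.exp (-(1 / 18)) ^ T := by gcongr
      _ = n * Real.exp (-(T / 18)) := by rw [← Real.exp_nat_mul]; ring_nf
      _ ≤ n * Real.exp (-ℓ) := by
        gcongr
        linarith
      _ = ρ := by
        rw [Real.exp_neg, hℓ, Real.exp_log hy]
        field_simp

/-- The gate count in terms of `ℓ = log (n / ρ)`, `Λ = log (B / δ)`, `l₁ = log ℓ` and `l₂ = log Λ`. The
factor `l₁`, which may be smaller than `1`, is at least `1/20` because `n / ρ ≥ 3`. -/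
theorem gateCount_bound (n m b q T d : ℕ) (K ℓ Λ l₁ l₂ : ℝ) (hT : T + 1 = 2 ^ (q + 1))
    (hn : 1 ≤ n) (hℓ : 1 ≤ ℓ) (hΛ : 1 ≤ Λ) (hl₁ : 1 / 20 ≤ l₁) (hl₂ : 1 ≤ l₂) (hK : 0 ≤ K)
    (hTℓ : (T : ℝ) ≤ 38 * ℓ) (hq : (2 * q + 7 : ℝ) ≤ 344 * l₁) (hm : (m : ℝ) ≤ 2 * Λ)
    (hd : (d + 2 : ℝ) ≤ 16 * l₂) (hb : (b : ℝ) ≤ K * Λ) :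
    ((T * (n * m + 254 + (88 * medianCost 6 b + b) + n * (m * (d + 2))) +
        11 * (4 * (n * medianCost q m) + n * m) : ℕ) : ℝ) ≤
      (760 * (376 + 212433 * K) + 1153416) * (n * ℓ * Λ * l₁ * l₂) := by
  have hn1 : (1 : ℝ) ≤ n := by exact_mod_cast hn
  have hTq : 2 ^ (q + 1) - 1 = T := by omega
  have hl₁' : 0 < l₁ := by linarith
  have h20 : 1 ≤ 20 * l₁ := by linarith
  have hnΛ : 1 ≤ n * Λ := one_le_mul_of_one_le_of_one_le hn1 hΛ
  have hnΛl : 1 ≤ n * Λ * l₂ := one_le_mul_of_one_le_of_one_le hnΛ hl₂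
  have hΛl : Λ ≤ Λ * l₂ := le_mul_of_one_le_right (by linarith) hl₂
  have hΛn : Λ * l₂ ≤ n * Λ * l₂ := by
    rw [mul_assoc]
    exact le_mul_of_one_le_left (by positivity) hn1
  have hnΛ' : n * Λ ≤ n * Λ * l₂ := le_mul_of_one_le_right (by positivity) hl₂
  have hC : (n * m + 254 + (88 * medianCost 6 b + b) + n * (m * (d + 2)) : ℝ) ≤
      (376 + 212433 * K) * (n * Λ * l₂) := by
    have h1 : (n * m : ℝ) ≤ 2 * (n * Λ * l₂) := by
      calc (n * m : ℝ) ≤ n * (2 * Λ) := by gcongr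
        _ = 2 * (n * Λ) := by ring
        _ ≤ _ := by gcongr
    have h2 : (n * (m * (d + 2)) : ℝ) ≤ 32 * (n * Λ * l₂) := by
      calc (n * (m * (d + 2)) : ℝ) ≤ n * (2 * Λ * (16 * l₂)) := by gcongr
        _ = _ := by ring
    have h3 : (b : ℝ) ≤ K * (n * Λ * l₂) := hb.trans (by gcongr; exact hΛl.trans hΛn)
    have h4 : (medianCost 6 b : ℝ) = 1 + 2414 * b := by
      simp only [medianCost]
      push_cast
      norm_num
      ring
    rw [h4]
    linarith
  have hX : n * ℓ * Λ * l₂ ≤ 20 * (n * ℓ * Λ * l₁ * l₂) := by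
    calc n * ℓ * Λ * l₂ ≤ (20 * l₁) * (n * ℓ * Λ * l₂) :=
          le_mul_of_one_le_left (by positivity) h20
      _ = _ := by ring
  have hY : n * Λ * l₂ ≤ n * ℓ * Λ * l₂ := by
    have : n * ℓ * Λ * l₂ = ℓ * (n * Λ * l₂) := by ring
    rw [this]
    exact le_mul_of_one_le_left (by positivity) hℓ
  have hM : (n * medianCost q m : ℝ) ≤ 26204 * (n * ℓ * Λ * l₁ * l₂) := by
    have h1 : (medianCost q m : ℝ) = 1 + m * (T * (2 * q + 7) + 1) := by
      simp only [medianCost, hTq]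
      push_cast
      ring
    have h2 : (m * (T * (2 * q + 7) + 1) : ℝ) ≤ 2 * Λ * (38 * ℓ * (344 * l₁) + 1) := by gcongr
    rw [h1]
    have h3 : n * ℓ * Λ * l₁ ≤ n * ℓ * Λ * l₁ * l₂ := le_mul_of_one_le_right (by positivity) hl₂
    have h4 : (n : ℝ) ≤ n * Λ := le_mul_of_one_le_right (by positivity) hΛ
    calc (n * (1 + m * (T * (2 * q + 7) + 1)) : ℝ)
        ≤ n * (1 + 2 * Λ * (38 * ℓ * (344 * l₁) + 1)) := by gcongr
      _ = n + 26144 * (n * ℓ * Λ * l₁) + 2 * (n * Λ) := by ring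
      _ ≤ _ := by linarith
  have hnm : (n * m : ℝ) ≤ 40 * (n * ℓ * Λ * l₁ * l₂) := by
    calc (n * m : ℝ) ≤ n * (2 * Λ) := by gcongr
      _ = 2 * (n * Λ) := by ring
      _ ≤ _ := by linarith
  push_cast
  calc _ ≤ 38 * ℓ * ((376 + 212433 * K) * (n * Λ * l₂)) +
        11 * (4 * (26204 * (n * ℓ * Λ * l₁ * l₂)) + 40 * (n * ℓ * Λ * l₁ * l₂)) := by gcongr
    _ = 38 * (376 + 212433 * K) * (n * ℓ * Λ * l₂) + 1153416 * (n * ℓ * Λ * l₁ * l₂) := by ring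
    _ ≤ 38 * (376 + 212433 * K) * (20 * (n * ℓ * Λ * l₁ * l₂)) +
        1153416 * (n * ℓ * Λ * l₁ * l₂) := by gcongr
    _ = _ := by ring

/-- The algorithm without any gates, which always outputs `0`. -/
theorem exists_zeroAlgorithm (Q : Type) (n : ℕ) : ∃ A : QueryAlgorithm Q n, A.queryCount = 0 ∧
    A.gateCount = 0 ∧ ∀ z, A.output z = 0 := by
  refine ⟨⟨0, [], 0, ⟨fun p => p.2.elim0, fun p => p.2.elim0⟩, 0, 0⟩, rfl, rfl, fun z => ?_⟩
  funext i
  simp [QueryAlgorithm.output, fixedPoint]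

/-! ### The theorem on gradient computation -/

theorem mainTheorem9 :
    ∃ Cq : ℝ, ∀ K : ℝ, ∃ Cg : ℝ,
      ∀ (n m b w : ℕ) (δ B r ρ a₀ a : ℝ),
        1 ≤ n → 0 < δ → 0 < B → 0 < r → 0 < ρ → ρ ≤ 1 / 3 →
        (m : ℤ) = ⌈Real.logb 2 (B / (28 * Real.pi * δ))⌉ →
        (b : ℝ) ≤ K * Real.log (B / δ) →
        ∃ A : QueryAlgorithm ((Fin n × Fin m) ⊕ Fin b ⊕ Fin w) n,
          (A.queryCount : ℝ) ≤ Cq * Real.log (n / ρ) ∧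
          (A.gateCount : ℝ) ≤ Cg * (n * Real.log (n / ρ) * Real.log (B / δ) *
            Real.log (Real.log (n / ρ)) * Real.log (Real.log (B / δ))) ∧
          ∀ (x₀ g : Fin n → ℝ) (c : ℝ) (f : (Fin n → ℝ) → ℝ)
            (U : Matrix ((Fin n × Fin m) ⊕ Fin b ⊕ Fin w → Bool)
              ((Fin n × Fin m) ⊕ Fin b ⊕ Fin w → Bool) ℂ),
            ‖g‖ ≤ B / r →
            (999 / 1000 : ℝ) * ((hyperGrid n m).card : ℝ) ≤
              ({x ∈ hyperGrid n m | |f (x₀ + r • x) - g ⬝ᵥ (r • x) - c| ≤ δ}.card : ℝ) →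
            IsUnitaryApproximator a₀ a δ (fun x => f (x₀ + r • gridPoint x)) U →
            A.outputProb U {v | 8 * 42 * Real.pi * δ / r < ‖v - g‖} ≤ ρ := by

  -- Each of the at most `38 * log (n / ρ)` runs makes `127` queries and as many adjoint queries.
  refine ⟨9652, fun K => ⟨760 * (376 + 212433 * |K|) + 1153416, ?_⟩⟩
  intro n m b w δ B r ρ a₀ a hn hδ hB hr hρ hρ' hm hb
  have hπ := Real.pi_gt_three
  obtain ⟨hℓ, hl₁, q, T, hT, hTℓ, hq, hfail⟩ := exists_repetitions n ρ hn hρ hρ'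
  obtain ⟨y, hy⟩ : ∃ y, y = B / (28 * Real.pi * δ) := ⟨_, rfl⟩
  rw [← hy] at hm
  have hy0 : 0 < y := by rw [hy]; positivity
  have hBy : B / δ = 28 * Real.pi * y := by
    rw [hy]
    field_simp
  have hm₁ : Real.logb 2 y ≤ m := by
    have := Int.le_ceil (Real.logb 2 y)
    rw [← hm] at this
    exact_mod_cast this
  have hm₂ : (m : ℝ) < Real.logb 2 y + 1 := by
    have := Int.ceil_lt_add_one (Real.logb 2 y)
    rw [← hm] at this
    exact_mod_cast this
  have hy₁ : y ≤ 2 ^ m := by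
    rw [Real.logb_le_iff_le_rpow (by norm_num) hy0, Real.rpow_natCast] at hm₁
    exact hm₁
  have hy₂ : 1 / 2 ≤ y := by
    have h1 : -1 ≤ Real.logb 2 y := by
      have : (0 : ℝ) ≤ m := Nat.cast_nonneg m
      linarith
    rw [Real.le_logb_iff_rpow_le (by norm_num) hy0, Real.rpow_neg_one] at h1
    linarith
  have hexp3 : Real.exp 3 ≤ 28 * 3 / 2 := by
    have h1 : Real.exp 3 = Real.exp 1 ^ 3 := by rw [← Real.exp_nat_mul]; norm_num
    rw [h1]
    calc Real.exp 1 ^ 3 ≤ 3 ^ 3 := by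
          gcongr
          linarith [Real.exp_one_lt_d9]
      _ ≤ _ := by norm_num
  have hBδ : Real.exp 3 ≤ B / δ := by
    rw [hBy]
    calc Real.exp 3 ≤ 28 * 3 * (1 / 2) := by linarith
      _ ≤ 28 * Real.pi * y := by gcongr
  have hBδ0 : 0 < B / δ := by positivity
  have hΛ : 3 ≤ Real.log (B / δ) := (Real.le_log_iff_exp_le hBδ0).2 hBδ
  have hl₂ : 1 ≤ Real.log (Real.log (B / δ)) :=
    (Real.le_log_iff_exp_le (by linarith)).2 (by linarith [Real.exp_one_lt_d9])
  have hBm : B ≤ 28 * Real.pi * δ * 2 ^ m := by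
    have h1 : B = 28 * Real.pi * δ * y := by
      rw [hy]
      field_simp
    rw [h1]
    gcongr
  rcases le_or_gt m 3 with hm3 | hm3
  · -- The tolerance exceeds the a priori bound on the gradient.
    obtain ⟨A, hA₁, hA₂, hA₃⟩ := exists_zeroAlgorithm ((Fin n × Fin m) ⊕ Fin b ⊕ Fin w) n
    refine ⟨A, ?_, ?_, ?_⟩
    · rw [hA₁, Nat.cast_zero]
      positivity
    · rw [hA₂, Nat.cast_zero]
      have : 0 < Real.log (n / ρ) := by linarith
      have : 0 < Real.log (B / δ) := by linarith
      have : 0 < Real.log (Real.log (n / ρ)) := by linarith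
      positivity
    · intro x₀ g c f U hg _ _
      have h1 : ‖0 - g‖ ≤ 8 * 42 * Real.pi * δ / r := by
        rw [zero_sub, norm_neg]
        refine hg.trans ?_
        gcongr
        have h2 : (2 : ℝ) ^ m ≤ 2 ^ 3 := pow_le_pow_right₀ (by norm_num) hm3
        calc B ≤ 28 * Real.pi * δ * 2 ^ m := hBm
          _ ≤ 28 * Real.pi * δ * 2 ^ 3 := by gcongr
          _ ≤ 8 * 42 * Real.pi * δ := by nlinarith [mul_pos Real.pi_pos hδ]
      refine le_of_eq_of_le (Finset.sum_eq_zero fun z _ => Set.indicator_of_notMem ?_ _) hρ.le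
      rw [Set.mem_preimage, hA₃]
      exact not_lt.2 h1
  -- `B / δ` exceeds `y` by the factor `28 * π`, which absorbs the rounding in `m`.
  have hlogm : (m : ℝ) ≤ 2 * Real.log (B / δ) := by
    have h1 : Real.log y ≤ Real.log (B / δ) - 1 := by
      rw [le_sub_iff_add_le, ← Real.log_exp 1, ← Real.log_mul hy0.ne' (Real.exp_pos 1).ne', hBy,
        mul_comm]
      refine Real.log_le_log (by positivity) ?_
      gcongr
      linarith [Real.exp_one_lt_d9]
    have h2 : Real.logb 2 y * Real.log 2 = Real.log y :=
      div_mul_cancel₀ _ (Real.log_pos (by norm_num)).ne'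
    have h3 : (3 : ℝ) ≤ Real.logb 2 y := by
      have : (4 : ℝ) ≤ m := by exact_mod_cast hm3
      linarith
    nlinarith [Real.log_two_gt_d9]
  obtain ⟨d, hd⟩ : ∃ d, d = Nat.log 2 m + 11 := ⟨_, rfl⟩
  have hd₁ : 700 * m ≤ 2 ^ d := by
    have h1 := Nat.lt_pow_succ_log_self (b := 2) (by norm_num) m
    rw [hd, show Nat.log 2 m + 11 = (Nat.log 2 m).succ + 10 by omega, pow_add]
    omega
  have hd₂ : (d + 2 : ℝ) ≤ 16 * Real.log (Real.log (B / δ)) := by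
    have h1 : (2 : ℝ) ^ Nat.log 2 m ≤ 2 * Real.log (B / δ) := by
      have : 2 ^ Nat.log 2 m ≤ m := Nat.pow_log_le_self 2 (by omega)
      exact le_trans (by exact_mod_cast this) hlogm
    have h2 := Real.log_le_log (by positivity) h1
    rw [Real.log_pow, Real.log_mul (by norm_num) (by linarith)] at h2
    have h3 : (Nat.log 2 m : ℝ) ≤ 1 + 2 * Real.log (Real.log (B / δ)) := by
      by_contra! h4
      nlinarith [Real.log_two_gt_d9]
    rw [hd]
    push_cast
    linarith
  have hbK : (b : ℝ) ≤ |K| * Real.log (B / δ) := hb.trans (by gcongr; exact le_abs_self K)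
  obtain ⟨A, hA₁, hA₂, hA₃⟩ := exists_gradientAlgorithm n m b w q T d hT hm3 hd₁ δ B r a₀ a hδ hr hBm
  refine ⟨A, ?_, ?_, fun x₀ g c f U hg hf hU => (hA₃ x₀ g c f U hg hf hU).trans hfail⟩
  · rw [hA₁]
    push_cast
    linarith
  · exact (Nat.cast_le.2 hA₂).trans (gateCount_bound n m b q T d |K| _ _ _ _ hT hn hℓ (by linarith)
      hl₁ hl₂ (abs_nonneg K) hTℓ hq hlogm hd₂ hbK)
end
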